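/- Fix a dimension $d\ge 2$. A box in $\mathbb{R}^d$ is a set $\prod_{i=1}^d[\alpha_i,\beta_i]$. In the randomized real RAM model (exact real arithmetic and comparisons, no rounding of reals to integers, integer words of $O(\log(n+m))$ bits with unit-cost arithmetic, unit-cost random access to memory, and a unit-cost instruction that returns a uniformly random integer in $\{0,\dots,k\}$ for a given word $k$), there is an algorithm with the following properties. Its input, stored in memory, consists of $n\ge 1$ points $P$ in $\mathbb{R}^d$, a parameter $\varepsilon\in(0,1)$, and a family $\mathcal{B}$ of $m\ge 1$ boxes in $\mathbb{R}^d$, each of which contains at least $\varepsilon n$ points of $P$. It always outputs, when it halts, a weak $\varepsilon$-net of the range space $(P,\mathcal{B})$, that is, a finite set $\mathcal{N}\subset\mathbb{R}^d$ (not necessarily a subset of $P$) that contains a point of every box of $\mathcal{B}$ that contains at least $\varepsilon n$ points of $P$; so $\mathcal{N}$ pierces every box of $\mathcal{B}$. The size of $\mathcal{N}$ is $O(\varepsilon^{-1}\log\log\varepsilon^{-1})$, and the expected running time is $O(m\log^d\varepsilon^{-1})$, for every such input; in particular the algorithm halts with probability $1$. The program and the constants hidden in the $O$-notation depend only on $d$,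 and $\log\varepsilon^{-1}$ and $\log\log\varepsilon^{-1}$ are read as $1$ where they are smaller than $1$. -/

import Mathlib

open scoped ENNReal

/-!
A randomized real RAM, given by a small structured imperative language.

The memory consists of arrays of natural numbers and arrays of real numbers, named by natural
numbers; a program is a finite text, so it names only finitely many of them, and scalar variables
are cells at fixed positions. Cells are read and written at computed positions in one step.
Real arithmetic and comparisons of reals are exact; there is no rounding of reals to integers and
there are no real literals. The only source of randomness is a uniformly random integer in
`{0, …, k}` for a computed `k`.
-/
namespace RealRAM

/-- Natural number expressions. `get a i` is the content of cell `i` of natural number array `a`;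
subtraction is truncated and division rounds down (with `x / 0 = 0`). -/
inductive NExpr where
  | lit (k : ℕ)
  | get (a : ℕ) (i : NExpr)
  | add (x y : NExpr)
  | sub (x y : NExpr)
  | mul (x y : NExpr)
  | div (x y : NExpr)

/-- Real expressions. `get a i` is the content of cell `i` of real array `a`;
`cast x` is the real number equal to the natural number `x`. -/
inductive RExpr where
  | cast (x : NExpr)
  | get (a : ℕ) (i : NExpr)
  | add (x y : RExpr)
  | sub (x y : RExpr)
  | mul (x y : RExpr)
  | div (x y : RExpr)

/-- Tests. -/
inductive BExpr where
  | ltNat (x y : NExpr)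
  | ltReal (x y : RExpr)
  | neg (b : BExpr)
  | conj (b c : BExpr)

/-- Programs. -/
inductive Cmd where
  /-- do nothing -/
  | skip
  /-- write `x` into cell `i` of natural number array `a` -/
  | setNat (a : ℕ) (i x : NExpr)
  /-- write `x` into cell `i` of real array `a` -/
  | setReal (a : ℕ) (i : NExpr) (x : RExpr)
  /-- write a uniformly random element of `{0, …, k}` into cell `i` of natural number array `a` -/
  | rand (a : ℕ) (i k : NExpr)
  /-- first `p`, then `q` -/
  | seq (p q : Cmd)
  /-- if `b` then `p` else `q` -/
  | branch (b : BExpr) (p q : Cmd)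
  /-- while `b` do `p` -/
  | loop (b : BExpr) (p : Cmd)

/-- The content of the memory: `nat a i` and `real a i` are cells `i` of arrays `a`. -/
@[ext] structure State where
  nat : ℕ → ℕ → ℕ
  real : ℕ → ℕ → ℝ

/-- Overwrite cell `i` of natural number array `a`. -/
def State.writeNat (s : State) (a i v : ℕ) : State :=
  { s with nat := Function.update s.nat a (Function.update (s.nat a) i v) }

/-- Overwrite cell `i` of real array `a`. -/
noncomputable def State.writeReal (s : State) (a i : ℕ) (v : ℝ) : State :=
  { s with real := Function.update s.real a (Function.update (s.real a) i v) }

def NExpr.eval (s : State) : NExpr → ℕ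
  | lit k => k
  | get a i => s.nat a (i.eval s)
  | add x y => x.eval s + y.eval s
  | sub x y => x.eval s - y.eval s
  | mul x y => x.eval s * y.eval s
  | div x y => x.eval s / y.eval s

noncomputable def RExpr.eval (s : State) : RExpr → ℝ
  | cast x => (x.eval s : ℝ)
  | get a i => s.real a (i.eval s)
  | add x y => x.eval s + y.eval s
  | sub x y => x.eval s - y.eval s
  | mul x y => x.eval s * y.eval s
  | div x y => x.eval s / y.eval s

def BExpr.eval (s : State) : BExpr → Prop
  | ltNat x y => x.eval s < y.eval s
  | ltReal x y => x.eval s < y.eval s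
  | neg b => ¬ b.eval s
  | conj b c => b.eval s ∧ c.eval s

/-- A configuration: the commands that remain to be executed, in this order, and the memory. -/
structure Config where
  todo : List Cmd
  mem : State

/-- The machine has halted when nothing remains to be executed. -/
def Config.Halted (c : Config) : Prop := c.todo = []

open Classical in
/-- One step of the machine, as a distribution over the next configuration. (One step evaluates
the expressions of one command; their sizes are fixed by the program and do not depend
on its input, so one step amounts to a constant number of elementary operations.) -/
noncomputable def step : Config → PMF Config
  | ⟨[], s⟩ => PMF.pure ⟨[], s⟩
  | ⟨.skip :: k, s⟩ => PMF.pure ⟨k, s⟩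
  | ⟨.setNat a i x :: k, s⟩ => PMF.pure ⟨k, s.writeNat a (i.eval s) (x.eval s)⟩
  | ⟨.setReal a i x :: k, s⟩ => PMF.pure ⟨k, s.writeReal a (i.eval s) (x.eval s)⟩
  | ⟨.rand a i x :: k, s⟩ =>
      (PMF.uniformOfFintype (Fin (x.eval s + 1))).map
        fun r => ⟨k, s.writeNat a (i.eval s) (r : ℕ)⟩
  | ⟨.seq p q :: k, s⟩ => PMF.pure ⟨p :: q :: k, s⟩
  | ⟨.branch b p q :: k, s⟩ => PMF.pure (if b.eval s then ⟨p :: k, s⟩ else ⟨q :: k, s⟩)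
  | ⟨.loop b p :: k, s⟩ => PMF.pure (if b.eval s then ⟨p :: .loop b p :: k, s⟩ else ⟨k, s⟩)

/-- The distribution of the configuration after `t` steps from `c`. -/
noncomputable def runDist : ℕ → Config → PMF Config
  | 0, c => PMF.pure c
  | t + 1, c => (step c).bind (runDist t)

/-- The initial configuration of program `p` on memory content `s`. -/
def start (p : Cmd) (s : State) : Config := ⟨[p], s⟩

/-- The expected number `E[T] = ∑ₜ Pr[T > t]` of steps until `p`, started on `s`, halts. It is
infinite if `p` has a positive probability of running forever. -/
noncomputable def expectedTime (p : Cmd) (s : State) : ℝ≥0∞ :=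
  ∑' t : ℕ, (runDist t (start p s)).toOuterMeasure {c | ¬ c.Halted}

/-- `c` occurs with positive probability in the run of `p` on `s`. -/
def Reachable (p : Cmd) (s : State) (c : Config) : Prop :=
  ∃ t : ℕ, c ∈ (runDist t (start p s)).support

/-- `s'` is a possible final memory content of `p` started on `s`. -/
def Outcome (p : Cmd) (s s' : State) : Prop :=
  ∃ c : Config, Reachable p s c ∧ c.Halted ∧ c.mem = s'

/-- All natural numbers that `p`, started on `s`, ever has in its memory are at most `W`. -/
def WordBound (p : Cmd) (s : State) (W : ℕ) : Prop :=
  ∀ c : Config, Reachable p s c → ∀ a i : ℕ, c.mem.nat a i ≤ W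

end RealRAM

namespace BoxNet

/-- Points of `ℝ^d`. -/
abbrev Point (d : ℕ) := Fin d → ℝ

/-- An axis-aligned box `∏ⱼ [lo j, hi j]`, given by its two extreme corners. -/
structure Box (d : ℕ) where
  lo : Point d
  hi : Point d

/-- The set of points of a box. -/
def Box.toSet {d : ℕ} (b : Box d) : Set (Point d) := Set.Icc b.lo b.hi

open Classical in
/-- The number of the points `P 0, …, P (n-1)` that lie in the box `b`. -/
noncomputable def countIn {d n : ℕ} (P : Fin n → Point d) (b : Box d) : ℕ :=
  (Finset.univ.filter fun i => P i ∈ b.toSet).card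

/-- `b` contains at least an `ε` fraction of the points. -/
def Heavy {d n : ℕ} (P : Fin n → Point d) (ε : ℝ) (b : Box d) : Prop :=
  ε * (n : ℝ) ≤ (countIn P b : ℝ)

/-- `N` has a point in every box of the family. -/
def Pierces {d m : ℕ} (N : Finset (Point d)) (B : Fin m → Box d) : Prop :=
  ∀ j, ∃ p ∈ N, p ∈ (B j).toSet

/-- `N`, a set of arbitrary points of `ℝ^d`, is a weak `ε`-net of the range space `(P, B)`:
it has a point in every range of the family that is `ε`-heavy. -/
def IsWeakNet {d n m : ℕ} (P : Fin n → Point d) (B : Fin m → Box d) (ε : ℝ)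
    (N : Finset (Point d)) : Prop :=
  ∀ j, Heavy P ε (B j) → ∃ p ∈ N, p ∈ (B j).toSet

/-- `log ε⁻¹`, read as `1` where it is smaller than `1`. -/
noncomputable def lg (ε : ℝ) : ℝ := max 1 (Real.log ε⁻¹)

/-- `log log ε⁻¹`, read as `1` where it is smaller than `1`. -/
noncomputable def lglg (ε : ℝ) : ℝ := max 1 (Real.log (Real.log ε⁻¹))

/-- The memory that holds the input: `n`, `m` are cells `0`, `1` of natural number array `0`;
real array `0` holds `ε` in cell `0`, real array `1` holds the coordinates of the points,
real arrays `2` and `3` those of the lower and upper corners of the boxes, with the `j`-th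
coordinate of the `i`-th object in cell `i * d + j`. All other cells hold `0`. -/
noncomputable def input {d n m : ℕ} (P : Fin n → Point d) (B : Fin m → Box d) (ε : ℝ) :
    RealRAM.State where
  nat a i := if a = 0 ∧ i = 0 then n else if a = 0 ∧ i = 1 then m else 0
  real a i :=
    if a = 0 ∧ i = 0 then ε
    else if h : 0 < d then
      let j : Fin d := ⟨i % d, Nat.mod_lt i h⟩
      if a = 1 then (if hi : i / d < n then P ⟨i / d, hi⟩ j else 0)
      else if a = 2 then (if hi : i / d < m then (B ⟨i / d, hi⟩).lo j else 0)
      else if a = 3 then (if hi : i / d < m then (B ⟨i / d, hi⟩).hi j else 0)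
      else 0
    else 0

open Classical in
/-- The point set that a memory holds as output: cell `0` of natural number array `1` holds
the number of listed points, whose coordinates are in real array `4`, the `j`-th coordinate
of the `i`-th point in cell `i * d + j`. -/
noncomputable def output (d : ℕ) (s : RealRAM.State) : Finset (Point d) :=
  (Finset.range (s.nat 1 0)).image fun i => fun j : Fin d => s.real 4 (i * d + (j : ℕ))

end BoxNet

/-! The net is a random sample of O(ε⁻¹ log log ε⁻¹) input points, repaired by one extra point for
each "center" of a box that the sample misses.

Let `2 ^ e` be a power of two near `ε⁻¹`, and let `G = H + 2` be the number of dyadic levels, of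
order log ε⁻¹. In each coordinate, `2 ^ H` lines are drawn through randomly chosen points of `P`.
For at least three quarters of the choices they are `Dense` (`card_not_dense_le`). A heavy box then
keeps half of the guaranteed weight in its `interior`: the points that a line separates, in every
coordinate, from both sides of the box (`le_card_interior`). This set is described by integer ranks
alone.

In rank space every box has a dyadic center (`mid`). Once a level is fixed in each coordinate, any
interior point determines the center (`mid_spec`), so a point lies in the cells of at most `G ^ d`
centers, and all cells together have size at most `n * G ^ d`. Hence at most `2 ^ e` centers are
heavy, with a cell of at least `G ^ d * ε * n` points, and at most `2 * G ^ d * 2 ^ e` centers are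
light. The boxes of a light center fill a fraction of order `G ^ (-d)` of its cell, so polynomially
many core sets in `G ^ d` represent them all (`exists_core_sets`). A sample of size `4 * 2 ^ e * q`,
with `2 ^ q` polynomial in `G`, misses one of these cores with probability at most `1 / (2 * G ^
d)`. On average at most `2 ^ e` light centers are missed, and Markov's inequality gives at most `5 *
2 ^ e` missed centers for three quarters of the samples (`card_many_badCenters_le`). One point per
missed center is enough, because with dense lines the grid point at a center lies in every box with
that center. Since `G` is polylogarithmic in the size of the net, `q` is of order log log ε⁻¹.

To find out whether a box contains a sample point, each sample point marks the `G ^ d` dyadic cells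
that contain its rank vector. An interior point of a box always lies in a cell adjacent to a side of
the box at some level (`exists_sideNode`), so `2 ^ d * G ^ d` lookups per box are enough
(`exists_hit`); this is the log^d factor. Tables are never cleared. Every mark is verified by
comparing coordinates, so stale entries are harmless and the output pierces all boxes whatever the
random choices were. A trial is accepted only if its output is small. It is rejected with
probability at most 1/2, so two trials are expected (`cost_trials_le`). When `ε` is tiny relative to
`m`, or the sample would not be smaller than `m`, the lower corners of all boxes already form a
small net.

Time, word size and correctness are handled together: `cost` charges one unit per step and infinity
for any violation of the goal, so a single finite bound (`cost_netProgram_le`) yields all three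
through `of_cost_le`. -/

namespace RealRAM

/-! ### Expected cost with a penalty for unsafe configurations -/

/-- What has to hold of a run: a bound on the words, and a property of final memory contents. -/
structure Goal where
  word : ℕ
  post : State → Prop

/-- All natural numbers in the memory are at most `W`. -/
def Bounded (W : ℕ) (s : State) : Prop := ∀ a i, s.nat a i ≤ W

open Classical in
/-- One unit of time for a running configuration, infinite if the goal is violated. -/
noncomputable def weight (σ : Goal) (c : Config) : ℝ≥0∞ :=
  if Bounded σ.word c.mem then (if c.Halted then (if σ.post c.mem then 0 else ⊤) else 1) else ⊤

/-- The expected total weight of the first `t` configurations of a run from `c`. -/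
noncomputable def cost (σ : Goal) : ℕ → Config → ℝ≥0∞
  | 0, _ => 0
  | t + 1, c => weight σ c + ∑' c', step c c' * cost σ t c'

/-- Conditioning on the first step shifts time by one. In the unrolled form the cost can be compared
with the tail sum that defines `expectedTime`. -/
theorem cost_eq_sum (σ : Goal) (t : ℕ) (c : Config) :
    cost σ t c = ∑ u ∈ Finset.range t, ∑' c', runDist u c c' * weight σ c' := by
  induction t generalizing c with
  | zero => simp [cost]
  | succ t ih =>
    rw [Finset.sum_range_succ', cost, add_comm]
    congr 1
    · simp_rw [ih, Finset.mul_sum]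
      rw [Summable.tsum_finsetSum (fun _ _ => ENNReal.summable)]
      refine Finset.sum_congr rfl fun u _ => ?_
      simp only [runDist, PMF.bind_apply]
      simp_rw [← ENNReal.tsum_mul_left, ← ENNReal.tsum_mul_right]
      rw [ENNReal.tsum_comm]
      simp_rw [mul_assoc]
    · simp only [runDist, PMF.pure_apply]
      rw [tsum_eq_single c (fun b hb => by simp [hb])]
      simp

theorem cost_mono (σ : Goal) (t : ℕ) (c : Config) : cost σ t c ≤ cost σ (t + 1) c := by
  rw [cost_eq_sum, cost_eq_sum, Finset.sum_range_succ]
  exact le_self_add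

/-- Keeping the horizon `t` on the right, although a step has been spent, is allowed by `cost_mono`;
later bounds then need not count the horizon down. -/
theorem cost_le_of_pure {σ : Goal} {c c' : Config} (h : step c = PMF.pure c') (t : ℕ) :
    cost σ t c ≤ weight σ c + cost σ t c' := by
  cases t with
  | zero => simp [cost]
  | succ t =>
    rw [cost, h]
    gcongr
    rw [tsum_eq_single c' (fun b hb => by simp [hb])]
    simpa using cost_mono σ t c'

theorem weight_running {σ : Goal} {p : Cmd} {k : List Cmd} {s : State}
    (hs : Bounded σ.word s) : weight σ ⟨p :: k, s⟩ = 1 := by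
  simp [weight, hs, Config.Halted]

theorem cost_halted {σ : Goal} {s : State} (hs : Bounded σ.word s) (hp : σ.post s) (t : ℕ) :
    cost σ t ⟨[], s⟩ = 0 := by
  have hw : weight σ ⟨[], s⟩ = 0 := by simp [weight, hs, Config.Halted, hp]
  induction t with
  | zero => rfl
  | succ t ih =>
    rw [cost, hw, step, tsum_eq_single ⟨[], s⟩ (fun b hb => by simp [hb])]
    simp [ih]

/-- A finite bound on the cost bounds the expected time and makes all runs safe. -/
theorem of_cost_le {σ : Goal} {p : Cmd} {s : State} {b : ℝ≥0∞} (hb : b ≠ ⊤)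
    (h : ∀ t, cost σ t (start p s) ≤ b) :
    expectedTime p s ≤ b ∧ WordBound p s σ.word ∧ ∀ s', Outcome p s s' → σ.post s' := by
  classical
  -- A reachable configuration of infinite weight would contribute a positive probability times
  -- infinity to a finite cost.
  have key : ∀ c, Reachable p s c → weight σ c ≠ ⊤ := by
    rintro c ⟨t, ht⟩ hw
    have h1 := h (t + 1)
    rw [cost_eq_sum, Finset.sum_range_succ] at h1
    have h2 : runDist t (start p s) c * weight σ c ≤ b :=
      (ENNReal.le_tsum (f := fun c' => runDist t (start p s) c' * weight σ c') c).trans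
        (le_add_self.trans h1)
    rw [hw, ENNReal.mul_top ((PMF.mem_support_iff _ _).1 ht)] at h2
    exact hb (top_le_iff.1 h2)
  refine ⟨?_, fun c hc => ?_, ?_⟩
  · refine ENNReal.tsum_le_of_sum_range_le fun t => (le_trans ?_ (h t))
    rw [cost_eq_sum]
    refine Finset.sum_le_sum fun u _ => ?_
    rw [PMF.toOuterMeasure_apply]
    refine ENNReal.tsum_le_tsum fun c => ?_
    by_cases hc : c.Halted
    · simp [hc]
    · simp only [Set.indicator, Set.mem_ofPred_eq, hc, not_false_eq_true, if_true, weight, if_false]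
      split_ifs
      · simp
      · exact le_mul_of_one_le_right' le_top
  · by_contra hcon
    exact key c hc (by rw [weight, if_neg (show ¬ Bounded σ.word c.mem from hcon)])
  · rintro s' ⟨c, hc, hh, rfl⟩
    by_contra hcon
    refine key c hc ?_
    simp [weight, hh, hcon]

/-! ### A program logic for deterministic commands -/

/-- Started on `s`, the command `p` ends after at most `T` steps in a memory that satisfies `Q`. -/
def Ends (σ : Goal) (p : Cmd) (s : State) (T : ℕ) (Q : State → Prop) : Prop :=
  Bounded σ.word s → ∀ k t, ∃ s', Bounded σ.word s' ∧ Q s' ∧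
    cost σ t ⟨p :: k, s⟩ ≤ T + cost σ t ⟨k, s'⟩

variable {σ : Goal} {p q body : Cmd} {s : State} {T T₁ T₂ : ℕ} {Q Q₁ : State → Prop}

theorem Ends.mono (h : Ends σ p s T₁ Q₁) (hT : T₁ ≤ T)
    (hQ : ∀ s', Bounded σ.word s' → Q₁ s' → Q s') : Ends σ p s T Q := by
  intro hs k t
  obtain ⟨s', hb, h1, h2⟩ := h hs k t
  exact ⟨s', hb, hQ s' hb h1, h2.trans (by gcongr)⟩

theorem Ends.pre (h : Bounded σ.word s → Ends σ p s T Q) : Ends σ p s T Q :=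
  fun hs => h hs hs

theorem Bounded.writeNat {W : ℕ} (hs : Bounded W s) {a i v : ℕ} (hv : v ≤ W) :
    Bounded W (s.writeNat a i v) := by
  intro b j
  simp only [State.writeNat, Function.update_apply]
  split_ifs with h1
  · rw [Function.update_apply]
    split_ifs
    exacts [hv, hs _ _]
  · exact hs _ _

theorem Ends.step_le {p' : List Cmd} {s' : State} (hs : Bounded σ.word s) {k : List Cmd}
    (h : step ⟨p :: k, s⟩ = PMF.pure ⟨p' ++ k, s'⟩) (t : ℕ) :
    cost σ t ⟨p :: k, s⟩ ≤ 1 + cost σ t ⟨p' ++ k, s'⟩ := by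
  simpa [weight_running hs] using cost_le_of_pure (σ := σ) h t

theorem Ends.skip (hQ : Q s) : Ends σ .skip s 1 Q := fun hs k t =>
  ⟨s, hs, hQ, by simpa using Ends.step_le (p' := []) hs (by simp [step]) t⟩

theorem Ends.setNat {a : ℕ} {i x : NExpr} (hv : Bounded σ.word s → x.eval s ≤ σ.word)
    (hQ : Q (s.writeNat a (i.eval s) (x.eval s))) : Ends σ (.setNat a i x) s 1 Q := fun hs k t =>
  ⟨_, hs.writeNat (hv hs), hQ, by simpa using Ends.step_le (p' := []) hs (by simp [step]) t⟩

theorem Ends.setReal {a : ℕ} {i : NExpr} {x : RExpr}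
    (hQ : Q (s.writeReal a (i.eval s) (x.eval s))) : Ends σ (.setReal a i x) s 1 Q := fun hs k t =>
  ⟨s.writeReal a (i.eval s) (x.eval s), hs, hQ, by
    simpa using Ends.step_le (p' := []) hs (by simp [step]) t⟩

/-- The arbitrary continuation in `Ends` is what makes this work: `p` runs while `q` is still
pending. The additional step unfolds the sequence. -/
theorem Ends.seq (hp : Ends σ p s T₁ Q₁)
    (hq : ∀ s', Bounded σ.word s' → Q₁ s' → Ends σ q s' T₂ Q) :
    Ends σ (.seq p q) s (T₁ + T₂ + 1) Q := by
  intro hs k t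
  obtain ⟨s₁, hb₁, h₁, hc₁⟩ := hp hs (q :: k) t
  obtain ⟨s₂, hb₂, h₂, hc₂⟩ := hq s₁ hb₁ h₁ hb₁ k t
  refine ⟨s₂, hb₂, h₂, ?_⟩
  have := Ends.step_le (σ := σ) (p := .seq p q) (p' := [p, q]) (s' := s) hs (k := k)
    (by simp [step]) t
  simp only [List.cons_append, List.nil_append] at this
  refine this.trans ((add_le_add_right (hc₁.trans (add_le_add_right hc₂ _)) _).trans (le_of_eq ?_))
  push_cast
  ring

theorem Ends.branch {b : BExpr} (hp : b.eval s → Ends σ p s T Q)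
    (hq : ¬ b.eval s → Ends σ q s T Q) : Ends σ (.branch b p q) s (T + 1) Q := by
  intro hs k t
  by_cases hb : b.eval s
  · obtain ⟨s', hb', h', hc⟩ := hp hb hs k t
    refine ⟨s', hb', h', ?_⟩
    have := Ends.step_le (σ := σ) (p := .branch b p q) (p' := [p]) (s' := s) hs (k := k)
      (by simp [step, hb]) t
    refine this.trans ((add_le_add_right hc _).trans (le_of_eq ?_))
    push_cast
    ring
  · obtain ⟨s', hb', h', hc⟩ := hq hb hs k t
    refine ⟨s', hb', h', ?_⟩
    have := Ends.step_le (σ := σ) (p := .branch b p q) (p' := [q]) (s' := s) hs (k := k)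
      (by simp [step, hb]) t
    refine this.trans ((add_le_add_right hc _).trans (le_of_eq ?_))
    push_cast
    ring

theorem cost_loop_le {b : BExpr} (hs : Bounded σ.word s) (k : List Cmd) (t : ℕ) (hb : b.eval s) :
    cost σ t ⟨.loop b p :: k, s⟩ ≤ 1 + cost σ t ⟨p :: .loop b p :: k, s⟩ :=
  Ends.step_le (σ := σ) (p := .loop b p) (p' := [p, .loop b p]) (s' := s) hs (k := k)
    (by simp [step, hb]) t

theorem cost_loop_exit_le {b : BExpr} (hs : Bounded σ.word s) (k : List Cmd) (t : ℕ)
    (hb : ¬ b.eval s) : cost σ t ⟨.loop b p :: k, s⟩ ≤ 1 + cost σ t ⟨k, s⟩ :=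
  Ends.step_le (σ := σ) (p := .loop b p) (p' := []) (s' := s) hs (k := k)
    (by simp [step, hb]) t

/-- A loop that runs at most `N` times. -/
theorem Ends.loop {b : BExpr} (I : ℕ → State → Prop) (N : ℕ)
    (hbody : ∀ q < N, ∀ s, Bounded σ.word s → I q s → b.eval s → Ends σ body s T (I (q + 1)))
    (hend : ∀ s, Bounded σ.word s → I N s → ¬ b.eval s) (h0 : I 0 s) :
    Ends σ (.loop b body) s (N * (T + 1) + 1) (fun s' => ∃ q ≤ N, I q s' ∧ ¬ b.eval s') := by
  -- Induction on the number `r` of passes still allowed, while the pass number `q` of the invariant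
  -- grows.
  have key : ∀ r q s, q + r = N → I q s → Bounded σ.word s → ∀ k t,
      ∃ s', Bounded σ.word s' ∧ (∃ q ≤ N, I q s' ∧ ¬ b.eval s') ∧
        cost σ t ⟨.loop b body :: k, s⟩ ≤ (r * (T + 1) + 1 : ℕ) + cost σ t ⟨k, s'⟩ := by
    intro r
    induction r with
    | zero =>
      intro q s hq hI hs k t
      obtain rfl : q = N := by omega
      exact ⟨s, hs, ⟨q, le_rfl, hI, hend s hs hI⟩, by
        simpa using cost_loop_exit_le hs k t (hend s hs hI)⟩
    | succ r ih =>
      intro q s hq hI hs k t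
      by_cases hb : b.eval s
      · obtain ⟨s₁, hb₁, h₁, hc₁⟩ := hbody q (by omega) s hs hI hb hs (.loop b body :: k) t
        obtain ⟨s₂, hb₂, h₂, hc₂⟩ := ih (q + 1) s₁ (by omega) h₁ hb₁ k t
        refine ⟨s₂, hb₂, h₂, ?_⟩
        refine (cost_loop_le hs k t hb).trans
          ((add_le_add_right (hc₁.trans (add_le_add_right hc₂ _)) _).trans (le_of_eq ?_))
        push_cast
        ring
      · refine ⟨s, hs, ⟨q, by omega, hI, hb⟩, (cost_loop_exit_le hs k t hb).trans ?_⟩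
        gcongr
        exact_mod_cast Nat.le_add_left _ _
  intro hs k t
  exact key N 0 s (by omega) h0 hs k t

/-! ### Counted loops, finite sequences and finite conjunctions -/

theorem eval_lit (s : State) (k : ℕ) : (NExpr.lit k).eval s = k := rfl

/-- `for i in [0, N)` -/
def forLoop (i : ℕ) (N : NExpr) (body : Cmd) : Cmd :=
  .seq (.setNat i (.lit 0) (.lit 0)) (.loop (.ltNat (.get i (.lit 0)) N)
    (.seq body (.setNat i (.lit 0) (.add (.get i (.lit 0)) (.lit 1)))))

/-- The loop itself advances its counter, so the body must leave it alone and restore the invariant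
for the memory after the increment. The `3` per pass pays for the test, the unfolding of the
sequence and the increment. -/
theorem Ends.forLoop {i : ℕ} {Ne : NExpr} (I : ℕ → State → Prop) (N : ℕ) (hN : N ≤ σ.word)
    (hev : ∀ q ≤ N, ∀ s, I q s → Ne.eval s = N) (h0 : I 0 (s.writeNat i 0 0))
    (hbody : ∀ q < N, ∀ s, Bounded σ.word s → I q s → s.nat i 0 = q →
      Ends σ body s T (fun s' => s'.nat i 0 = q ∧ I (q + 1) (s'.writeNat i 0 (q + 1)))) :
    Ends σ (forLoop i Ne body) s (N * (T + 3) + 3) (fun s' => I N s' ∧ s'.nat i 0 = N) := by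
  have hl : ∀ s, I 0 s → s.nat i 0 = 0 → Ends σ (.loop (.ltNat (.get i (.lit 0)) Ne)
      (.seq body (.setNat i (.lit 0) (.add (.get i (.lit 0)) (.lit 1))))) s
      (N * (T + 1 + 1 + 1) + 1) (fun s' => I N s' ∧ s'.nat i 0 = N) := by
    intro s hI hi
    refine (Ends.loop (fun q s => I q s ∧ s.nat i 0 = q) N ?_ ?_ ⟨hI, hi⟩).mono le_rfl ?_
    · intro q hq s hs h _
      refine Ends.seq (hbody q hq s hs h.1 h.2) fun s' _ hs' => Ends.setNat ?_ ?_
      · simp only [NExpr.eval, hs'.1]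
        omega
      · simp only [NExpr.eval, hs'.1]
        exact ⟨hs'.2, by simp [State.writeNat]⟩
    · rintro s _ ⟨h, h'⟩
      simp [BExpr.eval, NExpr.eval, hev N le_rfl s h, h']
    · rintro s' _ ⟨q, hq, ⟨h, h'⟩, hb⟩
      simp only [BExpr.eval, NExpr.eval, hev q hq s' h, h'] at hb
      obtain rfl : q = N := by omega
      exact ⟨h, h'⟩
  refine (Ends.seq (Ends.setNat (Q := fun s' => I 0 s' ∧ s'.nat i 0 = 0) ?_ ?_)
    fun s' _ h => hl s' h.1 h.2).mono ?_ fun _ _ h => h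
  · simp [NExpr.eval]
  · simp only [NExpr.eval]
    exact ⟨h0, by simp [State.writeNat]⟩
  · have : N * (T + 1 + 1 + 1) = N * (T + 3) := by ring
    omega

/-- `f 0; …; f (k - 1)` -/
def seqN : ℕ → (ℕ → Cmd) → Cmd
  | 0, _ => .skip
  | k + 1, f => .seq (seqN k f) (f k)

theorem Ends.seqN {f : ℕ → Cmd} (I : ℕ → State → Prop) (k : ℕ) (h0 : I 0 s)
    (h : ∀ j < k, ∀ s, Bounded σ.word s → I j s → Ends σ (f j) s T (I (j + 1))) :
    Ends σ (seqN k f) s (k * (T + 1) + 1) (I k) := by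
  induction k with
  | zero => simpa [RealRAM.seqN] using Ends.skip h0
  | succ k ih =>
    refine (Ends.seq (ih fun j hj => h j (by omega)) fun s' hs' hI =>
      h k (by omega) s' hs' hI).mono ?_ fun _ _ h => h
    ring_nf
    omega

/-- `b 0 ∧ … ∧ b (k - 1)` -/
def conjN : ℕ → (ℕ → BExpr) → BExpr
  | 0, _ => .ltNat (.lit 0) (.lit 1)
  | k + 1, f => .conj (conjN k f) (f k)

theorem eval_conjN {k : ℕ} {f : ℕ → BExpr} : (conjN k f).eval s ↔ ∀ j < k, (f j).eval s := by
  induction k with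
  | zero => simp [conjN, BExpr.eval, NExpr.eval]
  | succ k ih => simp only [conjN, BExpr.eval, ih, Nat.forall_lt_succ_right]

/-! ### Memory updates and frames -/

@[simp] theorem writeNat_nat (s : State) (a i v b j : ℕ) :
    (s.writeNat a i v).nat b j = if b = a ∧ j = i then v else s.nat b j := by
  simp only [State.writeNat, Function.update_apply]
  split_ifs <;> simp_all

@[simp] theorem writeNat_real (s : State) (a i v : ℕ) : (s.writeNat a i v).real = s.real := rfl

@[simp] theorem writeReal_nat (s : State) (a i : ℕ) (v : ℝ) : (s.writeReal a i v).nat = s.nat := rfl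

@[simp] theorem writeReal_real (s : State) (a i : ℕ) (v : ℝ) (b j : ℕ) :
    (s.writeReal a i v).real b j = if b = a ∧ j = i then v else s.real b j := by
  simp only [State.writeReal, Function.update_apply]
  split_ifs <;> simp_all

/-- Only the natural number arrays in `A` and the real arrays in `B` have changed. -/
structure Frame (A B : List ℕ) (s s' : State) : Prop where
  nat : ∀ a, a ∉ A → s'.nat a = s.nat a
  real : ∀ a, a ∉ B → s'.real a = s.real a

theorem Frame.refl (A B : List ℕ) (s : State) : Frame A B s s := ⟨fun _ _ => rfl, fun _ _ => rfl⟩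

theorem Frame.trans {A B : List ℕ} {s s' s'' : State} (h : Frame A B s s')
    (h' : Frame A B s' s'') : Frame A B s s'' :=
  ⟨fun a ha => (h'.nat a ha).trans (h.nat a ha), fun a ha => (h'.real a ha).trans (h.real a ha)⟩

theorem Frame.mono {A B A' B' : List ℕ} {s s' : State} (h : Frame A B s s') (hA : A ⊆ A')
    (hB : B ⊆ B') : Frame A' B' s s' :=
  ⟨fun a ha => h.nat a fun h' => ha (hA h'), fun a ha => h.real a fun h' => ha (hB h')⟩

theorem Frame.writeNat {A B : List ℕ} {s s' : State} (h : Frame A B s s') {a i v : ℕ}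
    (ha : a ∈ A) : Frame A B s (s'.writeNat a i v) :=
  h.trans ⟨fun b hb => by
    have : b ≠ a := fun e => hb (e ▸ ha)
    simp [State.writeNat, Function.update_of_ne this], fun _ _ => rfl⟩

theorem Frame.writeReal {A B : List ℕ} {s s' : State} (h : Frame A B s s') {a i : ℕ} {v : ℝ}
    (ha : a ∈ B) : Frame A B s (s'.writeReal a i v) :=
  h.trans ⟨fun _ _ => rfl, fun b hb => by
    have : b ≠ a := fun e => hb (e ▸ ha)
    simp [State.writeReal, Function.update_of_ne this]⟩

/-! ### Sampling -/

/-- The expectation over the pushed-forward uniform distribution becomes a finite average once the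
two sums are exchanged. -/
theorem cost_rand_le {a : ℕ} {i x : NExpr} (hs : Bounded σ.word s) (k : List Cmd) (t N : ℕ)
    (hN : x.eval s + 1 = N) : cost σ t ⟨.rand a i x :: k, s⟩ ≤
      1 + ∑ r : Fin N, (N : ℝ≥0∞)⁻¹ * cost σ t ⟨k, s.writeNat a (i.eval s) r⟩ := by
  subst hN
  cases t with
  | zero => simp [cost]
  | succ t =>
    rw [cost, weight_running hs, step]
    gcongr
    change ∑' c', ((PMF.map (fun r => (⟨k, s.writeNat a (i.eval s) r⟩ : Config))
      (PMF.map (fun r : Fin (x.eval s + 1) => (r : ℕ)) (PMF.uniformOfFintype _))) c' *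
        cost σ t c') ≤ _
    rw [PMF.map_comp, ← PMF.bind_pure_comp]
    simp only [PMF.bind_apply, Function.comp, PMF.pure_apply]
    simp_rw [← ENNReal.tsum_mul_right]
    rw [ENNReal.tsum_comm, tsum_fintype]
    refine Finset.sum_le_sum fun r _ => ?_
    rw [tsum_eq_single ⟨k, s.writeNat a (i.eval s) r⟩ (fun b hb => by simp [hb])]
    simp only [PMF.uniformOfFintype_apply, Fintype.card_fin, if_true, mul_one]
    gcongr
    exact cost_mono _ _ _

/-- Fill the first `N` cells of array `a` with uniformly random elements of `{0, …, n - 1}`,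
where `n` is the content of cell `0` of array `0`. -/
def sampleLoop (i a : ℕ) (N : NExpr) : Cmd :=
  forLoop i N (.rand a (.get i (.lit 0)) (.sub (.get 0 (.lit 0)) (.lit 1)))

/-- Independent uniform cells form a uniformly random function `ω`, and `F ω` is the memory that
results from it. Everything between two sampling loops is deterministic, so averages over such
functions are the only probability needed. -/
theorem cost_sampleLoop_le {i a n N : ℕ} {Ne : NExpr} (hia : i ≠ a) (hi : i ≠ 0) (ha : a ≠ 0)
    (hn : 0 < n) (hnW : n ≤ σ.word) (hN : N ≤ σ.word)
    (hs : Bounded σ.word s) (hsn : s.nat 0 0 = n)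
    (hev : ∀ s', Frame [i, a] [] s s' → Ne.eval s' = N) (k : List Cmd) (t : ℕ) :
    ∃ F : (Fin N → Fin n) → State,
      (∀ ω, Bounded σ.word (F ω) ∧ Frame [i, a] [] s (F ω) ∧ ∀ l : Fin N, (F ω).nat a l = ω l) ∧
      cost σ t ⟨sampleLoop i a Ne :: k, s⟩ ≤
        (N * 4 + 3 : ℕ) + ∑ ω : Fin N → Fin n, ((n : ℝ≥0∞) ^ N)⁻¹ * cost σ t ⟨k, F ω⟩ := by
  set b : BExpr := .ltNat (.get i (.lit 0)) Ne with hb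
  set body : Cmd := .seq (.rand a (.get i (.lit 0)) (.sub (.get 0 (.lit 0)) (.lit 1)))
    (.setNat i (.lit 0) (.add (.get i (.lit 0)) (.lit 1))) with hbody
  -- Induction on the number `r` of cells still to be filled. A sample of length `r + 1` splits into
  -- its head, drawn now, and its tail.
  have key : ∀ r q s₁, q + r = N → Bounded σ.word s₁ → Frame [i, a] [] s s₁ → s₁.nat i 0 = q →
      ∃ F : (Fin r → Fin n) → State,
      (∀ ω, Bounded σ.word (F ω) ∧ Frame [i, a] [] s (F ω) ∧
        (∀ l < q, (F ω).nat a l = s₁.nat a l) ∧ ∀ l : Fin r, (F ω).nat a (q + l) = ω l) ∧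
      cost σ t ⟨.loop b body :: k, s₁⟩ ≤
        (r * 4 + 1 : ℕ) + ∑ ω : Fin r → Fin n, ((n : ℝ≥0∞) ^ r)⁻¹ * cost σ t ⟨k, F ω⟩ := by
    intro r
    induction r with
    | zero =>
      intro q s₁ hq hs₁ hf h₁
      refine ⟨fun _ => s₁, fun ω => ⟨hs₁, hf, fun _ _ => rfl, fun l => l.elim0⟩, ?_⟩
      have := cost_loop_exit_le (σ := σ) (p := body) (b := b) hs₁ k t (by
        simp [hb, BExpr.eval, NExpr.eval, hev s₁ hf, h₁]; omega)
      simpa using this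
    | succ r ih =>
      intro q s₁ hq hs₁ hf h₁
      have hn₁ : s₁.nat 0 0 = n := by rw [hf.nat 0 (by simp [hi.symm, ha.symm])]; exact hsn
      let S : Fin n → State := fun x => (s₁.writeNat a q x).writeNat i 0 (q + 1)
      have hS : ∀ x, Bounded σ.word (S x) ∧ Frame [i, a] [] s (S x) ∧ (S x).nat i 0 = q + 1 := by
        intro x
        refine ⟨(hs₁.writeNat ?_).writeNat (by omega), (hf.writeNat (by simp)).writeNat (by simp),
          by simp [S]⟩
        exact x.2.le.trans hnW
      have hch := fun x => ih (q + 1) (S x) (by omega) (hS x).1 (hS x).2.1 (hS x).2.2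
      choose F hF hc using hch
      refine ⟨fun ω => F (ω 0) (Fin.tail ω), fun ω => ⟨(hF _ _).1, (hF _ _).2.1, ?_, ?_⟩, ?_⟩
      · intro l hl
        rw [(hF _ _).2.2.1 l (by omega)]
        simp [S, hia.symm, hl.ne]
      · intro l
        refine Fin.cases ?_ (fun l => ?_) l
        · rw [Fin.val_zero, add_zero, (hF _ _).2.2.1 q (by omega)]
          simp [S, hia.symm]
        · have := (hF (ω 0) (Fin.tail ω)).2.2.2 l
          rw [Fin.val_succ, ← add_assoc, add_right_comm, this]
          rfl
      · have h2 := cost_loop_le (σ := σ) (p := body) (b := b) hs₁ k t (by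
          simp [hb, BExpr.eval, NExpr.eval, hev s₁ hf, h₁]; omega)
        have h3 := Ends.step_le (σ := σ) (p := body) (s := s₁) (s' := s₁)
          (p' := [.rand a (.get i (.lit 0)) (.sub (.get 0 (.lit 0)) (.lit 1)),
            .setNat i (.lit 0) (.add (.get i (.lit 0)) (.lit 1))]) hs₁
          (k := .loop b body :: k) (by simp [hbody, step]) t
        have h4 := cost_rand_le (σ := σ) (a := a) (i := .get i (.lit 0))
          (x := .sub (.get 0 (.lit 0)) (.lit 1)) hs₁
          (.setNat i (.lit 0) (.add (.get i (.lit 0)) (.lit 1)) :: .loop b body :: k) t n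
          (by simp [NExpr.eval, hn₁]; omega)
        have h5 : ∀ x : Fin n, cost σ t ⟨.setNat i (.lit 0) (.add (.get i (.lit 0)) (.lit 1)) ::
            .loop b body :: k, s₁.writeNat a ((NExpr.get i (.lit 0)).eval s₁) x⟩ ≤
            (1 + (r * 4 + 1 : ℕ)) +
              ∑ ω : Fin r → Fin n, ((n : ℝ≥0∞) ^ r)⁻¹ * cost σ t ⟨k, F x ω⟩ := by
          intro x
          have := Ends.step_le (σ := σ) (p := .setNat i (.lit 0) (.add (.get i (.lit 0)) (.lit 1)))
            (s := s₁.writeNat a q x) (s' := S x) (p' := [])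
            (hs₁.writeNat (x.2.le.trans hnW)) (k := .loop b body :: k)
            (by simp [step, S, NExpr.eval, hia, h₁]) t
          simp only [NExpr.eval, h₁]
          refine this.trans ?_
          rw [add_assoc]
          gcongr
          exact hc x
        have h6 : ∑ x : Fin n, (n : ℝ≥0∞)⁻¹ * cost σ t ⟨.setNat i (.lit 0)
            (.add (.get i (.lit 0)) (.lit 1)) ::
            .loop b body :: k, s₁.writeNat a ((NExpr.get i (.lit 0)).eval s₁) x⟩ ≤
            (1 + (r * 4 + 1 : ℕ)) + ∑ ω : Fin (r + 1) → Fin n, ((n : ℝ≥0∞) ^ (r + 1))⁻¹ *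
              cost σ t ⟨k, F (ω 0) (Fin.tail ω)⟩ := by
          refine (Finset.sum_le_sum fun x _ => mul_le_mul_right (h5 x) _).trans ?_
          simp_rw [mul_add]
          rw [Finset.sum_add_distrib]
          refine add_le_add ?_ (le_of_eq ?_)
          · simp only [Finset.sum_const, Finset.card_univ, Fintype.card_fin, nsmul_eq_mul,
              ← mul_add, ← mul_assoc]
            rw [ENNReal.mul_inv_cancel (by simpa using hn.ne') (by simp), one_mul]
          · simp_rw [Finset.mul_sum]
            rw [← Fintype.sum_prod_type', ← (Fin.consEquiv fun _ : Fin (r + 1) => Fin n).sum_comp]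
            refine Finset.sum_congr rfl fun x _ => ?_
            rw [← mul_assoc, pow_succ', ENNReal.mul_inv (by simp) (by simp)]
            rfl
        refine h2.trans ((add_le_add_right (h3.trans (add_le_add_right (h4.trans
          (add_le_add_right h6 _)) _)) _).trans (le_of_eq ?_))
        push_cast
        ring
  have hs0 : Bounded σ.word (s.writeNat i 0 0) := hs.writeNat (Nat.zero_le _)
  obtain ⟨F, hF, hc⟩ := key N 0 (s.writeNat i 0 0) (by omega) hs0
    ((Frame.refl _ _ s).writeNat (by simp)) (by simp)
  refine ⟨F, fun ω => ⟨(hF ω).1, (hF ω).2.1, fun l => by simpa using (hF ω).2.2.2 l⟩, ?_⟩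
  have h1 := Ends.step_le (σ := σ) (p := sampleLoop i a Ne) (s := s) (s' := s)
    (p' := [.setNat i (.lit 0) (.lit 0), .loop b body]) hs (k := k)
    (by simp [sampleLoop, forLoop, hbody, hb, step]) t
  have h2 := Ends.step_le (σ := σ) (p := .setNat i (.lit 0) (.lit 0)) (s := s)
    (s' := s.writeNat i 0 0) (p' := []) hs (k := .loop b body :: k) (by simp [step, NExpr.eval]) t
  refine h1.trans ((add_le_add_right (h2.trans (add_le_add_right hc _)) _).trans (le_of_eq ?_))
  push_cast
  ring

end RealRAM

namespace BoxNet

/-! ### Core sets of a family of boxes -/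

/-- The set `u` that belongs to an element with the largest value of `f` already contains all of
`s`. -/
theorem card_lt_of_max {ι α : Type*} [LinearOrder α] (s : Finset ι) (f : ι → α) {β : ℝ}
    (hβ : 0 < β) (h : ∀ i ∈ s, ∃ u : Finset ι, (∀ i' ∈ s, f i' ≤ f i → i' ∈ u) ∧ (u.card : ℝ) < β) :
    (s.card : ℝ) < β := by
  rcases s.eq_empty_or_nonempty with rfl | hs
  · simpa using hβ
  obtain ⟨i, hi, hmax⟩ := s.exists_max_image f hs
  obtain ⟨u, hu, hc⟩ := h i hi
  exact lt_of_le_of_lt (by exact_mod_cast Finset.card_le_card fun i' hi' => hu i' hi' (hmax i' hi')) hc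

/-- Finitely many core sets such that every box of the family contains one. -/
theorem exists_core_sets {ι α κ : Type*} [LinearOrder α] [Fintype κ] [Nonempty κ]
    (A : Finset ι) (f : κ → ι → α) (F : Set ((κ → α) × (κ → α))) (w : ℝ) (hw : 0 < w)
    (hF : ∀ b ∈ F, w ≤ ((A.filter fun i => ∀ j, b.1 j ≤ f j i ∧ f j i ≤ b.2 j).card : ℝ)) :
    ∃ 𝓢 : Finset (Finset ι),
      (𝓢.card : ℝ) ≤ (4 * Fintype.card κ * A.card / w + 1) ^ (2 * Fintype.card κ) ∧
      (∀ S ∈ 𝓢, w / 2 ≤ (S.card : ℝ)) ∧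
      ∀ b ∈ F, ∃ S ∈ 𝓢, ∀ i ∈ S, ∀ j, b.1 j ≤ f j i ∧ f j i ≤ b.2 j := by
  classical
  set D : ℝ := (Fintype.card κ : ℝ) with hD
  have hD0 : 0 < D := by simp [hD, Fintype.card_pos]
  -- Each of the `2 D` sides will cost fewer than `β` elements, and `2 * D * β = w / 2`.
  set β : ℝ := w / (4 * D) with hβ
  have hβ0 : 0 < β := by positivity
  set N : ℕ := ⌊(A.card : ℝ) / β⌋₊ with hN
  have hfl : ∀ u : Finset ι, u ⊆ A → ⌊(u.card : ℝ) / β⌋₊ < N + 1 := fun u hu =>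
    Nat.lt_succ_of_le (Nat.floor_le_floor (by gcongr))
  let lowS : κ → ((κ → α) × (κ → α)) → Finset ι := fun j b => A.filter fun i => f j i < b.1 j
  let upS : κ → ((κ → α) × (κ → α)) → Finset ι := fun j b => A.filter fun i => b.2 j < f j i
  -- The class of a range records, for each side, how many elements that side cuts off, in units of
  -- `β`. A core is what all ranges of one class have in common.
  let cls : ((κ → α) × (κ → α)) → (κ → Fin (N + 1) × Fin (N + 1)) := fun b j =>
    (⟨_, hfl (lowS j b) (Finset.filter_subset _ _)⟩, ⟨_, hfl (upS j b) (Finset.filter_subset _ _)⟩)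
  let core : (κ → Fin (N + 1) × Fin (N + 1)) → Finset ι := fun c =>
    A.filter fun i => ∀ b ∈ F, cls b = c → ∀ j, b.1 j ≤ f j i ∧ f j i ≤ b.2 j
  -- Nested sets whose sizes round to the same multiple of `β` differ by fewer than `β` elements.
  have hdiff : ∀ u v : Finset ι, u ⊆ v → ⌊(u.card : ℝ) / β⌋₊ = ⌊(v.card : ℝ) / β⌋₊ →
      ((v \ u).card : ℝ) < β := by
    intro u v huv h
    have h1 : (v.card : ℝ) / β < ⌊(v.card : ℝ) / β⌋₊ + 1 := Nat.lt_floor_add_one _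
    have h2 : (⌊(u.card : ℝ) / β⌋₊ : ℝ) ≤ (u.card : ℝ) / β := Nat.floor_le (by positivity)
    rw [h] at h2
    have h3 : ((v.card : ℝ) - u.card) / β < 1 := by rw [sub_div]; linarith
    rw [div_lt_one hβ0] at h3
    rw [Finset.cast_card_sdiff huv]
    exact h3
  refine ⟨(Finset.univ.filter fun c => ∃ b ∈ F, cls b = c).image core, ?_, ?_, ?_⟩
  · have h1 : (((Finset.univ.filter fun c => ∃ b ∈ F, cls b = c).image core).card : ℝ) ≤
        ((N : ℝ) + 1) ^ (2 * Fintype.card κ) := by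
      have : ((Finset.univ.filter fun c => ∃ b ∈ F, cls b = c).image core).card ≤
          (N + 1) ^ (2 * Fintype.card κ) := by
        refine Finset.card_image_le.trans ((Finset.card_le_univ _).trans (le_of_eq ?_))
        simp [pow_mul, sq]
      exact_mod_cast this
    refine h1.trans (pow_le_pow_left₀ (by positivity) ?_ _)
    have : (N : ℝ) ≤ (A.card : ℝ) / β := Nat.floor_le (by positivity)
    have h2 : (A.card : ℝ) / β = 4 * D * A.card / w := by rw [hβ]; field_simp
    linarith
  · intro S hS
    obtain ⟨c, hc, rfl⟩ := Finset.mem_image.1 hS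
    obtain ⟨-, b, hb, rfl⟩ := Finset.mem_filter.1 hc
    let box := A.filter fun i => ∀ j, b.1 j ≤ f j i ∧ f j i ≤ b.2 j
    -- The elements that `b` keeps at its lower side although some range of the same class cuts them
    -- off there; `loss'` does the same for the upper side.
    let loss : κ → Finset ι := fun j => A.filter fun i => b.1 j ≤ f j i ∧
      ∃ b' ∈ F, cls b' = cls b ∧ f j i < b'.1 j
    let loss' : κ → Finset ι := fun j => A.filter fun i => f j i ≤ b.2 j ∧
      ∃ b' ∈ F, cls b' = cls b ∧ b'.2 j < f j i
    have hl : ∀ j, ((loss j).card : ℝ) < β := by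
      intro j
      refine card_lt_of_max _ (f j) hβ0 fun i hi => ?_
      obtain ⟨hiA, hi1, b', hb', hbb, hi2⟩ := Finset.mem_filter.1 hi
      have hle : b.1 j ≤ b'.1 j := hi1.trans hi2.le
      refine ⟨lowS j b' \ lowS j b, fun i' hi' hii => ?_, hdiff _ _ ?_ ?_⟩
      · obtain ⟨h1, h2, -⟩ := Finset.mem_filter.1 hi'
        simp only [lowS, Finset.mem_sdiff, Finset.mem_filter, h1, true_and, not_lt]
        exact ⟨lt_of_le_of_lt hii hi2, h2⟩
      · exact Finset.monotone_filter_right _ fun x _ (hx : f j x < b.1 j) => lt_of_lt_of_le hx hle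
      · have := congrArg (fun c => ((c j).1 : ℕ)) hbb
        exact this.symm
    have hl' : ∀ j, ((loss' j).card : ℝ) < β := by
      intro j
      -- At the upper side the extreme lost element is the smallest one, hence the reversed order.
      refine card_lt_of_max _ (fun i => OrderDual.toDual (f j i)) hβ0 fun i hi => ?_
      obtain ⟨hiA, hi1, b', hb', hbb, hi2⟩ := Finset.mem_filter.1 hi
      have hle : b'.2 j ≤ b.2 j := hi2.le.trans hi1
      refine ⟨upS j b' \ upS j b, fun i' hi' hii => ?_, hdiff _ _ ?_ ?_⟩
      · obtain ⟨h1, h2, -⟩ := Finset.mem_filter.1 hi'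
        simp only [upS, Finset.mem_sdiff, Finset.mem_filter, h1, true_and, not_lt]
        exact ⟨lt_of_lt_of_le hi2 hii, h2⟩
      · exact Finset.monotone_filter_right _ fun x _ (hx : b.2 j < f j x) => lt_of_le_of_lt hle hx
      · have := congrArg (fun c => ((c j).2 : ℕ)) hbb
        exact this.symm
    have hcov : box ⊆ core (cls b) ∪ Finset.univ.biUnion (fun j => loss j ∪ loss' j) := by
      intro i hi
      obtain ⟨hiA, hib⟩ := Finset.mem_filter.1 hi
      by_cases hcore : i ∈ core (cls b)
      · exact Finset.mem_union_left _ hcore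
      · refine Finset.mem_union_right _ (Finset.mem_biUnion.2 ?_)
        simp only [core, Finset.mem_filter, hiA, true_and, not_forall] at hcore
        obtain ⟨b', hb', hbb, j, hj⟩ := hcore
        refine ⟨j, Finset.mem_univ _, ?_⟩
        rw [not_and_or, not_le, not_le] at hj
        rcases hj with hj | hj
        · exact Finset.mem_union_left _ (Finset.mem_filter.2 ⟨hiA, (hib j).1, b', hb', hbb, hj⟩)
        · exact Finset.mem_union_right _ (Finset.mem_filter.2 ⟨hiA, (hib j).2, b', hb', hbb, hj⟩)
    have h1 : (box.card : ℝ) ≤ (core (cls b)).card + ∑ j, ((loss j).card + (loss' j).card : ℝ) := by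
      have : box.card ≤ (core (cls b)).card + ∑ j, ((loss j).card + (loss' j).card) :=
        (Finset.card_le_card hcov).trans ((Finset.card_union_le _ _).trans (add_le_add le_rfl
          (Finset.card_biUnion_le.trans (Finset.sum_le_sum fun j _ => Finset.card_union_le _ _))))
      exact_mod_cast this
    have h2 : ∑ j, ((loss j).card + (loss' j).card : ℝ) ≤ ∑ _j : κ, (β + β) :=
      Finset.sum_le_sum fun j _ => add_le_add (hl j).le (hl' j).le
    have h3 : ∑ _j : κ, (β + β) = w / 2 := by
      simp only [Finset.sum_const, Finset.card_univ, nsmul_eq_mul, ← hD, hβ]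
      field_simp
      ring
    have := hF b hb
    linarith
  · intro b hb
    refine ⟨core (cls b), Finset.mem_image_of_mem _ (by simp; exact ⟨b.1, b.2, hb, rfl⟩), ?_⟩
    intro i hi j
    exact (Finset.mem_filter.1 hi).2 b hb rfl j

/-! ### Missing a set by a random sample -/

theorem card_avoid {n : ℕ} (N : ℕ) (S : Finset (Fin n)) :
    (Finset.univ.filter fun ω : Fin N → Fin n => ∀ l, ω l ∉ S).card = (n - S.card) ^ N := by
  have : (Finset.univ.filter fun ω : Fin N → Fin n => ∀ l, ω l ∉ S) =
      Fintype.piFinset fun _ => Sᶜ := by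
    ext ω; simp [Fintype.mem_piFinset]
  rw [this, Fintype.card_piFinset_const, Finset.card_compl, Fintype.card_fin]

/-- `(1 - x) ^ N ≤ exp (-x * N) ≤ exp (-q) ≤ 2 ^ (-q)`, with samples counted instead of weighed by
probability. -/
theorem card_avoid_le {n N q : ℕ} (S : Finset (Fin n)) {x : ℝ}
    (hS : x * n ≤ S.card) (hq : q ≤ x * N) :
    ((Finset.univ.filter fun ω : Fin N → Fin n => ∀ l, ω l ∉ S).card : ℝ) ≤
      (1 / 2) ^ q * (n : ℝ) ^ N := by
  have hSn : S.card ≤ n := by simpa using Finset.card_le_univ S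
  rw [card_avoid, Nat.cast_pow, Nat.cast_sub hSn]
  have h0 : (0 : ℝ) ≤ n - S.card := by simpa using hSn
  rcases Nat.eq_zero_or_pos n with rfl | hn
  · obtain rfl : S = ∅ := by simpa using hSn
    simp only [Nat.cast_zero, Finset.card_empty, sub_zero]
    rcases Nat.eq_zero_or_pos N with rfl | hN
    · have : q = 0 := by
        have : (q : ℝ) ≤ 0 := by simpa using hq
        exact_mod_cast le_antisymm this (by positivity)
      simp [this]
    · simp [hN.ne']
  have hn' : (0 : ℝ) < n := by exact_mod_cast hn
  have h1 : (n : ℝ) - S.card ≤ (1 - x) * n := by linarith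
  have h2 : 0 ≤ 1 - x := by
    by_contra h
    nlinarith
  calc ((n : ℝ) - S.card) ^ N ≤ ((1 - x) * n) ^ N := pow_le_pow_left₀ h0 h1 _
    _ = (1 - x) ^ N * (n : ℝ) ^ N := mul_pow _ _ _
    _ ≤ (1 / 2) ^ q * (n : ℝ) ^ N := by
      gcongr
      calc (1 - x) ^ N ≤ (Real.exp (-x)) ^ N :=
            pow_le_pow_left₀ h2 (by linarith [Real.add_one_le_exp (-x)]) _
        _ = Real.exp (-(x * N)) := by rw [← Real.exp_nat_mul]; congr 1; ring
        _ ≤ Real.exp (-(q : ℝ)) := Real.exp_le_exp.2 (by linarith)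
        _ = (Real.exp (-1)) ^ q := by rw [← Real.exp_nat_mul]; congr 1; ring
        _ ≤ (1 / 2) ^ q := by
          refine pow_le_pow_left₀ (Real.exp_pos _).le ?_ _
          rw [Real.exp_neg, one_div]
          exact inv_anti₀ (by norm_num) (by linarith [Real.add_one_le_exp (1 : ℝ)])

/-! ### Ranks and interiors -/

/-- The number of the values `f 0, …, f (K - 1)` below `y`. -/
noncomputable def ltCount (f : ℕ → ℝ) (K : ℕ) (y : ℝ) : ℕ :=
  ((Finset.range K).filter fun g => f g < y).card

/-- The number of the values `f 0, …, f (K - 1)` that are at most `y`. -/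
noncomputable def leCount (f : ℕ → ℝ) (K : ℕ) (y : ℝ) : ℕ :=
  ((Finset.range K).filter fun g => f g ≤ y).card

/-- The position of `y` among the values `f 0, …, f (K - 1)` and the gaps between them. -/
noncomputable def pos (f : ℕ → ℝ) (K : ℕ) (y : ℝ) : ℕ := ltCount f K y + leCount f K y

theorem ltCount_le (f : ℕ → ℝ) (K : ℕ) (y : ℝ) : ltCount f K y ≤ K :=
  (Finset.card_filter_le _ _).trans_eq (Finset.card_range K)

theorem leCount_le (f : ℕ → ℝ) (K : ℕ) (y : ℝ) : leCount f K y ≤ K :=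
  (Finset.card_filter_le _ _).trans_eq (Finset.card_range K)

theorem ltCount_le_leCount {f : ℕ → ℝ} {K : ℕ} {y z : ℝ} (h : y ≤ z) :
    ltCount f K y ≤ leCount f K z :=
  Finset.card_le_card (Finset.monotone_filter_right _ fun _ _ hg => (le_of_lt hg).trans h)

theorem ltCount_mono {f : ℕ → ℝ} {K : ℕ} {y z : ℝ} (h : y ≤ z) :
    ltCount f K y ≤ ltCount f K z :=
  Finset.card_le_card (Finset.monotone_filter_right _ fun _ _ hg => lt_of_lt_of_le hg h)

theorem leCount_mono {f : ℕ → ℝ} {K : ℕ} {y z : ℝ} (h : y ≤ z) :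
    leCount f K y ≤ leCount f K z :=
  Finset.card_le_card (Finset.monotone_filter_right _ fun _ _ hg => le_trans hg h)

theorem leCount_le_ltCount {f : ℕ → ℝ} {K : ℕ} {y z : ℝ} (h : y < z) :
    leCount f K y ≤ ltCount f K z :=
  Finset.card_le_card (Finset.monotone_filter_right _ fun _ _ hg => lt_of_le_of_lt hg h)

theorem ltCount_lt_leCount {f : ℕ → ℝ} {K g : ℕ} {y z : ℝ} (hg : g < K) (h1 : y ≤ f g)
    (h2 : f g ≤ z) : ltCount f K y < leCount f K z := by
  refine Finset.card_lt_card ((Finset.ssubset_iff_of_subset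
    (Finset.monotone_filter_right _ fun _ _ hg => (le_of_lt hg).trans (h1.trans h2))).2
      ⟨g, ?_, ?_⟩)
  · simp [hg, h2]
  · simp [h1]

/-- If `p < a`, every line at or below `p` is also below `a`, so both counts in `pos` are at most
`ltCount f K a`. This lemma and its mirror image let integer comparisons certify containment in a
box. -/
theorem le_of_two_mul_ltCount_lt {f : ℕ → ℝ} {K : ℕ} {a p : ℝ}
    (h : 2 * ltCount f K a < pos f K p) : a ≤ p := by
  by_contra hc
  push Not at hc
  have h1 := leCount_le_ltCount (f := f) (K := K) hc
  have h2 := ltCount_le_leCount (f := f) (K := K) (le_refl p)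
  unfold pos at h
  omega

theorem le_of_lt_two_mul_leCount {f : ℕ → ℝ} {K : ℕ} {b p : ℝ}
    (h : pos f K p < 2 * leCount f K b) : p ≤ b := by
  by_contra hc
  push Not at hc
  have h1 := leCount_le_ltCount (f := f) (K := K) hc
  have h2 := ltCount_le_leCount (f := f) (K := K) (le_refl p)
  unfold pos at h
  omega

/-- A line between `a` and `p` forces only the weak count up, while the strict count merely does not
fall. Adding the two counts thus lets a point on the line itself count as separated from the side.
-/
theorem two_mul_ltCount_lt {f : ℕ → ℝ} {K g : ℕ} {a p : ℝ} (hg : g < K) (h1 : a ≤ f g)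
    (h2 : f g ≤ p) : 2 * ltCount f K a < pos f K p := by
  have := ltCount_lt_leCount hg h1 h2
  have := ltCount_mono (f := f) (K := K) (h1.trans h2)
  unfold pos
  omega

theorem lt_two_mul_leCount {f : ℕ → ℝ} {K g : ℕ} {b p : ℝ} (hg : g < K) (h1 : p ≤ f g)
    (h2 : f g ≤ b) : pos f K p < 2 * leCount f K b := by
  have := ltCount_lt_leCount hg h1 h2
  have := leCount_mono (f := f) (K := K) (h1.trans h2)
  unfold pos
  omega

/-! ### Dense lines and interiors of boxes -/

variable {d n m : ℕ}

/-- Every interval with at least `β n` points (in some coordinate) contains a line. -/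
def Dense (P : Fin n → Point d) (β : ℝ) (ln : ℕ → ℕ → ℝ) (K : ℕ) : Prop :=
  ∀ (j : Fin d) (a y : ℝ),
    β * n ≤ ((Finset.univ.filter fun i => a ≤ P i j ∧ P i j ≤ y).card : ℝ) →
    ∃ g < K, a ≤ ln j g ∧ ln j g ≤ y

/-- The points whose positions are strictly inside the box, in every coordinate. -/
noncomputable def interior (P : Fin n → Point d) (ln : ℕ → ℕ → ℝ) (K : ℕ) (b : Box d) :
    Finset (Fin n) :=
  Finset.univ.filter fun i => ∀ j : Fin d, 2 * ltCount (ln j) K (b.lo j) < pos (ln j) K (P i j) ∧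
    pos (ln j) K (P i j) < 2 * leCount (ln j) K (b.hi j)

/-- A point of the box outside the interior has no line between itself and some side. For each side,
the farthest such point spans a line-free interval that contains all the others, so density allows
fewer than `ε * n / (4 * d)` of them. The `2 * d` sides lose at most `ε / 2 * n` together. -/
theorem le_card_interior (P : Fin n → Point d) (ln : ℕ → ℕ → ℝ) (K : ℕ) (b : Box d) {ε : ℝ}
    (hε : 0 < ε) (hn : 0 < n) (hd : 0 < d) (hD : Dense P (ε / (4 * d)) ln K) (hb : Heavy P ε b) :
    ε / 2 * n ≤ ((interior P ln K b).card : ℝ) := by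
  classical
  have hd' : (0 : ℝ) < d := by exact_mod_cast hd
  have hn' : (0 : ℝ) < n := by exact_mod_cast hn
  set β : ℝ := ε / (4 * d) * n with hβ
  have hβ0 : 0 < β := by positivity
  let loss : Fin d → Finset (Fin n) := fun j => Finset.univ.filter fun i =>
    b.lo j ≤ P i j ∧ ¬ ∃ g < K, b.lo j ≤ ln j g ∧ ln j g ≤ P i j
  let loss' : Fin d → Finset (Fin n) := fun j => Finset.univ.filter fun i =>
    P i j ≤ b.hi j ∧ ¬ ∃ g < K, P i j ≤ ln j g ∧ ln j g ≤ b.hi j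
  have hl : ∀ j, ((loss j).card : ℝ) < β := by
    intro j
    refine card_lt_of_max _ (fun i => P i j) hβ0 fun i hi =>
      ⟨Finset.univ.filter fun i' => b.lo j ≤ P i' j ∧ P i' j ≤ P i j, fun i' hi' hii => ?_, ?_⟩
    · simp only [loss, Finset.mem_filter, Finset.mem_univ, true_and] at hi'
      simp [hi'.1, hii]
    · by_contra hc
      simp only [loss, Finset.mem_filter, Finset.mem_univ, true_and] at hi
      exact hi.2 (hD j _ _ (not_lt.1 hc))
  have hl' : ∀ j, ((loss' j).card : ℝ) < β := by
    intro j
    refine card_lt_of_max _ (fun i => OrderDual.toDual (P i j)) hβ0 fun i hi =>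
      ⟨Finset.univ.filter fun i' => P i j ≤ P i' j ∧ P i' j ≤ b.hi j, fun i' hi' hii => ?_, ?_⟩
    · simp only [loss', Finset.mem_filter, Finset.mem_univ, true_and] at hi'
      simp only [Finset.mem_filter, Finset.mem_univ, true_and]
      exact ⟨hii, hi'.1⟩
    · by_contra hc
      simp only [loss', Finset.mem_filter, Finset.mem_univ, true_and] at hi
      exact hi.2 (hD j _ _ (not_lt.1 hc))
  have hcov : (Finset.univ.filter fun i => P i ∈ b.toSet) ⊆
      interior P ln K b ∪ Finset.univ.biUnion (fun j => loss j ∪ loss' j) := by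
    intro i hi
    simp only [Finset.mem_filter, Finset.mem_univ, true_and, Box.toSet, Set.mem_Icc] at hi
    by_cases h : ∃ j, i ∈ loss j ∪ loss' j
    · obtain ⟨j, hj⟩ := h
      exact Finset.mem_union_right _ (Finset.mem_biUnion.2 ⟨j, Finset.mem_univ _, hj⟩)
    · refine Finset.mem_union_left _ (Finset.mem_filter.2 ⟨Finset.mem_univ _, fun j => ?_⟩)
      simp only [not_exists, Finset.mem_union, not_or] at h
      obtain ⟨h1, h2⟩ := h j
      simp only [loss, loss', Finset.mem_filter, Finset.mem_univ, true_and, hi.1 j, hi.2 j,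
        not_not] at h1 h2
      obtain ⟨g, hg, h3, h4⟩ := h1
      obtain ⟨g', hg', h5, h6⟩ := h2
      exact ⟨two_mul_ltCount_lt hg h3 h4, lt_two_mul_leCount hg' h5 h6⟩
  have h1 : (countIn P b : ℝ) ≤ (interior P ln K b).card +
      ∑ j, ((loss j).card + (loss' j).card : ℝ) := by
    have : countIn P b ≤ (interior P ln K b).card + ∑ j, ((loss j).card + (loss' j).card) :=
      (Finset.card_le_card hcov).trans ((Finset.card_union_le _ _).trans (add_le_add le_rfl
        (Finset.card_biUnion_le.trans (Finset.sum_le_sum fun j _ => Finset.card_union_le _ _))))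
    exact_mod_cast this
  have h2 : ∑ j, ((loss j).card + (loss' j).card : ℝ) ≤ ∑ _j : Fin d, (β + β) :=
    Finset.sum_le_sum fun j _ => add_le_add (hl j).le (hl' j).le
  have h3 : ∑ _j : Fin d, (β + β) = ε / 2 * n := by
    simp only [Finset.sum_const, Finset.card_univ, nsmul_eq_mul, Fintype.card_fin, hβ]
    field_simp
    ring
  have h4 : ε * n ≤ countIn P b := hb
  linarith

open Classical in
/-- All but a quarter of the samples are dense. -/
theorem card_not_dense_le (P : Fin n → Point d) {ε : ℝ} (hε : 0 < ε) (hn : 0 < n) (hd : 0 < d)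
    {e K : ℕ} (he : 1 ≤ ε * 2 ^ e) (hK : 8 * d * 2 ^ e * ((13 + 3 * d) * (e + 1)) ≤ K) :
    ((Finset.univ.filter fun ω : Fin K → Fin n => ¬ ∀ (j : Fin d) (a y : ℝ), ε / (4 * d) * n ≤
      ((Finset.univ.filter fun i => a ≤ P i j ∧ P i j ≤ y).card : ℝ) →
      ∃ l, a ≤ P (ω l) j ∧ P (ω l) j ≤ y).card : ℝ) ≤ 1 / 4 * (n : ℝ) ^ K := by
  have hd' : (0 : ℝ) < d := by exact_mod_cast hd
  have hn' : (0 : ℝ) < n := by exact_mod_cast hn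
  set β : ℝ := ε / (4 * d) * n with hβ
  have hβ0 : 0 < β := by positivity
  -- Core sets replace the infinitely many intervals of one coordinate by finitely many sets, which
  -- makes a union bound possible.
  have hcore := fun j : Fin d => exists_core_sets (κ := Fin 1) (Finset.univ : Finset (Fin n))
    (fun _ i => P i j) {b | β ≤ ((Finset.univ.filter fun i =>
      b.1 0 ≤ P i j ∧ P i j ≤ b.2 0).card : ℝ)} β hβ0
    (fun b hb => by simpa [Fin.forall_fin_one] using hb)
  choose 𝓢 h1 h2 h3 using hcore
  set q := (13 + 3 * d) * (e + 1) with hq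
  have hsub : (Finset.univ.filter fun ω : Fin K → Fin n => ¬ ∀ (j : Fin d) (a y : ℝ), β ≤
      ((Finset.univ.filter fun i => a ≤ P i j ∧ P i j ≤ y).card : ℝ) →
      ∃ l, a ≤ P (ω l) j ∧ P (ω l) j ≤ y) ⊆ Finset.univ.biUnion fun j => (𝓢 j).biUnion fun S =>
        Finset.univ.filter fun ω : Fin K → Fin n => ∀ l, ω l ∉ S := by
    intro ω hω
    simp only [Finset.mem_filter, Finset.mem_univ, true_and, not_forall] at hω
    obtain ⟨j, a, y, hc, hω⟩ := hω
    obtain ⟨S, hS, hSb⟩ := h3 j (fun _ => a, fun _ => y) hc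
    simp only [Finset.mem_biUnion, Finset.mem_filter, Finset.mem_univ, true_and]
    exact ⟨j, S, hS, fun l hl => hω ⟨l, hSb _ hl 0⟩⟩
  -- Here `4 * n / β = 16 * d / ε`, and `1 / ε ≤ 2 ^ e`; the `17` absorbs the summand one.
  have hcard : ∀ j, ((𝓢 j).card : ℝ) ≤ (17 * d * 2 ^ e) ^ 2 := by
    intro j
    refine (h1 j).trans ?_
    simp only [Fintype.card_fin, Finset.card_univ, Nat.cast_one, mul_one]
    refine pow_le_pow_left₀ (by positivity) ?_ _
    have h4 : 4 * (n : ℝ) / β = 16 * d * (1 / ε) := by rw [hβ]; field_simp; ring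
    have h5 : 1 / ε ≤ 2 ^ e := by rw [div_le_iff₀ hε]; linarith
    have h6 : (1 : ℝ) ≤ d * 2 ^ e := by
      have : (1 : ℝ) ≤ d := by exact_mod_cast hd
      nlinarith [one_le_pow₀ (n := e) (by norm_num : (1 : ℝ) ≤ 2)]
    rw [h4]
    nlinarith
  have hbad : ∀ j, ∀ S ∈ 𝓢 j, ((Finset.univ.filter fun ω : Fin K → Fin n =>
      ∀ l, ω l ∉ S).card : ℝ) ≤ (1 / 2) ^ q * (n : ℝ) ^ K := by
    intro j S hS
    refine card_avoid_le (x := ε / (8 * d)) S ?_ ?_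
    · refine le_trans (le_of_eq ?_) (h2 j S hS)
      rw [hβ]; field_simp; ring
    · have h4 : (8 * d * 2 ^ e * q : ℝ) ≤ K := by exact_mod_cast hK
      calc (q : ℝ) = 1 * q := by ring
        _ ≤ (ε * 2 ^ e) * q := by gcongr
        _ = ε / (8 * d) * (8 * d * 2 ^ e * q) := by field_simp
        _ ≤ _ := by gcongr
  -- The exponent `11 + 3 * d + 2 * e` would do, since `4 * 17 ^ 2 ≤ 2 ^ 11` and `d ≤ 2 ^ d`; `q`
  -- exceeds it.
  have hfin : (d : ℝ) * ((17 * d * 2 ^ e) ^ 2 * (1 / 2) ^ q) ≤ 1 / 4 := by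
    have h4 : (d : ℝ) ≤ 2 ^ d := by exact_mod_cast Nat.lt_two_pow_self.le
    have h5 : (4 * (d * (17 * d * 2 ^ e) ^ 2) : ℝ) ≤ 2 ^ q := by
      calc (4 * (d * (17 * d * 2 ^ e) ^ 2) : ℝ) = 1156 * d ^ 3 * 2 ^ (2 * e) := by ring
        _ ≤ 2 ^ 11 * (2 ^ d) ^ 3 * 2 ^ (2 * e) := by gcongr; norm_num
        _ = 2 ^ (11 + 3 * d + 2 * e) := by ring
        _ ≤ 2 ^ q := by
          refine pow_le_pow_right₀ (by norm_num) ?_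
          rw [hq]; nlinarith
    rw [one_div, inv_pow, ← mul_assoc, ← div_eq_mul_inv, div_le_iff₀ (by positivity)]
    linarith
  calc _ ≤ (∑ j, ∑ S ∈ 𝓢 j, ((Finset.univ.filter fun ω : Fin K → Fin n =>
        ∀ l, ω l ∉ S).card : ℝ)) := by
        exact_mod_cast (Finset.card_le_card hsub).trans (Finset.card_biUnion_le.trans
          (Finset.sum_le_sum fun j _ => Finset.card_biUnion_le))
    _ ≤ ∑ j : Fin d, ∑ _S ∈ 𝓢 j, (1 / 2) ^ q * (n : ℝ) ^ K :=
        Finset.sum_le_sum fun j _ => Finset.sum_le_sum fun S hS => hbad j S hS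
    _ ≤ ∑ _j : Fin d, (17 * d * 2 ^ e) ^ 2 * ((1 / 2) ^ q * (n : ℝ) ^ K) := by
        refine Finset.sum_le_sum fun j _ => ?_
        rw [Finset.sum_const, nsmul_eq_mul]
        gcongr
        exact hcard j
    _ = (d * ((17 * d * 2 ^ e) ^ 2 * (1 / 2) ^ q)) * (n : ℝ) ^ K := by
        simp only [Finset.sum_const, Finset.card_univ, Fintype.card_fin, nsmul_eq_mul]
        ring
    _ ≤ _ := by gcongr

end BoxNet

namespace BoxNet

/-! ### Centers -/

/-- The dyadic point that splits `(x, y]`. -/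
def mid : ℕ → ℕ → ℕ → ℕ
  | 0, _, _ => 0
  | g + 1, x, y => if x / 2 ^ g < y / 2 ^ g then y / 2 ^ g * 2 ^ g else mid g x y

/-- At the highest level where `x` and `y` lie in different blocks, these blocks are the two halves
of one parent block, and `mid` is their common border. On the doubled scale every `z` strictly
between `2 * x` and `2 * y` lies in the doubled parent, so `z` and the level alone determine the
border. -/
theorem mid_spec {G x y : ℕ} (hxy : x < y) (h : x / 2 ^ G = y / 2 ^ G) :
    x < mid G x y ∧ mid G x y ≤ y ∧ ∃ g < G, ∀ z, 2 * x < z → z < 2 * y →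
      mid G x y = (2 * (z / 2 ^ (g + 2)) + 1) * 2 ^ g := by
  induction G with
  | zero => simp at h; omega
  | succ G ih =>
    have hp : 0 < 2 ^ G := by positivity
    by_cases hlt : x / 2 ^ G < y / 2 ^ G
    · rw [mid, if_pos hlt]
      have hx : x / 2 ^ (G + 1) = x / 2 ^ G / 2 := by rw [pow_succ, Nat.div_div_eq_div_mul]
      have hy : y / 2 ^ (G + 1) = y / 2 ^ G / 2 := by rw [pow_succ, Nat.div_div_eq_div_mul]
      have hy1 : y / 2 ^ G = 2 * (y / 2 ^ (G + 1)) + 1 := by omega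
      have hx1 : x / 2 ^ G = 2 * (y / 2 ^ (G + 1)) := by omega
      refine ⟨(Nat.div_lt_iff_lt_mul hp).1 hlt, Nat.div_mul_le_self _ _, G, by omega, ?_⟩
      intro z hz1 hz2
      suffices z / 2 ^ (G + 2) = y / 2 ^ (G + 1) by rw [this, ← hy1]
      set q := y / 2 ^ (G + 1) with hq
      have h1 : q * 2 ^ (G + 1) ≤ x := by
        have := Nat.div_mul_le_self x (2 ^ G)
        rw [hx1] at this
        calc q * 2 ^ (G + 1) = 2 * q * 2 ^ G := by ring
          _ ≤ x := this
      have h2 : y < (q + 1) * 2 ^ (G + 1) := (Nat.div_lt_iff_lt_mul (by positivity)).1 (by omega)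
      have h3 : 2 ^ (G + 2) = 2 * 2 ^ (G + 1) := by ring
      refine Nat.div_eq_of_lt_le ?_ ?_
      · rw [h3]; nlinarith
      · rw [h3]; nlinarith
    · have heq : x / 2 ^ G = y / 2 ^ G := le_antisymm (Nat.div_le_div_right hxy.le) (not_lt.1 hlt)
      rw [mid, if_neg hlt]
      obtain ⟨h1, h2, g, hg, h3⟩ := ih heq
      exact ⟨h1, h2, g, by omega, h3⟩

variable {d n m : ℕ}

/-- The center of a box. -/
noncomputable def center (ln : ℕ → ℕ → ℝ) (K G : ℕ) (b : Box d) : Fin d → ℕ := fun j =>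
  mid G (ltCount (ln j) K (b.lo j)) (leCount (ln j) K (b.hi j))

open Classical in
/-- The centers of the boxes whose interiors are missed by the sample `ω`. -/
noncomputable def badCenters (P : Fin n → Point d) (B : Fin m → Box d) (ln : ℕ → ℕ → ℝ) (K G : ℕ)
    {S : ℕ} (ω : Fin S → Fin n) : Finset (Fin d → ℕ) :=
  (Finset.univ.filter fun b : Fin m => ∀ l, ω l ∉ interior P ln K (B b)).image
    fun b => center ln K G (B b)

/-- The points in the cell of a center. -/
noncomputable def cell (P : Fin n → Point d) (ln : ℕ → ℕ → ℝ) (K G : ℕ) (c : Fin d → ℕ) :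
    Finset (Fin n) :=
  Finset.univ.filter fun i => ∃ h : Fin d → Fin G,
    (fun j : Fin d => (2 * (pos (ln j) K (P i j) / 2 ^ ((h j : ℕ) + 2)) + 1) * 2 ^ (h j : ℕ)) = c

/-- A point together with a level in each coordinate determines a single center, so the pairs
counted for different centers are different. -/
theorem sum_card_cell_le (P : Fin n → Point d) (ln : ℕ → ℕ → ℝ) (K G : ℕ)
    (s : Finset (Fin d → ℕ)) : ∑ c ∈ s, (cell P ln K G c).card ≤ n * G ^ d := by
  classical
  let φ : Fin n × (Fin d → Fin G) → (Fin d → ℕ) := fun p (j : Fin d) =>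
    (2 * (pos (ln j) K (P p.1 j) / 2 ^ ((p.2 j : ℕ) + 2)) + 1) * 2 ^ (p.2 j : ℕ)
  have h1 : ∀ c, (cell P ln K G c).card ≤ (Finset.univ.filter fun p => φ p = c).card := by
    intro c
    refine (Finset.card_le_card (t := (Finset.univ.filter fun p => φ p = c).image Prod.fst)
      fun i hi => ?_).trans Finset.card_image_le
    simp only [cell, Finset.mem_filter, Finset.mem_univ, true_and] at hi
    obtain ⟨h, hh⟩ := hi
    exact Finset.mem_image.2 ⟨(i, h), by simp [φ, hh], rfl⟩
  calc ∑ c ∈ s, (cell P ln K G c).card ≤ ∑ c ∈ s, (Finset.univ.filter fun p => φ p = c).card :=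
        Finset.sum_le_sum fun c _ => h1 c
    _ = (s.biUnion fun c => Finset.univ.filter fun p => φ p = c).card := by
        rw [Finset.card_biUnion]
        intro c _ c' _ hne
        rw [Function.onFun, Finset.disjoint_left]
        intro p hp hp'
        simp only [Finset.mem_filter, Finset.mem_univ, true_and] at hp hp'
        exact hne (hp.symm.trans hp')
    _ ≤ _ := (Finset.card_le_univ _).trans (le_of_eq (by simp))

/-- The levels supplied by `mid_spec` depend on the box only, and each interior point recovers the
center from them. `K < 2 ^ G` puts all ranks into a single block at the top. -/
theorem interior_subset_cell (P : Fin n → Point d) (ln : ℕ → ℕ → ℝ) {K G : ℕ} (hK : K < 2 ^ G)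
    (b : Box d) : interior P ln K b ⊆ cell P ln K G (center ln K G b) := by
  intro i hi
  simp only [interior, Finset.mem_filter, Finset.mem_univ, true_and] at hi
  have h := fun j : Fin d => mid_spec (G := G)
    (show ltCount (ln j) K (b.lo j) < leCount (ln j) K (b.hi j) by
      have := hi j; omega) (by
      rw [Nat.div_eq_of_lt ((ltCount_le _ _ _).trans_lt hK),
        Nat.div_eq_of_lt ((leCount_le _ _ _).trans_lt hK)])
  choose g hg hz using fun j => (h j).2.2
  refine Finset.mem_filter.2 ⟨Finset.mem_univ _, fun j => ⟨g j, hg j⟩, ?_⟩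
  funext j
  exact (hz j _ (hi j).1 (hi j).2).symm

open Classical in
-- A first-moment argument over centers instead of boxes. The heavy centers `H` are so few that all
-- of them may be missed. Each light center in `L` has few core sets and is therefore missed by a
-- small fraction of the samples; averaging over samples and Markov's inequality finish the count.
theorem card_many_badCenters_le (P : Fin n → Point d) (B : Fin m → Box d) (ln : ℕ → ℕ → ℝ) {ε : ℝ}
    (hε : 0 < ε) (hn : 0 < n) (hd : 0 < d) {e K G S q : ℕ} (hG : 0 < G) (he : 1 ≤ ε * 2 ^ e)
    (hK : K < 2 ^ G) (hD : Dense P (ε / (4 * d)) ln K) (hB : ∀ b, Heavy P ε (B b))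
    (hq : 2 * G ^ d * (8 * d * G ^ d + 1) ^ (2 * d) ≤ 2 ^ q) (hS : 4 * 2 ^ e * q ≤ S) :
    ((Finset.univ.filter fun ω : Fin S → Fin n =>
      5 * 2 ^ e < (badCenters P B ln K G ω).card).card : ℝ) ≤ 1 / 4 * (n : ℝ) ^ S := by
  have hd' : (0 : ℝ) < d := by exact_mod_cast hd
  have hn' : (0 : ℝ) < n := by exact_mod_cast hn
  have hG' : (0 : ℝ) < G := by exact_mod_cast hG
  have : Nonempty (Fin d) := ⟨⟨0, hd⟩⟩
  have he' : 1 / ε ≤ 2 ^ e := by rw [div_le_iff₀ hε]; linarith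
  set w : (Fin d → ℕ) → ℝ := fun c => ((cell P ln K G c).card : ℝ) with hw
  set C : Finset (Fin d → ℕ) := Finset.univ.image fun b => center ln K G (B b) with hC
  have hCw : ∀ c ∈ C, ε / 2 * n ≤ w c := by
    intro c hc
    obtain ⟨b, -, rfl⟩ := Finset.mem_image.1 hc
    exact (le_card_interior P ln K (B b) hε hn hd hD (hB b)).trans
      (Nat.cast_le.2 (Finset.card_le_card (interior_subset_cell P ln hK (B b))))
  have hsum : ∀ s : Finset (Fin d → ℕ), ∑ c ∈ s, w c ≤ n * (G : ℝ) ^ d := fun s => by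
    have := sum_card_cell_le P ln K G s
    simp only [hw]
    exact_mod_cast this
  set H := C.filter fun c => (G : ℝ) ^ d * ε * n ≤ w c with hH
  set L := C.filter fun c => ¬ (G : ℝ) ^ d * ε * n ≤ w c with hL
  have hHcard : (H.card : ℝ) ≤ 2 ^ e := by
    have h1 : (H.card : ℝ) * ((G : ℝ) ^ d * ε * n) ≤ n * (G : ℝ) ^ d := by
      refine le_trans ?_ (hsum H)
      rw [← nsmul_eq_mul]
      exact Finset.card_nsmul_le_sum _ _ _ fun c hc => (Finset.mem_filter.1 hc).2
    refine le_trans ?_ he'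
    rw [le_div_iff₀ hε]
    have h2 : 0 < (n : ℝ) * (G : ℝ) ^ d := by positivity
    nlinarith
  have hLcard : (L.card : ℝ) ≤ 2 * (G : ℝ) ^ d * 2 ^ e := by
    have h1 : (L.card : ℝ) * (ε / 2 * n) ≤ n * (G : ℝ) ^ d := by
      refine le_trans ?_ (hsum L)
      rw [← nsmul_eq_mul]
      exact Finset.card_nsmul_le_sum _ _ _ fun c hc => hCw c (Finset.mem_filter.1 hc).1
    have h2 : (L.card : ℝ) * ε ≤ 2 * (G : ℝ) ^ d := by
      have h3 : (L.card : ℝ) * ε * n ≤ 2 * (G : ℝ) ^ d * n := by nlinarith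
      exact le_of_mul_le_mul_right h3 hn'
    calc (L.card : ℝ) = L.card * ε * (1 / ε) := by field_simp
      _ ≤ 2 * (G : ℝ) ^ d * 2 ^ e := by gcongr
  have hlight : ∀ c ∈ L, ((Finset.univ.filter fun ω : Fin S → Fin n =>
      c ∈ badCenters P B ln K G ω).card : ℝ) ≤
        (8 * d * G ^ d + 1) ^ (2 * d) * ((1 / 2) ^ q * (n : ℝ) ^ S) := by
    intro c hc
    obtain ⟨hcC, hcw⟩ := Finset.mem_filter.1 hc
    -- Core sets need closed ranges; for integer positions the strict inequalities of `interior`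
    -- close up by `+ 1` and `- 1`.
    obtain ⟨𝓢, h1, h2, h3⟩ := exists_core_sets (cell P ln K G c)
      (fun (j : Fin d) i => pos (ln j) K (P i j))
      {p | ∃ b, center ln K G (B b) = c ∧ p = (fun j : Fin d => 2 * ltCount (ln j) K ((B b).lo j) + 1,
        fun j : Fin d => 2 * leCount (ln j) K ((B b).hi j) - 1)} (ε / 2 * n) (by positivity) (by
        rintro _ ⟨b, hb, rfl⟩
        have h4 : interior P ln K (B b) ⊆ (cell P ln K G c).filter fun i => ∀ j : Fin d,
            2 * ltCount (ln j) K ((B b).lo j) + 1 ≤ pos (ln j) K (P i j) ∧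
            pos (ln j) K (P i j) ≤ 2 * leCount (ln j) K ((B b).hi j) - 1 := by
          intro i hi
          refine Finset.mem_filter.2
            ⟨hb ▸ interior_subset_cell P ln hK (B b) hi, fun j => ?_⟩
          have := (Finset.mem_filter.1 hi).2 j
          omega
        refine ((le_card_interior P ln K (B b) hε hn hd hD (hB b)).trans
          (Nat.cast_le.2 (Finset.card_le_card h4))).trans (le_of_eq ?_)
        congr!)
    have hsub : (Finset.univ.filter fun ω : Fin S → Fin n => c ∈ badCenters P B ln K G ω) ⊆
        𝓢.biUnion fun T => Finset.univ.filter fun ω : Fin S → Fin n => ∀ l, ω l ∉ T := by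
      intro ω hω
      simp only [Finset.mem_filter, Finset.mem_univ, true_and, badCenters, Finset.mem_image] at hω
      obtain ⟨b, hb, hbc⟩ := hω
      obtain ⟨T, hT, hTb⟩ := h3 _ ⟨b, hbc, rfl⟩
      simp only [Finset.mem_biUnion, Finset.mem_filter, Finset.mem_univ, true_and]
      refine ⟨T, hT, fun l hl => hb l (Finset.mem_filter.2 ⟨Finset.mem_univ _, fun j => ?_⟩)⟩
      have := hTb _ hl j
      dsimp only at this
      omega
    -- Lightness bounds the cell by `G ^ d * ε * n`, while each range holds `ε / 2 * n` points of
    -- it: the ratio is `2 * G ^ d`.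
    have hcard : (𝓢.card : ℝ) ≤ (8 * d * G ^ d + 1) ^ (2 * d) := by
      refine h1.trans ?_
      rw [Fintype.card_fin]
      refine pow_le_pow_left₀ (by positivity) ?_ _
      gcongr
      rw [div_le_iff₀ (by positivity)]
      have := (not_le.1 hcw).le
      simp only [hw] at this
      nlinarith
    calc _ ≤ ∑ T ∈ 𝓢, ((Finset.univ.filter fun ω : Fin S → Fin n => ∀ l, ω l ∉ T).card : ℝ) := by
          exact_mod_cast (Finset.card_le_card hsub).trans Finset.card_biUnion_le
      _ ≤ ∑ _T ∈ 𝓢, (1 / 2) ^ q * (n : ℝ) ^ S := by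
          -- A core has at least half of `ε / 2 * n` points, hence density `ε / 4`, which the factor
          -- `4` in the sample size compensates.
          refine Finset.sum_le_sum fun T hT => card_avoid_le (x := ε / 4) T ?_ ?_
          · exact le_trans (le_of_eq (by ring)) (h2 T hT)
          · have h4 : (4 * 2 ^ e * q : ℝ) ≤ S := by exact_mod_cast hS
            calc (q : ℝ) = 1 * q := by ring
              _ ≤ (ε * 2 ^ e) * q := by gcongr
              _ = ε / 4 * (4 * 2 ^ e * q) := by ring
              _ ≤ _ := by gcongr
      _ ≤ _ := by
          rw [Finset.sum_const, nsmul_eq_mul]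
          gcongr
  have hexp : ∑ ω : Fin S → Fin n, ((L.filter fun c => c ∈ badCenters P B ln K G ω).card : ℝ) ≤
      2 ^ e * (n : ℝ) ^ S := by
    have hswap : ∑ ω : Fin S → Fin n, (L.filter fun c => c ∈ badCenters P B ln K G ω).card =
        ∑ c ∈ L, (Finset.univ.filter fun ω : Fin S → Fin n =>
          c ∈ badCenters P B ln K G ω).card := by
      simp only [Finset.card_filter]
      exact Finset.sum_comm
    have hq' : (2 * G ^ d * (8 * d * G ^ d + 1) ^ (2 * d) : ℝ) * (1 / 2) ^ q ≤ 1 := by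
      rw [one_div, inv_pow, ← div_eq_mul_inv, div_le_one (by positivity)]
      exact_mod_cast hq
    calc ∑ ω : Fin S → Fin n, ((L.filter fun c => c ∈ badCenters P B ln K G ω).card : ℝ)
        = ∑ c ∈ L, ((Finset.univ.filter fun ω : Fin S → Fin n =>
          c ∈ badCenters P B ln K G ω).card : ℝ) := by exact_mod_cast hswap
      _ ≤ ∑ _c ∈ L, (8 * d * G ^ d + 1) ^ (2 * d) * ((1 / 2) ^ q * (n : ℝ) ^ S) :=
          Finset.sum_le_sum hlight
      _ = L.card * ((8 * d * G ^ d + 1) ^ (2 * d) * ((1 / 2) ^ q * (n : ℝ) ^ S)) := by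
          rw [Finset.sum_const, nsmul_eq_mul]
      _ ≤ (2 * (G : ℝ) ^ d * 2 ^ e) *
          ((8 * d * G ^ d + 1) ^ (2 * d) * ((1 / 2) ^ q * (n : ℝ) ^ S)) := by gcongr
      _ = 2 ^ e * (n : ℝ) ^ S *
          ((2 * G ^ d * (8 * d * G ^ d + 1) ^ (2 * d)) * (1 / 2) ^ q) := by ring
      _ ≤ 2 ^ e * (n : ℝ) ^ S * 1 := by gcongr
      _ = _ := mul_one _
  set bad := Finset.univ.filter fun ω : Fin S → Fin n =>
    5 * 2 ^ e < (badCenters P B ln K G ω).card with hbad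
  -- Of more than `5 * 2 ^ e` missed centers at most `2 ^ e` are heavy, so at least `4 * 2 ^ e` are
  -- light.
  have hmarkov : (bad.card : ℝ) * (4 * 2 ^ e) ≤ 2 ^ e * (n : ℝ) ^ S := by
    refine le_trans ?_ hexp
    refine le_trans ?_ (Finset.sum_le_sum_of_subset_of_nonneg (Finset.subset_univ bad)
      fun _ _ _ => by positivity)
    rw [← nsmul_eq_mul]
    refine Finset.card_nsmul_le_sum _ _ _ fun ω hω => ?_
    have h1 : 5 * 2 ^ e < (badCenters P B ln K G ω).card := (Finset.mem_filter.1 hω).2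
    have hsub : badCenters P B ln K G ω ⊆ H ∪ L.filter fun c => c ∈ badCenters P B ln K G ω := by
      intro c hc
      have hcC : c ∈ C := by
        obtain ⟨b, -, rfl⟩ := Finset.mem_image.1 hc
        exact Finset.mem_image_of_mem _ (Finset.mem_univ _)
      by_cases h : (G : ℝ) ^ d * ε * n ≤ w c
      · exact Finset.mem_union_left _ (Finset.mem_filter.2 ⟨hcC, h⟩)
      · exact Finset.mem_union_right _ (Finset.mem_filter.2 ⟨Finset.mem_filter.2 ⟨hcC, h⟩, hc⟩)
    have h2 := (Finset.card_le_card hsub).trans (Finset.card_union_le _ _)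
    have h3 : H.card ≤ 2 ^ e := by exact_mod_cast hHcard
    have h4 : 4 * 2 ^ e ≤ (L.filter fun c => c ∈ badCenters P B ln K G ω).card := by omega
    exact_mod_cast h4
  have h2e : (0 : ℝ) < 2 ^ e := by positivity
  have : (bad.card : ℝ) * 4 * 2 ^ e ≤ (n : ℝ) ^ S * 2 ^ e := by linarith
  have := le_of_mul_le_mul_right this h2e
  linarith

end BoxNet

namespace RealRAM

/-- The natural number variable `x`: cell `0` of array `x`. -/
abbrev NExpr.var (x : ℕ) : NExpr := .get x (.lit 0)

/-- `x := e` -/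
abbrev Cmd.assign (x : ℕ) (e : NExpr) : Cmd := .setNat x (.lit 0) e

variable {σ : Goal}

/-! ### Binary search -/

/-- `x < y` or `x ≤ y`. -/
def Below (strict : Bool) (x y : ℝ) : Prop := if strict then x < y else x ≤ y

/-- The number of values below `y`. -/
noncomputable def belowCount (strict : Bool) (f : ℕ → ℝ) (K : ℕ) (y : ℝ) : ℕ :=
  if strict then BoxNet.ltCount f K y else BoxNet.leCount f K y

theorem Below.of_le {strict : Bool} {x x' y : ℝ} (h : Below strict x' y) (hx : x ≤ x') :
    Below strict x y := by
  cases strict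
  · exact hx.trans h
  · exact lt_of_le_of_lt hx h

theorem belowCount_eq {strict : Bool} {f : ℕ → ℝ} {K r : ℕ} {y : ℝ} (hr : r ≤ K)
    (h1 : ∀ g < r, Below strict (f g) y) (h2 : ∀ g < K, r ≤ g → ¬ Below strict (f g) y) :
    belowCount strict f K y = r := by
  classical
  have key : ((Finset.range K).filter fun g => Below strict (f g) y) = Finset.range r := by
    ext g
    simp only [Finset.mem_filter, Finset.mem_range]
    constructor
    · rintro ⟨hg, h⟩
      by_contra hc
      exact h2 g hg (by omega) h
    · exact fun hg => ⟨by omega, h1 g hg⟩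
  have := congrArg Finset.card key
  rw [Finset.card_range] at this
  rw [← this]
  cases strict <;>
  · simp only [belowCount, BoxNet.ltCount, BoxNet.leCount, Below]
    congr!

/-- The test whether `x` is below `y`. -/
def belowTest (strict : Bool) (x y : RExpr) : BExpr :=
  if strict then .ltReal x y else .neg (.ltReal y x)

theorem eval_belowTest (strict : Bool) (x y : RExpr) (s : State) :
    (belowTest strict x y).eval s ↔ Below strict (x.eval s) (y.eval s) := by
  cases strict <;> simp [belowTest, Below, BExpr.eval]

/-- Variable `12` becomes the number of values in array `a` below `y`. -/
def search (strict : Bool) (a : ℕ) (y : RExpr) : Cmd :=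
  .seq (.assign 12 (.lit 0)) (.seq (.assign 13 (.var 7)) (forLoop 14 (.sub (.var 6) (.lit 1))
    (.seq (.branch (.conj (.neg (.ltNat (.var 7) (.add (.var 12) (.var 13))))
        (belowTest strict (.get a (.sub (.add (.var 12) (.var 13)) (.lit 1))) y))
      (.assign 12 (.add (.var 12) (.var 13))) .skip)
    (.assign 13 (.div (.var 13) (.lit 2))))))

/-- Binary search with step sizes `2 ^ H, …, 2, 1`: a step is taken if the last value it would skip
is still below `y`. There are `H + 1` passes instead of `H`, because the answer may be `2 ^ H`
itself. -/
theorem search_ends (strict : Bool) (a : ℕ) (y : RExpr) {s : State} {H : ℕ} {Y : ℝ}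
    (hG : s.nat 6 0 = H + 2) (hK : s.nat 7 0 = 2 ^ H)
    (hy : ∀ s', Frame [12, 13, 14] [] s s' → y.eval s' = Y)
    (hsort : ∀ g g', g ≤ g' → g' < 2 ^ H → s.real a g ≤ s.real a g') :
    Ends σ (search strict a y) s (10 * (H + 2)) (fun s' => Frame [12, 13, 14] [] s s' ∧
      s'.nat 12 0 = belowCount strict (s.real a) (2 ^ H) Y) := by
  refine Ends.pre fun hb => ?_
  have hGW : H + 2 ≤ σ.word := hG ▸ hb 6 0
  have hKW : 2 ^ H ≤ σ.word := hK ▸ hb 7 0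
  -- The count is at least variable `12` and less than variable `12` plus `2 ^ (H + 1 - q)`; after
  -- `H + 1` passes this leaves one value.
  let I : ℕ → State → Prop := fun q s' => Frame [12, 13, 14] [] s s' ∧
    s'.nat 13 0 = 2 ^ H / 2 ^ q ∧ s'.nat 12 0 ≤ 2 ^ H ∧
    (∀ g < s'.nat 12 0, Below strict (s.real a g) Y) ∧
    ∀ g < 2 ^ H, s'.nat 12 0 + 2 ^ (H + 1 - q) ≤ g + 1 → ¬ Below strict (s.real a g) Y
  have hmain : ∀ s₁, I 0 s₁ → Ends σ (forLoop 14 (.sub (.var 6) (.lit 1))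
    (.seq (.branch (.conj (.neg (.ltNat (.var 7) (.add (.var 12) (.var 13))))
        (belowTest strict (.get a (.sub (.add (.var 12) (.var 13)) (.lit 1))) y))
      (.assign 12 (.add (.var 12) (.var 13))) .skip)
    (.assign 13 (.div (.var 13) (.lit 2))))) s₁ ((H + 1) * (4 + 3) + 3)
      (fun s' => I (H + 1) s' ∧ s'.nat 14 0 = H + 1) := by
    intro s₁ h₁
    refine Ends.forLoop I (H + 1) (by omega) ?_ ?_ ?_
    · rintro q - s' ⟨hf, -⟩
      simp [NExpr.eval, hf.nat 6 (by simp), hG]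
    · obtain ⟨hf, h2, h3, h4, h5⟩ := h₁
      exact ⟨hf.writeNat (by simp), by simpa using h2, by simpa using h3, by simpa using h4,
        by simpa using h5⟩
    · rintro q hq s' hb' ⟨hf, h2, h3, h4, h5⟩ hq'
      have h7 : s'.nat 7 0 = 2 ^ H := by rw [hf.nat 7 (by simp), hK]
      have hw : 2 ^ H / 2 ^ q = 2 ^ (H - q) := Nat.pow_div (by omega) (by norm_num)
      have hw2 : 2 ^ (H + 1 - q) = 2 * 2 ^ (H - q) := by
        rw [← pow_succ', show H + 1 - q = H - q + 1 by omega]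
      have hw3 : H + 1 - (q + 1) = H - q := by omega
      have hpos : 0 < 2 ^ (H - q) := by positivity
      have hra : s'.real a = s.real a := hf.real a (by simp)
      have hdiv : 2 ^ H / 2 ^ q / 2 = 2 ^ H / 2 ^ (q + 1) := by
        rw [pow_succ, Nat.div_div_eq_div_mul]
      have hdle : 2 ^ H / 2 ^ q / 2 ≤ σ.word :=
        (Nat.div_le_self _ _).trans ((Nat.div_le_self _ _).trans hKW)
      refine Ends.seq (T₁ := 2) (T₂ := 1) (Q₁ := fun s'' => s''.nat 14 0 = q ∧
        s''.nat 13 0 = 2 ^ H / 2 ^ q ∧ I (q + 1) (s''.writeNat 13 0 (2 ^ H / 2 ^ (q + 1))))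
        (Ends.branch ?_ ?_) ?_
      · intro ht
        simp only [BExpr.eval, eval_belowTest, NExpr.eval, RExpr.eval, h7, h2, hw, not_lt,
          hy s' hf, hra] at ht
        obtain ⟨ht1, ht2⟩ := ht
        refine Ends.setNat ?_ ?_
        · intro _
          simp only [NExpr.eval, h2, hw]
          omega
        · simp only [NExpr.eval, h2, hw]
          refine ⟨by simp [hq'], by simp [h2, hw], (hf.writeNat (by simp)).writeNat (by simp),
            by simp, by simpa using ht1, ?_, ?_⟩
          · intro g hg
            simp only [writeNat_nat] at hg
            refine ht2.of_le (hsort _ _ ?_ ?_)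
            · simp at hg; omega
            · omega
          · intro g hg hg'
            refine h5 g hg ?_
            rw [hw3] at hg'
            simp at hg'
            omega
      · intro ht
        simp only [BExpr.eval, eval_belowTest, NExpr.eval, RExpr.eval, h7, h2, hw, not_lt,
          hy s' hf, hra, not_and] at ht
        refine Ends.skip ⟨hq', h2, hf.writeNat (by simp), by simp, by simpa using h3,
          by simpa using h4, ?_⟩
        intro g hg hg'
        rw [hw3] at hg'
        simp at hg'
        refine fun hbel => ht (by omega) (hbel.of_le (hsort _ _ ?_ hg))
        omega
      · rintro s'' - ⟨h14, h13, hI⟩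
        refine Ends.setNat ?_ ?_
        · intro _
          simpa [NExpr.eval, h13] using hdle
        · simp only [NExpr.eval, h13, hdiv]
          refine ⟨by simp [h14], ?_⟩
          obtain ⟨hf, h2, h3, h4, h5⟩ := hI
          exact ⟨hf.writeNat (by simp), by simp, by simpa using h3, by simpa using h4,
            by simpa using h5⟩
  refine (Ends.seq (Ends.setNat (Q := fun s' => s' = s.writeNat 12 0 0) ?_ rfl) fun s₁ _ e₁ =>
    Ends.seq (Ends.setNat (Q := fun s' => s' = s₁.writeNat 13 0 (2 ^ H)) ?_ ?_)
      fun s₂ _ e₂ => hmain s₂ ?_).mono ?_ ?_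
  · simp [NExpr.eval]
  · subst e₁
    simp [NExpr.eval, hK, hKW]
  · subst e₁
    simp [NExpr.eval, hK]
  · subst e₁ e₂
    refine ⟨((Frame.refl _ _ _).writeNat (by simp)).writeNat (by simp), by simp, by simp, by simp,
      ?_⟩
    intro g hg hg'
    simp [pow_succ] at hg'
    omega
  · omega
  · rintro s' - ⟨⟨hf, -, h3, h4, h5⟩, -⟩
    refine ⟨hf, (belowCount_eq h3 h4 fun g hg hg' => h5 g hg ?_).symm⟩
    simp
    omega

/-! ### Merge sort -/

/-- Merging has put the first `t` values of the block of `f` at `base` into `g`; the next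
candidates are at `i` and `j`. -/
structure Merged (f g : ℕ → ℝ) (base w t i j : ℕ) : Prop where
  base_le : base ≤ i
  i_le : i ≤ base + w
  le_j : base + w ≤ j
  j_le : j ≤ base + 2 * w
  sum : i + j = 2 * base + w + t
  sorted : ∀ x y, base ≤ x → x ≤ y → y < base + t → g x ≤ g y
  le_left : ∀ x z, base ≤ x → x < base + t → i ≤ z → z < base + w → g x ≤ f z
  le_right : ∀ x z, base ≤ x → x < base + t → j ≤ z → z < base + 2 * w → g x ≤ f z
  left : ∀ z, base ≤ z → z < i → ∃ x, base ≤ x ∧ x < base + t ∧ g x = f z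
  right : ∀ z, base + w ≤ z → z < j → ∃ x, base ≤ x ∧ x < base + t ∧ g x = f z

/-- The smaller of the two candidates is at most everything that remains in either half, so
appending it keeps the output sorted and below the rest. `hij` demands nothing once the right half
is exhausted. -/
theorem Merged.takeLeft {f g : ℕ → ℝ} {base w t i j : ℕ} (h : Merged f g base w t i j)
    (hs : ∀ x y, base ≤ x → x ≤ y → y < base + w → f x ≤ f y)
    (hs' : ∀ x y, base + w ≤ x → x ≤ y → y < base + 2 * w → f x ≤ f y)
    (hi : i < base + w) (hij : j < base + 2 * w → f i ≤ f j) :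
    Merged f (Function.update g (base + t) (f i)) base w (t + 1) (i + 1) j := by
  have hne : ∀ x, x < base + t → Function.update g (base + t) (f i) x = g x := fun x hx =>
    Function.update_of_ne hx.ne _ _
  have hcase : ∀ x, x < base + (t + 1) → x < base + t ∨ x = base + t := by omega
  have hb := h.base_le
  refine ⟨by omega, by omega, h.le_j, h.j_le, by have := h.sum; omega, ?_, ?_, ?_, ?_, ?_⟩
  · intro x y hx hxy hy
    rcases hcase y hy with hy | rfl
    · rw [hne x (by omega), hne y hy]
      exact h.sorted x y hx hxy hy
    · rcases hcase x (by omega) with hx' | rfl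
      · rw [hne x hx', Function.update_self]
        exact h.le_left x i hx hx' le_rfl hi
      · exact le_rfl
  · intro x z hx hx' hz hz'
    rcases hcase x hx' with hx' | rfl
    · rw [hne x hx']
      exact h.le_left x z hx hx' (by omega) hz'
    · rw [Function.update_self]
      exact hs i z hb (by omega) hz'
  · intro x z hx hx' hz hz'
    rcases hcase x hx' with hx' | rfl
    · rw [hne x hx']
      exact h.le_right x z hx hx' hz hz'
    · rw [Function.update_self]
      exact (hij (by omega)).trans (hs' j z h.le_j hz hz')
  · intro z hz hz'
    rcases (show z < i ∨ z = i by omega) with hz' | rfl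
    · obtain ⟨x, h1, h2, h3⟩ := h.left z hz hz'
      exact ⟨x, h1, by omega, by rw [hne x h2, h3]⟩
    · exact ⟨base + t, by omega, by omega, Function.update_self ..⟩
  · intro z hz hz'
    obtain ⟨x, h1, h2, h3⟩ := h.right z hz hz'
    exact ⟨x, h1, by omega, by rw [hne x h2, h3]⟩

theorem Merged.takeRight {f g : ℕ → ℝ} {base w t i j : ℕ} (h : Merged f g base w t i j)
    (hs : ∀ x y, base ≤ x → x ≤ y → y < base + w → f x ≤ f y)
    (hs' : ∀ x y, base + w ≤ x → x ≤ y → y < base + 2 * w → f x ≤ f y)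
    (hj : j < base + 2 * w) (hij : i < base + w → f j ≤ f i) :
    Merged f (Function.update g (base + t) (f j)) base w (t + 1) i (j + 1) := by
  have hne : ∀ x, x < base + t → Function.update g (base + t) (f j) x = g x := fun x hx =>
    Function.update_of_ne hx.ne _ _
  have hcase : ∀ x, x < base + (t + 1) → x < base + t ∨ x = base + t := by omega
  have hb := h.base_le
  have hb' := h.le_j
  refine ⟨hb, h.i_le, by omega, by omega, by have := h.sum; omega, ?_, ?_, ?_, ?_, ?_⟩
  · intro x y hx hxy hy
    rcases hcase y hy with hy | rfl
    · rw [hne x (by omega), hne y hy]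
      exact h.sorted x y hx hxy hy
    · rcases hcase x (by omega) with hx' | rfl
      · rw [hne x hx', Function.update_self]
        exact h.le_right x j hx hx' le_rfl hj
      · exact le_rfl
  · intro x z hx hx' hz hz'
    rcases hcase x hx' with hx' | rfl
    · rw [hne x hx']
      exact h.le_left x z hx hx' hz hz'
    · rw [Function.update_self]
      exact (hij (by omega)).trans (hs i z hb hz hz')
  · intro x z hx hx' hz hz'
    rcases hcase x hx' with hx' | rfl
    · rw [hne x hx']
      exact h.le_right x z hx hx' (by omega) hz'
    · rw [Function.update_self]
      exact hs' j z hb' (by omega) hz'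
  · intro z hz hz'
    obtain ⟨x, h1, h2, h3⟩ := h.left z hz hz'
    exact ⟨x, h1, by omega, by rw [hne x h2, h3]⟩
  · intro z hz hz'
    rcases (show z < j ∨ z = j by omega) with hz' | rfl
    · obtain ⟨x, h1, h2, h3⟩ := h.right z hz hz'
      exact ⟨x, h1, by omega, by rw [hne x h2, h3]⟩
    · exact ⟨base + t, by omega, by omega, Function.update_self ..⟩

/-- The start of the current block. -/
def blockStart : NExpr := .mul (.var 19) (.mul (.lit 2) (.var 17))

/-- One step of merging. -/
def mergeStep (a : ℕ) : Cmd :=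
  .branch (.conj (.ltNat (.var 21) (.add blockStart (.var 17)))
      (.neg (.conj (.ltNat (.var 22) (.add blockStart (.mul (.lit 2) (.var 17))))
        (.ltReal (.get a (.var 22)) (.get a (.var 21))))))
    (.seq (.setReal 5 (.add blockStart (.var 20)) (.get a (.var 21)))
      (.assign 21 (.add (.var 21) (.lit 1))))
    (.seq (.setReal 5 (.add blockStart (.var 20)) (.get a (.var 22)))
      (.assign 22 (.add (.var 22) (.lit 1))))

/-- Merge the halves of a block of array `a` into array `5`. -/
def mergeBlock (a : ℕ) : Cmd :=
  .seq (.assign 21 blockStart) (.seq (.assign 22 (.add blockStart (.var 17)))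
    (forLoop 20 (.mul (.lit 2) (.var 17)) (mergeStep a)))

theorem writeReal_self (s : State) (a i : ℕ) (v : ℝ) :
    (s.writeReal a i v).real a = Function.update (s.real a) i v := by
  simp [State.writeReal]

theorem mergeBlock_ends (a : ℕ) (ha : a ≠ 5) {s : State} {b w K : ℕ} (hb : s.nat 19 0 = b)
    (hw : s.nat 17 0 = w) (hw0 : 0 < w) (hK : K ≤ σ.word) (hbK : (b + 1) * (2 * w) ≤ K)
    (hs : ∀ x y, x ≤ y → y < K → x / w = y / w → s.real a x ≤ s.real a y) :
    Ends σ (mergeBlock a) s (14 * w + 10) (fun s' => Frame [20, 21, 22] [5] s s' ∧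
      (∀ x < b * (2 * w), s'.real 5 x = s.real 5 x) ∧
      Merged (s.real a) (s'.real 5) (b * (2 * w)) w (2 * w) (b * (2 * w) + w)
        (b * (2 * w) + 2 * w)) := by
  set base := b * (2 * w) with hbase
  have hK' : base + 2 * w ≤ K := by rw [hbase]; linarith
  -- The two halves of the block are the runs number `2 * b` and `2 * b + 1` of width `w`, which is
  -- how `hs` applies to them.
  have hs1 : ∀ x y, base ≤ x → x ≤ y → y < base + w → s.real a x ≤ s.real a y := by
    intro x y hx hxy hy
    have h1 : base = (2 * b) * w := by rw [hbase]; ring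
    refine hs x y hxy (by omega) ?_
    rw [Nat.div_eq_of_lt_le (k := 2 * b), Nat.div_eq_of_lt_le (k := 2 * b)] <;> nlinarith
  have hs2 : ∀ x y, base + w ≤ x → x ≤ y → y < base + 2 * w → s.real a x ≤ s.real a y := by
    intro x y hx hxy hy
    have h1 : base = (2 * b) * w := by rw [hbase]; ring
    refine hs x y hxy (by omega) ?_
    rw [Nat.div_eq_of_lt_le (k := 2 * b + 1), Nat.div_eq_of_lt_le (k := 2 * b + 1)] <;> nlinarith
  let I : ℕ → State → Prop := fun t s' => Frame [20, 21, 22] [5] s s' ∧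
    (∀ x < base, s'.real 5 x = s.real 5 x) ∧
    Merged (s.real a) (s'.real 5) base w t (s'.nat 21 0) (s'.nat 22 0)
  have hmain : ∀ s₁, I 0 s₁ → Ends σ (forLoop 20 (.mul (.lit 2) (.var 17)) (mergeStep a)) s₁
      ((2 * w) * (4 + 3) + 3) (fun s' => I (2 * w) s' ∧ s'.nat 20 0 = 2 * w) := by
    intro s₁ h₁
    refine Ends.forLoop I (2 * w) (by omega) ?_ ?_ ?_
    · rintro q - s' ⟨hf, -⟩
      simp [NExpr.eval, hf.nat 17 (by simp), hw]
    · obtain ⟨hf, h2, h3⟩ := h₁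
      exact ⟨hf.writeNat (by simp), by simpa using h2, by simpa using h3⟩
    · rintro q hq s' hb' ⟨hf, h2, h3⟩ hq'
      have h17 : s'.nat 17 0 = w := by rw [hf.nat 17 (by simp), hw]
      have h19 : s'.nat 19 0 = b := by rw [hf.nat 19 (by simp), hb]
      have hbs : blockStart.eval s' = base := by
        simp [blockStart, NExpr.eval, h17, h19, hbase]
      have hra : s'.real a = s.real a := hf.real a (by simp [ha])
      have hi := h3.i_le
      have hj := h3.j_le
      have hsum := h3.sum
      refine Ends.branch ?_ ?_
      · intro ht
        simp only [BExpr.eval, NExpr.eval, RExpr.eval, h17, hbs, hra, not_and, not_lt] at ht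
        refine (Ends.seq (Ends.setReal rfl) fun s'' _ e => Ends.setNat ?_ ?_).mono le_rfl
          fun _ _ h => h
        · subst e
          simp [NExpr.eval]
          omega
        · subst e
          simp only [NExpr.eval, RExpr.eval, hbs, hq', hra, writeReal_nat]
          refine ⟨by simp [hq'], ((hf.writeReal (by simp)).writeNat (by simp)).writeNat
            (by simp), ?_, ?_⟩
          · intro x hx
            have : x ≠ base + q := by omega
            simpa [this] using h2 x hx
          · have := h3.takeLeft hs1 hs2 ht.1 ht.2
            simpa [writeReal_self] using this
      · intro ht
        simp only [BExpr.eval, NExpr.eval, RExpr.eval, h17, hbs, hra] at ht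
        replace ht : s'.nat 21 0 < base + w → s'.nat 22 0 < base + 2 * w ∧
            s.real a (s'.nat 22 0) < s.real a (s'.nat 21 0) :=
          fun h => by_contra fun hc => ht ⟨h, hc⟩
        refine (Ends.seq (Ends.setReal rfl) fun s'' _ e => Ends.setNat ?_ ?_).mono le_rfl
          fun _ _ h => h
        · subst e
          simp [NExpr.eval]
          by_cases h : s'.nat 21 0 < base + w
          · have := (ht h).1
            omega
          · omega
        · subst e
          simp only [NExpr.eval, RExpr.eval, hbs, hq', hra, writeReal_nat]
          refine ⟨by simp [hq'], ((hf.writeReal (by simp)).writeNat (by simp)).writeNat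
            (by simp), ?_, ?_⟩
          · intro x hx
            have : x ≠ base + q := by omega
            simpa [this] using h2 x hx
          · have := h3.takeRight hs1 hs2 (by
              by_cases h : s'.nat 21 0 < base + w
              · exact (ht h).1
              · omega) (fun h => (ht h).2.le)
            simpa [writeReal_self] using this
  refine (Ends.seq (Ends.setNat (Q := fun s' => s' = s.writeNat 21 0 base) ?_ ?_) fun s₁ _ e₁ =>
    Ends.seq (Ends.setNat (Q := fun s' => s' = s₁.writeNat 22 0 (base + w)) ?_ ?_)
      fun s₂ _ e₂ => hmain s₂ ?_).mono ?_ ?_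
  · simp [NExpr.eval, blockStart, hb, hw]
    omega
  · simp [NExpr.eval, blockStart, hb, hw, hbase]
  · subst e₁
    simp [NExpr.eval, blockStart, hb, hw]
    omega
  · subst e₁
    simp [NExpr.eval, blockStart, hb, hw, hbase]
  · subst e₁ e₂
    refine ⟨((Frame.refl _ _ _).writeNat (by simp)).writeNat (by simp), by simp, ?_⟩
    simp only [writeNat_nat, writeNat_real]
    exact ⟨by simp, by simp, by simp, by simp; omega, by simp; omega, by omega, by omega, by omega,
      by simp; omega, by simp; omega⟩
  · omega
  · rintro s' - ⟨⟨hf, h2, h3⟩, -⟩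
    have e1 : s'.nat 21 0 = base + w := by
      have := h3.i_le; have := h3.j_le; have := h3.sum; omega
    have e2 : s'.nat 22 0 = base + 2 * w := by
      have := h3.i_le; have := h3.j_le; have := h3.sum; omega
    rw [e1, e2] at h3
    exact ⟨hf, h2, h3⟩

/-- Sort array `a`. -/
def sortArray (a : ℕ) : Cmd :=
  .seq (.assign 17 (.lit 1)) (forLoop 18 (.sub (.var 6) (.lit 2))
    (.seq (forLoop 19 (.div (.var 7) (.mul (.lit 2) (.var 17))) (mergeBlock a))
      (.seq (forLoop 20 (.var 7) (.setReal a (.var 20) (.get 5 (.var 20))))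
        (.assign 17 (.mul (.lit 2) (.var 17))))))

/-- Bottom-up merge sort: after `q` rounds the runs of length `2 ^ q` are sorted. Multiplicities are
not tracked, since density of the lines only needs every sampled value to survive. -/
theorem sortArray_ends (a : ℕ) (ha : a ≠ 5) {s : State} {H : ℕ}
    (hG : s.nat 6 0 = H + 2) (hK : s.nat 7 0 = 2 ^ H) :
    Ends σ (sortArray a) s (32 * (2 ^ H * (H + 1))) (fun s' =>
      Frame [17, 18, 19, 20, 21, 22] [5, a] s s' ∧
      (∀ x y, x ≤ y → y < 2 ^ H → s'.real a x ≤ s'.real a y) ∧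
      ∀ z < 2 ^ H, ∃ x < 2 ^ H, s'.real a x = s.real a z) := by
  refine Ends.pre fun hbd => ?_
  have hGW : H + 2 ≤ σ.word := hG ▸ hbd 6 0
  have hKW : 2 ^ H ≤ σ.word := hK ▸ hbd 7 0
  let I : ℕ → State → Prop := fun q s' => Frame [17, 18, 19, 20, 21, 22] [5, a] s s' ∧
    s'.nat 17 0 = 2 ^ q ∧
    (∀ x y, x ≤ y → y < 2 ^ H → x / 2 ^ q = y / 2 ^ q → s'.real a x ≤ s'.real a y) ∧
    ∀ z < 2 ^ H, ∃ x < 2 ^ H, s'.real a x = s.real a z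
  have hI : ∀ q v s', I q s' → I q (s'.writeNat 18 0 v) := by
    rintro q v s' ⟨hf, h1, h2, h3⟩
    exact ⟨hf.writeNat (by simp), by simpa using h1, by simpa using h2, by simpa using h3⟩
  have hmain : ∀ s₁, I 0 s₁ → Ends σ (forLoop 18 (.sub (.var 6) (.lit 2))
      (.seq (forLoop 19 (.div (.var 7) (.mul (.lit 2) (.var 17))) (mergeBlock a))
      (.seq (forLoop 20 (.var 7) (.setReal a (.var 20) (.get 5 (.var 20))))
        (.assign 17 (.mul (.lit 2) (.var 17)))))) s₁ (H * ((2 ^ H * 18 + 9) + 3) + 3)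
      (fun s' => I H s' ∧ s'.nat 18 0 = H) := by
    intro s₁ h₁
    refine Ends.forLoop I H (by omega) ?_ (hI _ _ _ h₁) ?_
    · rintro q - s' ⟨hf, -⟩
      simp [NExpr.eval, hf.nat 6 (by simp), hG]
    · rintro q hq s' hb' ⟨hf, h17, hsort, hsurj⟩ h18
      set w := 2 ^ q with hw
      have hw0 : 0 < w := by positivity
      have hdvd : 2 ^ H = 2 ^ (H - (q + 1)) * (2 * w) := by
        rw [hw, ← pow_succ', ← pow_add]; congr 1; omega
      set N := 2 ^ (H - (q + 1)) with hN
      have hNK : N ≤ 2 ^ H := Nat.pow_le_pow_right (by norm_num) (by omega)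
      have h7 : s'.nat 7 0 = 2 ^ H := by rw [hf.nat 7 (by simp), hK]
      let J : ℕ → State → Prop := fun b s'' => Frame [19, 20, 21, 22] [5] s' s'' ∧
        (∀ x y, x ≤ y → y < b * (2 * w) → x / (2 * w) = y / (2 * w) →
          s''.real 5 x ≤ s''.real 5 y) ∧
        ∀ z < b * (2 * w), ∃ x < b * (2 * w), s''.real 5 x = s'.real a z
      have hJ : ∀ q v s'', J q s'' → J q (s''.writeNat 19 0 v) := by
        rintro q v s'' ⟨hf, h2, h3⟩
        exact ⟨hf.writeNat (by simp), by simpa using h2, by simpa using h3⟩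
      have hpass : Ends σ (forLoop 19 (.div (.var 7) (.mul (.lit 2) (.var 17))) (mergeBlock a)) s'
          (N * ((14 * w + 10) + 3) + 3) (fun s'' => J N s'' ∧ s''.nat 19 0 = N) := by
        refine Ends.forLoop J N (hNK.trans hKW) ?_ (hJ _ _ _ ⟨Frame.refl _ _ _, by simp, by simp⟩)
          ?_
        · rintro b - s'' ⟨hf', -⟩
          simp only [NExpr.eval, hf'.nat 7 (by simp), h7, hf'.nat 17 (by simp), h17]
          rw [hdvd, Nat.mul_div_cancel _ (by positivity)]
        · rintro b hb s'' _ ⟨hf', hso, hsu⟩ h19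
          have hra : s''.real a = s'.real a := hf'.real a (by simp [ha])
          have hbN : (b + 1) * (2 * w) ≤ 2 ^ H := by
            rw [hdvd]; exact Nat.mul_le_mul_right _ hb
          refine (mergeBlock_ends a ha (K := 2 ^ H) h19 (by rw [hf'.nat 17 (by simp), h17]) hw0 hKW
            hbN (by rw [hra]; exact hsort)).mono le_rfl ?_
          rintro s₃ - ⟨hf₃, hold, hm⟩
          have hbase : (b + 1) * (2 * w) = b * (2 * w) + 2 * w := by ring
          refine ⟨by rw [hf₃.nat 19 (by simp), h19], hJ _ _ _
            ⟨hf'.trans (hf₃.mono (by simp) (by simp)), ?_, ?_⟩⟩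
          · intro x y hxy hy hq
            by_cases hyb : y < b * (2 * w)
            · rw [hold x (by omega), hold y hyb]
              exact hso x y hxy hyb hq
            · have h1 : y / (2 * w) = b := Nat.div_eq_of_lt_le (by omega) hy
              refine hm.sorted x y ?_ hxy (by omega)
              rw [h1] at hq
              rw [← hq]
              exact Nat.div_mul_le_self _ _
          · intro z hz
            rw [hra] at hm
            by_cases hzb : z < b * (2 * w)
            · obtain ⟨x, hx, hxe⟩ := hsu z hzb
              exact ⟨x, by omega, by rw [hold x hx, hxe]⟩
            · by_cases hz2 : z < b * (2 * w) + w
              · obtain ⟨x, -, hx, hxe⟩ := hm.left z (by omega) hz2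
                exact ⟨x, by omega, hxe⟩
              · obtain ⟨x, -, hx, hxe⟩ := hm.right z (by omega) (by omega)
                exact ⟨x, by omega, hxe⟩
      refine (Ends.seq hpass ?_ (T₂ := 2 ^ H * (1 + 3) + 3 + 1 + 1) (Q := fun s'' =>
        s''.nat 18 0 = q ∧ I (q + 1) (s''.writeNat 18 0 (q + 1)))).mono ?_ fun _ _ h => h
      · rintro s₂ - ⟨⟨hf₂, hso, hsu⟩, -⟩
        rw [← hdvd] at hso hsu
        let L : ℕ → State → Prop := fun t s'' => Frame [19, 20, 21, 22] [5, a] s' s'' ∧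
          s''.real 5 = s₂.real 5 ∧ ∀ x < t, s''.real a x = s₂.real 5 x
        have hcopy : Ends σ (forLoop 20 (.var 7) (.setReal a (.var 20) (.get 5 (.var 20)))) s₂
            (2 ^ H * (1 + 3) + 3) (fun s'' => L (2 ^ H) s'' ∧ s''.nat 20 0 = 2 ^ H) := by
          refine Ends.forLoop L (2 ^ H) hKW ?_ ?_ ?_
          · rintro _ - s'' ⟨hf', -⟩
            simp [NExpr.eval, hf'.nat 7 (by simp), h7]
          · exact ⟨(hf₂.mono (by simp) (by simp)).writeNat (by simp), by simp, by simp⟩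
          · rintro t ht s'' - ⟨hf', h5, hcp⟩ h20
            refine Ends.setReal ?_
            simp only [NExpr.eval, RExpr.eval, h20]
            refine ⟨by simp [h20], (hf'.writeReal (by simp)).writeNat (by simp), ?_, ?_⟩
            · funext x
              simp [ha.symm, h5]
            · intro x hx
              rcases (show x < t ∨ x = t by omega) with hx | rfl
              · simpa [hx.ne] using hcp x hx
              · simp [h5]
        refine Ends.seq (T₁ := 2 ^ H * (1 + 3) + 3) (T₂ := 1) hcopy ?_
        · rintro s₃ - ⟨⟨hf₃, h5, hcp⟩, -⟩
          have h17' : s₃.nat 17 0 = w := by rw [hf₃.nat 17 (by simp), h17]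
          have hp : 2 * w = 2 ^ (q + 1) := by rw [hw, pow_succ']
          refine Ends.setNat ?_ ?_
          · intro _
            simp only [NExpr.eval, h17']
            refine le_trans ?_ hKW
            rw [hp]
            exact Nat.pow_le_pow_right (by norm_num) (by omega)
          · simp only [NExpr.eval, h17']
            refine ⟨?_, hI _ _ _ ⟨(hf.trans (hf₃.mono (by simp) (by simp))).writeNat (by simp),
              by simp [hp], ?_, ?_⟩⟩
            · simp [hf₃.nat 18 (by simp), h18]
            · intro x y hxy hy hq
              rw [← hp] at hq
              simp only [writeNat_real]
              rw [hcp x (by omega), hcp y hy]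
              exact hso x y hxy hy hq
            · intro z hz
              obtain ⟨z', hz', he⟩ := hsurj z hz
              obtain ⟨x, hx, he'⟩ := hsu z' hz'
              exact ⟨x, hx, by simp only [writeNat_real]; rw [hcp x hx, he', he]⟩
      · have h1 : N * ((14 * w + 10) + 3) ≤ 2 ^ H * 14 := by
          have : N ≤ N * w := Nat.le_mul_of_pos_right _ hw0
          rw [hdvd]; nlinarith
        omega
  refine (Ends.seq (Ends.setNat (Q := fun s' => s' = s.writeNat 17 0 1) ?_ rfl)
    fun s₁ _ e₁ => hmain s₁ ?_).mono ?_ ?_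
  · intro _; simp only [NExpr.eval]; omega
  · subst e₁
    refine ⟨(Frame.refl _ _ _).writeNat (by simp), by simp, ?_, fun z hz => ⟨z, hz, by simp⟩⟩
    intro x y _ _ hxy
    simp at hxy
    subst hxy
    exact le_rfl
  · have : 1 ≤ 2 ^ H := Nat.one_le_two_pow
    nlinarith
  · rintro s' - ⟨⟨hf, -, h2, h3⟩, -⟩
    exact ⟨hf, fun x y hxy hy => h2 x y hxy hy (by
      rw [Nat.div_eq_of_lt hy, Nat.div_eq_of_lt (by omega)]), h3⟩

end RealRAM

namespace RealRAM

variable {σ : Goal}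

theorem writeNat_nat_of_ne (s : State) {a i v b : ℕ} (h : b ≠ a) :
    (s.writeNat a i v).nat b = s.nat b := by
  simp [State.writeNat, Function.update_of_ne h]

/-! ### Keys and digits -/

/-- The number with leading part `t` and digits `f 0, …, f (k - 1)` in base `M`. -/
def keyFold (M : ℕ) (f : ℕ → ℕ) (t : ℕ) : ℕ → ℕ
  | 0 => t
  | k + 1 => keyFold M f t k * M + f k

theorem keyFold_congr {M t k : ℕ} {f g : ℕ → ℕ} (h : ∀ j < k, f j = g j) :
    keyFold M f t k = keyFold M g t k := by
  induction k with
  | zero => rfl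
  | succ k ih => rw [keyFold, keyFold, ih fun j hj => h j (by omega), h k (by omega)]

/-- Digits below the base are unique. The leading part needs no bound, because it takes whatever
quotient is left. -/
theorem keyFold_inj {M t t' k : ℕ} {f g : ℕ → ℕ} (hf : ∀ j < k, f j < M) (hg : ∀ j < k, g j < M)
    (h : keyFold M f t k = keyFold M g t' k) : t = t' ∧ ∀ j < k, f j = g j := by
  induction k with
  | zero => exact ⟨h, fun j hj => by omega⟩
  | succ k ih =>
    rw [keyFold, keyFold] at h
    have h1 := hf k (by omega)
    have h2 := hg k (by omega)
    have h3 : keyFold M f t k = keyFold M g t' k := by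
      have := congrArg (· / M) h
      simpa [Nat.add_div_of_dvd_right, Nat.mul_div_cancel _ (by omega : 0 < M),
        Nat.div_eq_of_lt h1, Nat.div_eq_of_lt h2] using this
    have h4 : f k = g k := by rw [h3] at h; omega
    obtain ⟨h5, h6⟩ := ih (fun j hj => hf j (by omega)) (fun j hj => hg j (by omega)) h3
    refine ⟨h5, fun j hj => ?_⟩
    rcases (show j < k ∨ j = k by omega) with hj | rfl
    exacts [h6 j hj, h4]

/-- The expression of `keyFold`. -/
def keyExpr (M : NExpr) (f : ℕ → NExpr) (t : NExpr) : ℕ → NExpr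
  | 0 => t
  | k + 1 => .add (.mul (keyExpr M f t k) M) (f k)

theorem eval_keyExpr (M : NExpr) (f : ℕ → NExpr) (t : NExpr) (k : ℕ) (s : State) :
    (keyExpr M f t k).eval s =
      keyFold (M.eval s) (fun j => (f j).eval s) (t.eval s) k := by
  induction k with
  | zero => rfl
  | succ k ih => simp only [keyExpr, NExpr.eval, ih, keyFold]

/-- The expression of `x ^ k`. -/
def powExpr (x : NExpr) : ℕ → NExpr
  | 0 => .lit 1
  | k + 1 => .mul (powExpr x k) x

theorem eval_powExpr (x : NExpr) (k : ℕ) (s : State) : (powExpr x k).eval s = x.eval s ^ k := by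
  induction k with
  | zero => rfl
  | succ k ih => simp only [powExpr, NExpr.eval, ih, pow_succ]

/-- The expression of `t / G ^ j % G`. -/
def digitExpr (G t : NExpr) (j : ℕ) : NExpr :=
  .sub (.div t (powExpr G j)) (.mul (.div (.div t (powExpr G j)) G) G)

theorem eval_digitExpr (G t : NExpr) (j : ℕ) (s : State) :
    (digitExpr G t j).eval s = t.eval s / G.eval s ^ j % G.eval s := by
  simp only [digitExpr, NExpr.eval, eval_powExpr]
  rw [Nat.mod_eq_sub_div_mul]

/-- Lets one loop index run through all vectors of levels, and one index through all choices of
sides. -/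
theorem exists_digits {G k : ℕ} (h : ℕ → ℕ) (hh : ∀ j < k, h j < G) :
    ∃ t < G ^ k, ∀ j < k, t / G ^ j % G = h j := by
  induction k with
  | zero => exact ⟨0, by simp, fun j hj => by omega⟩
  | succ k ih =>
    obtain ⟨t, ht, hd⟩ := ih fun j hj => hh j (by omega)
    have hk := hh k (by omega)
    have hG : 0 < G := by omega
    refine ⟨t + h k * G ^ k, ?_, fun j hj => ?_⟩
    · rw [pow_succ]; nlinarith
    · rcases (show j < k ∨ j = k by omega) with hj | rfl
      · obtain ⟨r, rfl⟩ : ∃ r, k = j + 1 + r := ⟨k - (j + 1), by omega⟩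
        have : h (j + 1 + r) * G ^ (j + 1 + r) = G * (h (j + 1 + r) * G ^ r) * G ^ j := by ring
        rw [this, Nat.add_mul_div_right _ _ (by positivity), Nat.add_mul_mod_self_left, hd j hj]
      · rw [Nat.add_mul_div_right _ _ (by positivity), Nat.div_eq_of_lt ht, zero_add,
          Nat.mod_eq_of_lt hk]

/-! ### The memory during a trial -/

/-- The parameters of a run. -/
structure Params where
  n : ℕ
  m : ℕ
  R : ℕ
  H : ℕ
  S : ℕ
  points : ℕ → ℝ
  lo : ℕ → ℝ
  hi : ℕ → ℝ

/-- The memory holds the parameters. -/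
structure Holds (d : ℕ) (p : Params) (s : State) : Prop where
  n : s.nat 0 0 = p.n
  m : s.nat 0 1 = p.m
  R : s.nat 2 0 = p.R
  G : s.nat 6 0 = p.H + 2
  K : s.nat 7 0 = 2 ^ p.H
  M : s.nat 8 0 = 2 ^ (p.H + 2)
  S : s.nat 9 0 = p.S
  T : s.nat 10 0 = (p.H + 2) ^ d
  pw : ∀ h < p.H + 2, s.nat 11 h = 2 ^ h
  points : s.real 1 = p.points
  lo : s.real 2 = p.lo
  hi : s.real 3 = p.hi

/-- The arrays are numbered so that working memory (natural number array `1` and those from `12` on,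
real arrays from `4` on) never overlaps the parameters. -/
theorem Holds.frame {d : ℕ} {p : Params} {s s' : State} (h : Holds d p s) {A B : List ℕ}
    (hf : Frame A B s s') (hA : ∀ a ∈ A, a = 1 ∨ 12 ≤ a) (hB : ∀ a ∈ B, 4 ≤ a) :
    Holds d p s' := by
  have h1 : ∀ a, a ≠ 1 → a < 12 → s'.nat a = s.nat a := fun a h1 h2 =>
    hf.nat a fun hm => by have := hA a hm; omega
  have h2 : ∀ a, a < 4 → s'.real a = s.real a := fun a h1 =>
    hf.real a fun hm => by have := hB a hm; omega
  constructor
  · rw [h1 0 (by simp) (by simp), h.n]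
  · rw [h1 0 (by simp) (by simp), h.m]
  · rw [h1 2 (by simp) (by simp), h.R]
  · rw [h1 6 (by simp) (by simp), h.G]
  · rw [h1 7 (by simp) (by simp), h.K]
  · rw [h1 8 (by simp) (by simp), h.M]
  · rw [h1 9 (by simp) (by simp), h.S]
  · rw [h1 10 (by simp) (by simp), h.T]
  · rw [h1 11 (by simp) (by simp)]; exact h.pw
  · rw [h2 1 (by simp), h.points]
  · rw [h2 2 (by simp), h.lo]
  · rw [h2 3 (by simp), h.hi]

/-- The arrays `10, …, 10 + d - 1` hold the sorted lines `ln 0, …, ln (d - 1)`. -/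
structure Lines (d H : ℕ) (ln : ℕ → ℕ → ℝ) (s : State) : Prop where
  eq : ∀ j < d, s.real (10 + j) = ln j
  sorted : ∀ j < d, ∀ g g', g ≤ g' → g' < 2 ^ H → ln j g ≤ ln j g'

theorem Lines.frame {d H : ℕ} {ln : ℕ → ℕ → ℝ} {s s' : State} (h : Lines d H ln s) {A B : List ℕ}
    (hf : Frame A B s s') (hB : ∀ a ∈ B, a < 10) : Lines d H ln s' :=
  ⟨fun j hj => by rw [hf.real _ fun hm => by have := hB _ hm; omega, h.eq j hj], h.sorted⟩

/-! ### Marking -/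

/-- The address of coordinate `j` of the object with number `i`. -/
def addr (d : ℕ) (i : NExpr) (j : ℕ) : NExpr := .add (.mul i (.lit d)) (.lit j)

theorem eval_addr (d : ℕ) (i : NExpr) (j : ℕ) (s : State) :
    (addr d i j).eval s = i.eval s * d + j := rfl

/-- Copy coordinate `j` of the current sample point to the output and find its position. -/
def placeCoord (d j : ℕ) : Cmd :=
  .seq (.setReal 4 (addr d (.var 24) j) (.get 1 (addr d (.get 16 (.var 24)) j)))
    (.seq (search true (10 + j) (.get 1 (addr d (.get 16 (.var 24)) j)))
    (.seq (.setNat 26 (.lit j) (.var 12))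
    (.seq (search false (10 + j) (.get 1 (addr d (.get 16 (.var 24)) j)))
      (.setNat 26 (.lit j) (.add (.get 26 (.lit j)) (.var 12))))))

/-- The position is the sum of a strict and a weak search. It can reach `2 * 2 ^ H`, beyond the
number of lines, which is why a separate word bound is required. -/
theorem place_ends {d : ℕ} {p : Params} {ln : ℕ → ℕ → ℝ} {s : State} {i x : ℕ}
    (hH : Holds d p s) (hL : Lines d p.H ln s) (hi : s.nat 24 0 = i) (hx : s.nat 16 i = x)
    (hW : 2 ^ (p.H + 2) ≤ σ.word) :
    Ends σ (seqN d (placeCoord d)) s (d * (20 * (p.H + 2) + 8) + 1) (fun s' =>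
      Frame [12, 13, 14, 26] [4] s s' ∧ (∀ y < i * d, s'.real 4 y = s.real 4 y) ∧
      (∀ j < d, s'.real 4 (i * d + j) = p.points (x * d + j)) ∧
      ∀ j < d, s'.nat 26 j = BoxNet.pos (ln j) (2 ^ p.H) (p.points (x * d + j))) := by
  refine (Ends.seqN (T := 20 * (p.H + 2) + 7) (fun j s' => Frame [12, 13, 14, 26] [4] s s' ∧
    (∀ y < i * d, s'.real 4 y = s.real 4 y) ∧
      (∀ j' < j, s'.real 4 (i * d + j') = p.points (x * d + j')) ∧
      ∀ j' < j, s'.nat 26 j' = BoxNet.pos (ln j') (2 ^ p.H) (p.points (x * d + j'))) d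
    ⟨Frame.refl _ _ _, by simp, by simp, by simp⟩ ?_).mono le_rfl fun _ _ h => h
  rintro j hj s₀ - ⟨hf, h1, h2, h3⟩
  set Y := p.points (x * d + j) with hY
  have hy : ∀ s', Frame [12, 13, 14, 26] [4] s s' →
      (RExpr.get 1 (addr d (.get 16 (.var 24)) j)).eval s' = Y := by
    intro s' hf'
    simp [RExpr.eval, eval_addr, NExpr.eval, hf'.nat 24 (by simp), hf'.nat 16 (by simp),
      hf'.real 1 (by simp), hi, hx, hH.points, hY]
  have hsearch : ∀ (b : Bool) s', Frame [12, 13, 14, 26] [4] s s' → Ends σ (search b (10 + j)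
      (.get 1 (addr d (.get 16 (.var 24)) j))) s' (10 * (p.H + 2)) (fun s'' =>
      Frame [12, 13, 14] [] s' s'' ∧ s''.nat 12 0 = belowCount b (ln j) (2 ^ p.H) Y) := by
    intro b s' hf'
    have hH' := hH.frame hf' (by simp) (by simp)
    have hL' := hL.frame hf' (by simp)
    have := search_ends (σ := σ) b (10 + j) (.get 1 (addr d (.get 16 (.var 24)) j)) (Y := Y)
      hH'.G hH'.K (fun s'' hf'' => hy s'' (hf'.trans (hf''.mono (by simp) (by simp))))
      (by rw [hL'.eq j hj]; exact hL'.sorted j hj)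
    rwa [hL'.eq j hj] at this
  refine (Ends.seq (Ends.setReal rfl) fun s₁ _ e₁ => Ends.seq (hsearch true s₁ ?_)
    fun s₂ _ e₂ => Ends.seq (Ends.setNat (Q := fun s' => s' = s₂.writeNat 26 j
      (BoxNet.ltCount (ln j) (2 ^ p.H) Y)) ?_ ?_) fun s₃ _ e₃ => Ends.seq (hsearch false s₃ ?_)
      fun s₄ _ e₄ => Ends.setNat ?_ ?_).mono ?_ fun _ _ h => h
  · subst e₁
    exact hf.writeReal (by simp)
  · intro hb
    exact hb 12 0
  · simp [NExpr.eval, e₂.2, belowCount]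
  · subst e₁ e₃
    exact ((hf.writeReal (by simp)).trans (e₂.1.mono (by simp) (by simp))).writeNat (by simp)
  · intro hb
    subst e₃
    have h26 : s₄.nat 26 j = BoxNet.ltCount (ln j) (2 ^ p.H) Y := by
      rw [e₄.1.nat 26 (by simp)]; simp
    simp only [NExpr.eval, h26, e₄.2, belowCount, Bool.false_eq_true, if_false]
    have := BoxNet.ltCount_le (ln j) (2 ^ p.H) Y
    have := BoxNet.leCount_le (ln j) (2 ^ p.H) Y
    rw [pow_add] at hW
    omega
  · have hval : ((NExpr.get 26 (.lit j)).add (.var 12)).eval s₄ =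
        BoxNet.pos (ln j) (2 ^ p.H) Y := by
      subst e₃
      have h26 : s₄.nat 26 j = BoxNet.ltCount (ln j) (2 ^ p.H) Y := by
        rw [e₄.1.nat 26 (by simp)]; simp
      simp only [NExpr.eval, h26, e₄.2, belowCount, Bool.false_eq_true, if_false]
      rfl
    rw [hval, eval_lit]
    obtain ⟨s₅, e₅⟩ : ∃ s₅, s₅ = s₄.writeNat 26 j (BoxNet.pos (ln j) (2 ^ p.H) Y) := ⟨_, rfl⟩
    rw [← e₅]
    have hf₂ := e₂.1
    have hf₄ := e₄.1
    have h4 : s₅.real 4 = s₁.real 4 := by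
      subst e₃ e₅
      simp only [writeNat_real]
      rw [hf₄.real 4 (by simp), writeNat_real, hf₂.real 4 (by simp)]
    have hidx : ((addr d (.var 24) j).eval s₀) = i * d + j := by
      simp [eval_addr, NExpr.eval, hf.nat 24 (by simp), hi]
    rw [hidx, hy s₀ hf] at e₁
    refine ⟨?_, ?_, ?_, ?_⟩
    · subst e₁ e₃ e₅
      exact ((((hf.writeReal (by simp)).trans (hf₂.mono (by simp) (by simp))).writeNat
        (by simp)).trans (hf₄.mono (by simp) (by simp))).writeNat (by simp)
    · intro y hy
      rw [h4, ← h1 y hy, ← e₁]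
      have : y ≠ i * d + j := by omega
      simp [this]
    · intro j' hj'
      rw [h4, ← e₁]
      rcases (show j' < j ∨ j' = j by omega) with h | rfl
      · simpa [h.ne] using h2 j' h
      · simp [hY]
    · intro j' hj'
      subst e₁ e₃ e₅
      rcases (show j' < j ∨ j' = j by omega) with h | rfl
      · rw [← h3 j' h]
        simp only [writeNat_nat, h.ne, and_false, if_false]
        rw [hf₄.nat 26 (by simp)]
        simp only [writeNat_nat, h.ne, and_false, if_false]
        rw [hf₂.nat 26 (by simp)]
        simp
      · simp [hY]
  · omega

/-- The cells that contain a given position, numbered by their levels. -/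
def nodeKey (d H : ℕ) (f : ℕ → ℕ) (t : ℕ) : ℕ :=
  keyFold (2 ^ (H + 2)) (fun j => f j / 2 ^ (t / (H + 2) ^ j % (H + 2))) t d

/-- Mark all cells that contain the current sample point. -/
def markCells (d : ℕ) : Cmd :=
  forLoop 25 (.var 10) (.setNat 27 (keyExpr (.var 8)
    (fun j => .div (.get 26 (.lit j)) (.get 11 (digitExpr (.var 6) (.var 25) j))) (.var 25) d)
    (.var 24))

/-- The marks at the keys in `D` are due to points with these keys. -/
def Marked (key : ℕ → ℕ → ℕ) (table : ℕ → ℕ) (D : ℕ → ℕ → Prop) : Prop :=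
  ∀ i t, D i t → ∃ i' t', D i' t' ∧ table (key i t) = i' ∧ key i' t' = key i t

theorem Marked.update {key : ℕ → ℕ → ℕ} {table table' : ℕ → ℕ} {D D' : ℕ → ℕ → Prop}
    (h : Marked key table D) (i₀ t₀ : ℕ)
    (ht : ∀ x, table' x = if x = key i₀ t₀ then i₀ else table x)
    (hD : ∀ i t, D' i t ↔ D i t ∨ i = i₀ ∧ t = t₀) : Marked key table' D' := by
  intro i t hit
  by_cases hk : key i t = key i₀ t₀
  · exact ⟨i₀, t₀, (hD _ _).2 (Or.inr ⟨rfl, rfl⟩), by rw [ht, if_pos hk], hk.symm⟩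
  · rcases (hD _ _).1 hit with h' | ⟨rfl, rfl⟩
    · obtain ⟨i', t', h1, h2, h3⟩ := h i t h'
      exact ⟨i', t', (hD _ _).2 (Or.inl h1), by rw [ht, if_neg hk, h2], h3⟩
    · exact absurd rfl hk

/-- The index `t` codes a vector of levels and is also the leading part of the key, so cells with
different level vectors never share a table entry. -/
theorem markCells_ends {d : ℕ} {p : Params} {s : State} {i : ℕ} (key : ℕ → ℕ → ℕ)
    (hH : Holds d p s) (hi : s.nat 24 0 = i)
    (hkey : ∀ t, key i t = nodeKey d p.H (s.nat 26) t)
    (hm : Marked key (s.nat 27) fun i' t => i' < i ∧ t < (p.H + 2) ^ d) :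
    Ends σ (markCells d) s ((p.H + 2) ^ d * 4 + 3) (fun s' =>
      Frame [25, 27] [] s s' ∧
      Marked key (s'.nat 27) fun i' t => i' < i + 1 ∧ t < (p.H + 2) ^ d) := by
  refine Ends.pre fun hb => ?_
  have hTW : (p.H + 2) ^ d ≤ σ.word := hH.T ▸ hb 10 0
  have hiW : i ≤ σ.word := hi ▸ hb 24 0
  refine (Ends.forLoop (T := 1) (fun q s' => Frame [25, 27] [] s s' ∧
    Marked key (s'.nat 27) fun i' t => i' < i ∧ t < (p.H + 2) ^ d ∨ i' = i ∧ t < q)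
    ((p.H + 2) ^ d) hTW ?_ ?_ ?_).mono le_rfl ?_
  · rintro q - s' ⟨hf, -⟩
    simp [NExpr.eval, hf.nat 10 (by simp), hH.T]
  · refine ⟨(Frame.refl _ _ _).writeNat (by simp), ?_⟩
    rw [writeNat_nat_of_ne _ (by simp)]
    simpa using hm
  · rintro q hq s' - ⟨hf, h⟩ h25
    have h24 : s'.nat 24 0 = i := by rw [hf.nat 24 (by simp), hi]
    have hH' := hH.frame hf (by simp) (by simp)
    have hk : (keyExpr (.var 8) (fun j => .div (.get 26 (.lit j))
        (.get 11 (digitExpr (.var 6) (.var 25) j))) (.var 25) d).eval s' = key i q := by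
      rw [eval_keyExpr, hkey]
      simp only [NExpr.eval, eval_digitExpr, hH'.M, hH'.G, h25, hf.nat 26 (by simp)]
      refine keyFold_congr fun j _ => ?_
      rw [hH'.pw _ (Nat.mod_lt _ (by omega))]
    refine Ends.setNat ?_ ?_
    · intro _
      simpa [NExpr.eval, h24] using hiW
    · rw [hk]
      simp only [NExpr.eval, h24]
      refine ⟨by simp [h25], (hf.writeNat (by simp)).writeNat (by simp), ?_⟩
      refine h.update i q (fun x => by simp) fun i' t => ?_
      omega
  · rintro s' - ⟨⟨hf, h⟩, -⟩
    refine ⟨hf, ?_⟩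
    convert h using 3
    omega

/-- Copy the sample points to the output and mark their cells. -/
def markAll (d : ℕ) : Cmd :=
  forLoop 24 (.var 9) (.seq (seqN d (placeCoord d)) (markCells d))

/-- The positions of a sample point. -/
noncomputable def samplePos (d : ℕ) (p : Params) (ln : ℕ → ℕ → ℝ) (x j : ℕ) : ℕ :=
  BoxNet.pos (ln j) (2 ^ p.H) (p.points (x * d + j))

/-- `Marked` speaks only of keys written during this trial, so remains of earlier trials elsewhere
in the table do not matter. -/
theorem markAll_ends {d : ℕ} {p : Params} {ln : ℕ → ℕ → ℝ} {s : State}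
    (hH : Holds d p s) (hL : Lines d p.H ln s) (hW : 2 ^ (p.H + 2) ≤ σ.word) :
    Ends σ (markAll d) s (p.S * (d * (20 * (p.H + 2) + 8) + (p.H + 2) ^ d * 4 + 8) + 3) (fun s' =>
      Frame [12, 13, 14, 24, 25, 26, 27] [4] s s' ∧
      (∀ i < p.S, ∀ j < d, s'.real 4 (i * d + j) = p.points (s.nat 16 i * d + j)) ∧
      Marked (fun i => nodeKey d p.H (samplePos d p ln (s.nat 16 i))) (s'.nat 27)
        fun i t => i < p.S ∧ t < (p.H + 2) ^ d) := by
  refine Ends.pre fun hb => ?_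
  have hSW : p.S ≤ σ.word := hH.S ▸ hb 9 0
  refine (Ends.forLoop (T := d * (20 * (p.H + 2) + 8) + 1 + ((p.H + 2) ^ d * 4 + 3) + 1)
    (fun q s' => Frame [12, 13, 14, 24, 25, 26, 27] [4] s s' ∧
      (∀ i < q, ∀ j < d, s'.real 4 (i * d + j) = p.points (s.nat 16 i * d + j)) ∧
      Marked (fun i => nodeKey d p.H (samplePos d p ln (s.nat 16 i))) (s'.nat 27)
        fun i t => i < q ∧ t < (p.H + 2) ^ d) p.S hSW ?_ ?_ ?_).mono ?_ ?_
  · rintro q - s' ⟨hf, -⟩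
    simp [NExpr.eval, hf.nat 9 (by simp), hH.S]
  · exact ⟨(Frame.refl _ _ _).writeNat (by simp), by simp, fun i t h => by omega⟩
  · rintro q hq s₀ - ⟨hf, h1, h2⟩ h24
    have hH' := hH.frame hf (by simp) (by simp)
    have hL' := hL.frame hf (by simp)
    refine Ends.seq (place_ends hH' hL' h24 (by rw [hf.nat 16 (by simp)]) hW) ?_
    rintro s₁ - ⟨hf₁, h3, h4, h5⟩
    refine (markCells_ends (fun i => nodeKey d p.H (samplePos d p ln (s.nat 16 i)))
      (hH'.frame hf₁ (by simp) (by simp)) (i := q) ?_ ?_ ?_).mono le_rfl ?_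
    · rw [hf₁.nat 24 (by simp), h24]
    · intro t
      refine keyFold_congr fun j hj => ?_
      rw [h5 j hj, samplePos]
    · rw [hf₁.nat 27 (by simp)]
      exact h2
    · rintro s₂ - ⟨hf₂, h6⟩
      have hf₂' : Frame [12, 13, 14, 24, 25, 26, 27] [4] s s₂ :=
        (hf.trans (hf₁.mono (by simp) (by simp))).trans (hf₂.mono (by simp) (by simp))
      refine ⟨by rw [hf₂.nat 24 (by simp), hf₁.nat 24 (by simp), h24],
        hf₂'.writeNat (by simp), ?_, by rwa [writeNat_nat_of_ne _ (by simp)]⟩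
      intro i hi j hj
      rw [writeNat_real, hf₂.real 4 (by simp)]
      rcases (show i < q ∨ i = q by omega) with h | rfl
      · rw [h3 _ (by nlinarith), h1 i h j hj]
      · exact h4 j hj
  · have : d * (20 * (p.H + 2) + 8) + 1 + ((p.H + 2) ^ d * 4 + 3) + 1 + 3 =
      d * (20 * (p.H + 2) + 8) + (p.H + 2) ^ d * 4 + 8 := by ring
    rw [this]
  · rintro s' - ⟨h, -⟩
    exact h

end RealRAM

namespace RealRAM

variable {σ : Goal}

/-! ### Processing a box -/

/-- Output point `i`. -/
def outPoint (d : ℕ) (s : State) (i : ℕ) : ℕ → ℝ := fun j => s.real 4 (i * d + j)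

/-- Box `b` contains `v`. -/
def InBox (d : ℕ) (lo hi : ℕ → ℝ) (b : ℕ) (v : ℕ → ℝ) : Prop :=
  ∀ j < d, lo (b * d + j) ≤ v j ∧ v j ≤ hi (b * d + j)

theorem InBox.congr {d : ℕ} {lo hi : ℕ → ℝ} {b : ℕ} {v v' : ℕ → ℝ} (h : InBox d lo hi b v)
    (hv : ∀ j < d, v' j = v j) : InBox d lo hi b v' := fun j hj => by
  rw [hv j hj]; exact h j hj

/-- The test whether output point `i` lies in the current box. -/
def inBoxTest (d : ℕ) (i : NExpr) : BExpr :=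
  conjN d fun j => .conj
    (.neg (.ltReal (.get 4 (addr d i j)) (.get 2 (addr d (.var 30) j))))
    (.neg (.ltReal (.get 3 (addr d (.var 30) j)) (.get 4 (addr d i j))))

theorem eval_inBoxTest {d : ℕ} {i : NExpr} {s : State} : (inBoxTest d i).eval s ↔
    InBox d (s.real 2) (s.real 3) (s.nat 30 0) (outPoint d s (i.eval s)) := by
  simp [inBoxTest, eval_conjN, BExpr.eval, RExpr.eval, eval_addr, NExpr.eval, InBox, outPoint]

/-- The number of lines below box `b` in coordinate `j`. -/
noncomputable def boxLow (d : ℕ) (p : Params) (ln : ℕ → ℕ → ℝ) (b j : ℕ) : ℕ :=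
  BoxNet.ltCount (ln j) (2 ^ p.H) (p.lo (b * d + j))

/-- The number of lines below or in box `b` in coordinate `j`. -/
noncomputable def boxHigh (d : ℕ) (p : Params) (ln : ℕ → ℕ → ℝ) (b j : ℕ) : ℕ :=
  BoxNet.leCount (ln j) (2 ^ p.H) (p.hi (b * d + j))

/-- Find the lines at the lower and upper sides of the current box. -/
def boundCoord (d j : ℕ) : Cmd :=
  .seq (search true (10 + j) (.get 2 (addr d (.var 30) j))) (.seq (.setNat 28 (.lit j) (.var 12))
    (.seq (search false (10 + j) (.get 3 (addr d (.var 30) j))) (.setNat 29 (.lit j) (.var 12))))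

theorem bound_ends {d : ℕ} {p : Params} {ln : ℕ → ℕ → ℝ} {s : State} {b : ℕ}
    (hH : Holds d p s) (hL : Lines d p.H ln s) (hb : s.nat 30 0 = b) :
    Ends σ (seqN d (boundCoord d)) s (d * (20 * (p.H + 2) + 6) + 1) (fun s' =>
      Frame [12, 13, 14, 28, 29] [] s s' ∧ (∀ j < d, s'.nat 28 j = boxLow d p ln b j) ∧
      ∀ j < d, s'.nat 29 j = boxHigh d p ln b j) := by
  refine (Ends.seqN (T := 20 * (p.H + 2) + 5) (fun j s' => Frame [12, 13, 14, 28, 29] [] s s' ∧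
    (∀ j' < j, s'.nat 28 j' = boxLow d p ln b j') ∧ ∀ j' < j, s'.nat 29 j' = boxHigh d p ln b j') d
    ⟨Frame.refl _ _ _, by simp, by simp⟩ ?_).mono le_rfl fun _ _ h => h
  rintro j hj s₀ - ⟨hf, h1, h2⟩
  have hsearch : ∀ (c : Bool) (y : RExpr) (Y : ℝ) s',
      (∀ s'', Frame [12, 13, 14, 28, 29] [] s s'' → y.eval s'' = Y) →
      Frame [12, 13, 14, 28, 29] [] s s' →
      Ends σ (search c (10 + j) y) s' (10 * (p.H + 2)) (fun s'' =>
      Frame [12, 13, 14] [] s' s'' ∧ s''.nat 12 0 = belowCount c (ln j) (2 ^ p.H) Y) := by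
    intro c y Y s' hy hf'
    have hH' := hH.frame hf' (by simp) (by simp)
    have hL' := hL.frame hf' (by simp)
    have := search_ends (σ := σ) c (10 + j) y (Y := Y)
      hH'.G hH'.K (fun s'' hf'' => hy s'' (hf'.trans (hf''.mono (by simp) (by simp))))
      (by rw [hL'.eq j hj]; exact hL'.sorted j hj)
    rwa [hL'.eq j hj] at this
  refine (Ends.seq (hsearch true _ (p.lo (b * d + j)) s₀ ?_ hf)
    fun s₂ _ e₂ => Ends.seq (Ends.setNat (Q := fun s' => s' = s₂.writeNat 28 j
      (boxLow d p ln b j)) ?_ ?_) fun s₃ _ e₃ =>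
      Ends.seq (hsearch false _ (p.hi (b * d + j)) s₃ ?_ ?_)
      fun s₄ _ e₄ => Ends.setNat ?_ ?_).mono ?_ fun _ _ h => h
  · intro s' hf'
    simp [RExpr.eval, eval_addr, NExpr.eval, hf'.nat 30 (by simp), hb, hf'.real 2 (by simp), hH.lo]
  · intro hb; exact hb 12 0
  · simp [NExpr.eval, e₂.2, belowCount, boxLow]
  · intro s' hf'
    simp [RExpr.eval, eval_addr, NExpr.eval, hf'.nat 30 (by simp), hb, hf'.real 3 (by simp), hH.hi]
  · subst e₃
    exact (hf.trans (e₂.1.mono (by simp) (by simp))).writeNat (by simp)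
  · intro hb; exact hb 12 0
  · have hf₂ := e₂.1
    have hf₄ := e₄.1
    have hval : (NExpr.var 12).eval s₄ = boxHigh d p ln b j := by
      simp [NExpr.eval, e₄.2, belowCount, boxHigh]
    rw [hval, eval_lit]
    refine ⟨?_, ?_, ?_⟩
    · subst e₃
      exact (((hf.trans (hf₂.mono (by simp) (by simp))).writeNat (by simp)).trans
        (hf₄.mono (by simp) (by simp))).writeNat (by simp)
    · intro j' hj'
      rw [writeNat_nat_of_ne _ (by simp), hf₄.nat 28 (by simp), e₃]
      rcases (show j' < j ∨ j' = j by omega) with h | rfl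
      · rw [← h1 j' h]
        simp [h.ne, hf₂.nat 28 (by simp)]
      · simp
    · intro j' hj'
      rcases (show j' < j ∨ j' = j by omega) with h | rfl
      · rw [← h2 j' h]
        simp only [writeNat_nat, h.ne, and_false, if_false]
        rw [hf₄.nat 29 (by simp), e₃, writeNat_nat_of_ne _ (by simp), hf₂.nat 29 (by simp)]
      · simp
  · omega

/-! ### Searching the marked cells of a box -/

/-- The node of level `h` next to the lower (`c = 0`) or upper side of the interval `(x, y)`. -/
def sideNode (c h x y : ℕ) : ℕ := if c = 0 then x / 2 ^ h + 1 else y / 2 ^ h - 1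

/-- The key of a cell in the box `∏ (2 x j, 2 y j)`. -/
def queryKey (d H : ℕ) (x y : ℕ → ℕ) (t c : ℕ) : ℕ :=
  keyFold (2 ^ (H + 2)) (fun j => sideNode (c / 2 ^ j % 2) (t / (H + 2) ^ j % (H + 2))
    (2 * x j) (2 * y j)) t d

/-- The expression of the mark at `queryKey`. -/
def queryMark (d c : ℕ) : NExpr :=
  .get 27 (keyExpr (.var 8) (fun j => if c / 2 ^ j % 2 = 0 then
      .add (.div (.mul (.lit 2) (.get 28 (.lit j))) (.get 11 (digitExpr (.var 6) (.var 31) j)))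
        (.lit 1)
    else
      .sub (.div (.mul (.lit 2) (.get 29 (.lit j))) (.get 11 (digitExpr (.var 6) (.var 31) j)))
        (.lit 1)) (.var 31) d)

theorem eval_queryMark {d : ℕ} {p : Params} {s : State} (hH : Holds d p s) (c : ℕ) :
    (queryMark d c).eval s =
      s.nat 27 (queryKey d p.H (s.nat 28) (s.nat 29) (s.nat 31 0) c) := by
  simp only [queryMark, NExpr.eval, eval_keyExpr, hH.M, queryKey]
  congr 1
  refine keyFold_congr fun j _ => ?_
  by_cases hc : c / 2 ^ j % 2 = 0 <;>
  simp only [hc, if_true, if_false, NExpr.eval, eval_digitExpr, hH.G, sideNode] <;>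
  rw [hH.pw _ (Nat.mod_lt _ (by omega))]

/-- The mark number `i` refers to an output point in box `b`. -/
def Hits (d : ℕ) (p : Params) (s : State) (b i : ℕ) : Prop :=
  i < s.nat 1 0 ∧ InBox d p.lo p.hi b (outPoint d s i)

theorem Hits.frame {d : ℕ} {p : Params} {s s' : State} {b i : ℕ} {A B : List ℕ}
    (hf : Frame A B s s') (hA : 1 ∉ A) (hB : 4 ∉ B) : Hits d p s' b i ↔ Hits d p s b i := by
  unfold Hits outPoint
  rw [hf.nat 1 hA, hf.real 4 hB]

/-- The test whether `i` refers to an output point in the current box. -/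
def hitTest (d : ℕ) (i : NExpr) : BExpr := .conj (.ltNat i (.var 1)) (inBoxTest d i)

theorem eval_hitTest {d : ℕ} {p : Params} {i : NExpr} {s : State} (hH : Holds d p s) :
    (hitTest d i).eval s ↔ Hits d p s (s.nat 30 0) (i.eval s) := by
  simp only [hitTest, BExpr.eval, eval_inBoxTest, Hits, hH.lo, hH.hi, NExpr.eval]

/-- Look for a sample point in the current box. -/
def query (d : ℕ) : Cmd :=
  .seq (.assign 32 (.lit 0)) (forLoop 31 (.var 10) (seqN (2 ^ d) fun c =>
    .branch (hitTest d (queryMark d c)) (.assign 32 (.lit 1)) .skip))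

/-- A positive answer is certified by real comparisons and needs no assumption on the table. Only a
negative answer is interpreted later, through `exists_hit`. -/
theorem query_ends {d : ℕ} {p : Params} {s : State} {b : ℕ}
    (hH : Holds d p s) (hb : s.nat 30 0 = b) (hW : 1 ≤ σ.word) :
    Ends σ (query d) s ((p.H + 2) ^ d * (2 ^ d * 3 + 4) + 5) (fun s' => Frame [31, 32] [] s s' ∧
      (s'.nat 32 0 ≠ 0 → ∃ i, Hits d p s b i) ∧
      (s'.nat 32 0 = 0 → ∀ t < (p.H + 2) ^ d, ∀ c < 2 ^ d,
        ¬ Hits d p s b (s.nat 27 (queryKey d p.H (s.nat 28) (s.nat 29) t c)))) := by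
  refine Ends.pre fun hbd => ?_
  have hTW : (p.H + 2) ^ d ≤ σ.word := hH.T ▸ hbd 10 0
  -- Progress is lexicographic: all level codes before `q`, and the first `r` side codes of `q`
  -- itself.
  let I : ℕ → ℕ → State → Prop := fun q r s' => Frame [31, 32] [] s s' ∧
      (s'.nat 32 0 ≠ 0 → ∃ i, Hits d p s b i) ∧
      (s'.nat 32 0 = 0 → ∀ t c, c < 2 ^ d → (t < q ∨ t = q ∧ c < r) →
        ¬ Hits d p s b (s.nat 27 (queryKey d p.H (s.nat 28) (s.nat 29) t c)))
  have hI : ∀ q r v s', I q r s' → I q r (s'.writeNat 31 0 v) := by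
    rintro q r v s' ⟨hf, h1, h2⟩
    exact ⟨hf.writeNat (by simp), by simpa using h1, by simpa using h2⟩
  have hmain : ∀ s₁, I 0 0 s₁ → Ends σ (forLoop 31 (.var 10) (seqN (2 ^ d) fun c =>
      .branch (hitTest d (queryMark d c)) (.assign 32 (.lit 1)) .skip)) s₁
      ((p.H + 2) ^ d * ((2 ^ d * (2 + 1) + 1) + 3) + 3)
      (fun s' => I ((p.H + 2) ^ d) 0 s' ∧ s'.nat 31 0 = (p.H + 2) ^ d) := by
    intro s₁ h₁
    refine Ends.forLoop (fun q s' => I q 0 s') _ hTW ?_ (hI _ _ _ _ h₁) ?_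
    · rintro q - s' ⟨hf, -⟩
      simp [NExpr.eval, hf.nat 10 (by simp), hH.T]
    · rintro q hq s' - h h31
      refine (Ends.seqN (T := 2) (fun r s'' => I q r s'' ∧ s''.nat 31 0 = q) (2 ^ d) ⟨h, h31⟩
        ?_).mono le_rfl ?_
      · rintro c hc s₂ - ⟨h₂, h31⟩
        obtain ⟨hf, h3, h4⟩ := h₂
        have hH' := hH.frame hf (by simp) (by simp)
        have htest : (hitTest d (queryMark d c)).eval s₂ ↔
            Hits d p s b (s.nat 27 (queryKey d p.H (s.nat 28) (s.nat 29) q c)) := by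
          rw [eval_hitTest hH', eval_queryMark hH', Hits.frame hf (by simp) (by simp),
            hf.nat 27 (by simp), hf.nat 28 (by simp), hf.nat 29 (by simp), hf.nat 30 (by simp), hb,
            h31]
        refine Ends.branch ?_ ?_
        · intro ht
          refine Ends.setNat (fun _ => hW) ?_
          simp only [NExpr.eval]
          refine ⟨⟨hf.writeNat (by simp), fun _ => ⟨_, htest.1 ht⟩, by simp⟩, by simp [h31]⟩
        · intro ht
          refine Ends.skip ⟨⟨hf, h3, ?_⟩, h31⟩
          intro h0 t c' hc' htc
          rcases htc with h | ⟨rfl, h⟩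
          · exact h4 h0 t c' hc' (Or.inl h)
          · rcases (show c' < c ∨ c' = c by omega) with h | rfl
            · exact h4 h0 t c' hc' (Or.inr ⟨rfl, h⟩)
            · exact fun hh => ht (htest.2 hh)
      · rintro s₂ - ⟨⟨hf, h3, h4⟩, h31⟩
        refine ⟨h31, hI _ _ _ _ ⟨hf, h3, fun h0 t c hc htc => h4 h0 t c hc ?_⟩⟩
        omega
  refine (Ends.seq (Ends.setNat (Q := fun s' => s' = s.writeNat 32 0 0) ?_ rfl)
    fun s₁ _ e₁ => hmain s₁ ?_).mono ?_ ?_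
  · simp [NExpr.eval]
  · subst e₁
    exact ⟨(Frame.refl _ _ _).writeNat (by simp), by simp, fun _ t c _ h => by omega⟩
  · have : 2 ^ d * (2 + 1) + 1 + 3 = 2 ^ d * 3 + 4 := by ring
    rw [this]
    omega
  · rintro s' - ⟨⟨hf, h3, h4⟩, -⟩
    exact ⟨hf, h3, fun h0 t ht c hc => h4 h0 t c hc (Or.inl ht)⟩

/-! ### Centers and appended points -/

/-- Find the center of the current box. -/
def findCenter (d : ℕ) : Cmd :=
  .seq (seqN d fun j => .setNat 33 (.lit j) (.lit 0)) (forLoop 34 (.var 6) (seqN d fun j =>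
    .branch (.ltNat (.div (.get 28 (.lit j)) (.get 11 (.var 34)))
        (.div (.get 29 (.lit j)) (.get 11 (.var 34))))
      (.setNat 33 (.lit j) (.mul (.div (.get 29 (.lit j)) (.get 11 (.var 34)))
        (.get 11 (.var 34)))) .skip))

/-- Scanning the levels upwards and overwriting whenever the blocks differ leaves the value of the
highest such level, exactly as the recursion of `mid` prescribes. -/
theorem findCenter_ends {d : ℕ} {p : Params} {s : State} (hH : Holds d p s) :
    Ends σ (findCenter d) s ((p.H + 2) * (d * 3 + 4) + d * 2 + 5) (fun s' =>
      Frame [33, 34] [] s s' ∧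
      ∀ j < d, s'.nat 33 j = BoxNet.mid (p.H + 2) (s.nat 28 j) (s.nat 29 j)) := by
  refine Ends.pre fun hbd => ?_
  have hGW : p.H + 2 ≤ σ.word := hH.G ▸ hbd 6 0
  let I : ℕ → State → Prop := fun q s' => Frame [33, 34] [] s s' ∧
      ∀ j < d, s'.nat 33 j = BoxNet.mid q (s.nat 28 j) (s.nat 29 j)
  have hI : ∀ q v s', I q s' → I q (s'.writeNat 34 0 v) := by
    rintro q v s' ⟨hf, h1⟩
    exact ⟨hf.writeNat (by simp), by simpa using h1⟩
  have hinit : Ends σ (seqN d fun j => .setNat 33 (.lit j) (.lit 0)) s (d * (1 + 1) + 1) (I 0) := by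
    refine (Ends.seqN (fun j s' => Frame [33, 34] [] s s' ∧ ∀ j' < j, s'.nat 33 j' = 0) d
      ⟨Frame.refl _ _ _, by simp⟩ ?_).mono le_rfl fun _ _ h => h
    rintro j hj s' - ⟨hf, h1⟩
    refine Ends.setNat (by simp [NExpr.eval]) ⟨hf.writeNat (by simp), fun j' hj' => ?_⟩
    simp only [NExpr.eval, writeNat_nat]
    split_ifs with h
    · rfl
    · exact h1 j' (by simp at h; omega)
  have hmain : ∀ s₁, I 0 s₁ → Ends σ (forLoop 34 (.var 6) (seqN d fun j =>
    .branch (.ltNat (.div (.get 28 (.lit j)) (.get 11 (.var 34)))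
        (.div (.get 29 (.lit j)) (.get 11 (.var 34))))
      (.setNat 33 (.lit j) (.mul (.div (.get 29 (.lit j)) (.get 11 (.var 34)))
        (.get 11 (.var 34)))) .skip)) s₁ ((p.H + 2) * ((d * (2 + 1) + 1) + 3) + 3)
      (fun s' => I (p.H + 2) s' ∧ s'.nat 34 0 = p.H + 2) := by
    intro s₁ h₁
    refine Ends.forLoop I _ hGW ?_ (hI _ _ _ h₁) ?_
    · rintro q - s' ⟨hf, -⟩
      simp [NExpr.eval, hf.nat 6 (by simp), hH.G]
    · rintro q hq s' - h h34
      refine (Ends.seqN (T := 2) (fun r s'' => (Frame [33, 34] [] s s'' ∧ ∀ j < d, s''.nat 33 j =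
        BoxNet.mid (if j < r then q + 1 else q) (s.nat 28 j) (s.nat 29 j)) ∧ s''.nat 34 0 = q) d
        ⟨by simpa using h, h34⟩ ?_).mono le_rfl ?_
      · rintro j hj s₂ hb₂ ⟨⟨hf, h1⟩, h34⟩
        have hpw : s₂.nat 11 q = 2 ^ q := by rw [hf.nat 11 (by simp), hH.pw q hq]
        refine Ends.branch ?_ ?_
        · intro ht
          simp only [BExpr.eval, NExpr.eval, h34, hpw, hf.nat 28 (by simp), hf.nat 29 (by simp)]
            at ht
          refine Ends.setNat ?_ ?_
          · intro _
            simp only [NExpr.eval, h34, hpw]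
            exact (Nat.div_mul_le_self _ _).trans (hb₂ _ _)
          · simp only [NExpr.eval, h34, hpw, hf.nat 29 (by simp)]
            refine ⟨⟨hf.writeNat (by simp), fun j' hj' => ?_⟩, by simp [h34]⟩
            simp only [writeNat_nat, true_and]
            by_cases hjj : j' = j
            · subst hjj
              simp [BoxNet.mid, ht]
            · rw [if_neg hjj, h1 j' hj']
              congr 1
              split_ifs <;> omega
        · intro ht
          simp only [BExpr.eval, NExpr.eval, h34, hpw, hf.nat 28 (by simp), hf.nat 29 (by simp)]
            at ht
          refine Ends.skip ⟨⟨hf, fun j' hj' => ?_⟩, h34⟩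
          rw [h1 j' hj']
          by_cases hjj : j' = j
          · subst hjj
            simp [BoxNet.mid, ht]
          · congr 1
            split_ifs <;> omega
      · rintro s₂ - ⟨⟨hf, h1⟩, h34⟩
        refine ⟨h34, hI _ _ _ ⟨hf, fun j hj => ?_⟩⟩
        rw [h1 j hj, if_pos hj]
  refine (Ends.seq hinit fun s₁ _ h₁ => hmain s₁ h₁).mono ?_ ?_
  · have : d * (2 + 1) + 1 + 3 = d * 3 + 4 := by ring
    rw [this]
    omega
  · rintro s' - ⟨h, -⟩
    exact h

/-- Write a point with given coordinates to the end of the output. -/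
def writePoint (d : ℕ) (f : ℕ → RExpr) : Cmd := seqN d fun j => .setReal 4 (addr d (.var 1) j) (f j)

theorem writePoint_ends {d : ℕ} {s : State} {f : ℕ → RExpr} {v : ℕ → ℝ}
    (hv : ∀ j < d, ∀ s', Frame [] [4] s s' → (f j).eval s' = v j) :
    Ends σ (writePoint d f) s (d * 2 + 1) (fun s' => Frame [] [4] s s' ∧
      (∀ x < s.nat 1 0 * d, s'.real 4 x = s.real 4 x) ∧
      ∀ j < d, outPoint d s' (s.nat 1 0) j = v j) := by
  refine (Ends.seqN (T := 1) (fun j s' => Frame [] [4] s s' ∧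
      (∀ x < s.nat 1 0 * d, s'.real 4 x = s.real 4 x) ∧
      ∀ j' < j, outPoint d s' (s.nat 1 0) j' = v j') d ⟨Frame.refl _ _ _, by simp, by simp⟩
      ?_).mono le_rfl fun _ _ h => h
  rintro j hj s' - ⟨hf, h1, h2⟩
  refine Ends.setReal ?_
  simp only [eval_addr, NExpr.eval, hv j hj s' hf, hf.nat 1 (by simp)]
  refine ⟨hf.writeReal (by simp), fun x hx => ?_, fun j' hj' => ?_⟩
  · rw [← h1 x hx]
    have : x ≠ s.nat 1 0 * d + j := by omega
    simp [this]
  · rcases (show j' < j ∨ j' = j by omega) with h | rfl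
    · rw [← h2 j' h]
      simp [outPoint, h.ne]
    · simp [outPoint]

/-- The expression of the number of the output point that represents the current center. -/
def usedMark (d : ℕ) : NExpr :=
  .get 35 (keyExpr (.var 8) (fun j => .get 33 (.lit j)) (.lit 0) d)

/-- Append a point of the current box to the output, its center if possible. -/
def append (d : ℕ) : Cmd :=
  .seq (writePoint d fun j => .get (10 + j) (.sub (.get 33 (.lit j)) (.lit 1)))
    (.seq (.branch (inBoxTest d (.var 1)) .skip
      (writePoint d fun j => .get 2 (addr d (.var 30) j)))
    (.seq (.setNat 35 (keyExpr (.var 8) (fun j => .get 33 (.lit j)) (.lit 0) d) (.var 1))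
      (.assign 1 (.add (.var 1) (.lit 1)))))

/-- The key of the center with coordinates `c`. -/
def centerKey (d H : ℕ) (c : ℕ → ℕ) : ℕ := keyFold (2 ^ (H + 2)) c 0 d

/-- The grid point of the center is written first and replaced by the lower corner if it misses the
box, so the box is pierced even when the lines are not dense. Ranks count lines from one, hence the
index `s.nat 33 j - 1`. -/
theorem append_ends {d : ℕ} {p : Params} {ln : ℕ → ℕ → ℝ} {s : State} {b : ℕ}
    (hH : Holds d p s) (hL : Lines d p.H ln s) (hb : s.nat 30 0 = b)
    (hne : ∀ j < d, p.lo (b * d + j) ≤ p.hi (b * d + j)) (hW : s.nat 1 0 + 1 ≤ σ.word) :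
    Ends σ (append d) s (d * 4 + 8) (fun s' => Frame [1, 35] [4] s s' ∧
      s'.nat 1 0 = s.nat 1 0 + 1 ∧ (∀ x < s.nat 1 0 * d, s'.real 4 x = s.real 4 x) ∧
      InBox d p.lo p.hi b (outPoint d s' (s.nat 1 0)) ∧
      (InBox d p.lo p.hi b (fun j => ln j (s.nat 33 j - 1)) →
        ∀ j < d, outPoint d s' (s.nat 1 0) j = ln j (s.nat 33 j - 1)) ∧
      ∀ x, s'.nat 35 x = if x = centerKey d p.H (s.nat 33) then s.nat 1 0 else s.nat 35 x) := by
  refine (Ends.seq (writePoint_ends (v := fun j => ln j (s.nat 33 j - 1)) ?_) fun s₁ _ h₁ =>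
    Ends.seq (Q₁ := fun s' => Frame [] [4] s s' ∧
      (∀ x < s.nat 1 0 * d, s'.real 4 x = s.real 4 x) ∧
      InBox d p.lo p.hi b (outPoint d s' (s.nat 1 0)) ∧
      (InBox d p.lo p.hi b (fun j => ln j (s.nat 33 j - 1)) →
        ∀ j < d, outPoint d s' (s.nat 1 0) j = ln j (s.nat 33 j - 1)))
      (Ends.branch (T := d * 2 + 1) ?_ ?_) fun s₂ _ h₂ =>
    Ends.seq (Ends.setNat (Q := fun s' => s' = s₂.writeNat 35
      (centerKey d p.H (s.nat 33)) (s.nat 1 0)) ?_ ?_) fun s₃ _ h₃ =>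
    Ends.setNat ?_ ?_).mono ?_ fun _ _ h => h
  · intro j hj s' hf
    simp only [RExpr.eval, NExpr.eval, hf.nat 33 (by simp), hf.real (10 + j) (by simp; omega), hL.eq j hj]
  · intro ht
    obtain ⟨hf₁, h1, h2⟩ := h₁
    rw [eval_inBoxTest, hf₁.real 2 (by simp), hf₁.real 3 (by simp), hH.lo, hH.hi,
      hf₁.nat 30 (by simp), hb] at ht
    simp only [NExpr.eval, hf₁.nat 1 (by simp)] at ht
    exact Ends.skip ⟨hf₁, h1, ht, fun _ => h2⟩ |>.mono (by omega) fun _ _ h => h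
  · intro ht
    obtain ⟨hf₁, h1, h2⟩ := h₁
    rw [eval_inBoxTest, hf₁.real 2 (by simp), hf₁.real 3 (by simp), hH.lo, hH.hi,
      hf₁.nat 30 (by simp), hb] at ht
    simp only [NExpr.eval, hf₁.nat 1 (by simp)] at ht
    refine (writePoint_ends (v := fun j => p.lo (b * d + j)) ?_).mono le_rfl ?_
    · intro j hj s' hf
      simp [RExpr.eval, eval_addr, NExpr.eval, hf.nat 30 (by simp), hf₁.nat 30 (by simp), hb,
        hf.real 2, hf₁.real 2, hH.lo]
    · rintro s' - ⟨hf, h3, h4⟩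
      rw [hf₁.nat 1 (by simp)] at h3 h4
      refine ⟨hf₁.trans hf, fun x hx => by rw [h3 x hx, h1 x hx], fun j hj => ?_, fun h => ?_⟩
      · rw [h4 j hj]
        exact ⟨le_rfl, hne j hj⟩
      · exact absurd (h.congr h2) ht
  · intro hb'
    exact hb' 1 0
  · simp only [NExpr.eval, eval_keyExpr, h₂.1.nat 1 (by simp), h₂.1.nat 33 (by simp),
      h₂.1.nat 8 (by simp), hH.M]
    rfl
  · intro _
    subst h₃
    simp only [NExpr.eval, writeNat_nat, h₂.1.nat 1 (by simp)]
    simpa using hW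
  · subst h₃
    obtain ⟨hf, h1, h2, h3⟩ := h₂
    simp only [NExpr.eval]
    refine ⟨((hf.mono (by simp) (by simp)).writeNat (by simp)).writeNat (by simp), ?_, h1, h2, h3,
      fun x => ?_⟩
    · simp [hf.nat 1]
    · simp [hf.nat 35]
  · omega

/-- Make sure that the output contains a point of the current box. -/
def processBox (d : ℕ) : Cmd :=
  .seq (seqN d (boundCoord d)) (.seq (query d) (.branch (.ltNat (.var 32) (.lit 1))
    (.seq (findCenter d) (.branch (hitTest d (usedMark d)) .skip (append d))) .skip))

/-- The center of box `b`. -/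
noncomputable def boxCenter (d : ℕ) (p : Params) (ln : ℕ → ℕ → ℝ) (b j : ℕ) : ℕ :=
  BoxNet.mid (p.H + 2) (boxLow d p ln b j) (boxHigh d p ln b j)

/-- The relation of the memory contents before and after processing box `b`. -/
structure Processed (d : ℕ) (p : Params) (ln : ℕ → ℕ → ℝ) (b : ℕ) (s s' : State) : Prop where
  frame : Frame [1, 12, 13, 14, 28, 29, 31, 32, 33, 34, 35] [4] s s'
  output : ∀ x < s.nat 1 0 * d, s'.real 4 x = s.real 4 x
  hit : ∃ i, Hits d p s' b i
  cases : s'.nat 1 0 = s.nat 1 0 ∧ s'.nat 35 = s.nat 35 ∨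
    s'.nat 1 0 = s.nat 1 0 + 1 ∧
    (∀ t < (p.H + 2) ^ d, ∀ c < 2 ^ d, ¬ Hits d p s b
      (s.nat 27 (queryKey d p.H (boxLow d p ln b) (boxHigh d p ln b) t c))) ∧
    ¬ Hits d p s b (s.nat 35 (centerKey d p.H (boxCenter d p ln b))) ∧
    (InBox d p.lo p.hi b (fun j => ln j (boxCenter d p ln b j - 1)) →
      ∀ j < d, outPoint d s' (s.nat 1 0) j = ln j (boxCenter d p ln b j - 1)) ∧
    ∀ x, s'.nat 35 x =
      if x = centerKey d p.H (boxCenter d p ln b) then s.nat 1 0 else s.nat 35 x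

/-- The output grows only if neither a marked sample point nor the stored point of the center lies
in the box. `Processed` keeps both failures, because the size bound is derived from them. -/
theorem processBox_ends {d : ℕ} {p : Params} {ln : ℕ → ℕ → ℝ} {s : State} {b : ℕ}
    (hH : Holds d p s) (hL : Lines d p.H ln s) (hb : s.nat 30 0 = b)
    (hne : ∀ j < d, p.lo (b * d + j) ≤ p.hi (b * d + j)) (hW : s.nat 1 0 + 1 ≤ σ.word) :
    Ends σ (processBox d) s (d * (20 * (p.H + 2) + 6) + (p.H + 2) ^ d * (2 ^ d * 3 + 4) +
      (p.H + 2) * (d * 3 + 4) + d * 6 + 30) (Processed d p ln b s) := by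
  refine (Ends.seq (T₂ := (p.H + 2) ^ d * (2 ^ d * 3 + 4) + (p.H + 2) * (d * 3 + 4) + d * 6 + 26)
    (bound_ends hH hL hb) fun s₁ _ h₁ => ?_).mono (by omega) fun _ _ h => h
  obtain ⟨hf₁, hx, hy⟩ := h₁
  have hH₁ := hH.frame hf₁ (by simp) (by simp)
  have hL₁ := hL.frame hf₁ (by simp)
  have h27 : s₁.nat 27 = s.nat 27 := hf₁.nat 27 (by simp)
  have hqk : ∀ t c, queryKey d p.H (s₁.nat 28) (s₁.nat 29) t c =
      queryKey d p.H (boxLow d p ln b) (boxHigh d p ln b) t c := fun t c =>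
    keyFold_congr fun j hj => by rw [hx j hj, hy j hj]
  refine (Ends.seq (T₂ := (p.H + 2) * (d * 3 + 4) + d * 6 + 20)
    (query_ends hH₁ (by rw [hf₁.nat 30 (by simp), hb]) (by omega)) fun s₂ _ h₂ => ?_).mono (by omega) fun _ _ h => h
  obtain ⟨hf₂, hq, hq'⟩ := h₂
  have hH₂ := hH₁.frame hf₂ (by simp) (by simp)
  have hL₂ := hL₁.frame hf₂ (by simp)
  have hf₁₂ : Frame [1, 12, 13, 14, 28, 29, 31, 32, 33, 34, 35] [4] s s₂ :=
    (hf₁.mono (by simp) (by simp)).trans (hf₂.mono (by simp) (by simp))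
  have h1₂ : s₂.nat 1 = s.nat 1 := by rw [hf₂.nat 1 (by simp), hf₁.nat 1 (by simp)]
  have h35₂ : s₂.nat 35 = s.nat 35 := by rw [hf₂.nat 35 (by simp), hf₁.nat 35 (by simp)]
  have h4₂ : s₂.real 4 = s.real 4 := by rw [hf₂.real 4 (by simp), hf₁.real 4 (by simp)]
  refine (Ends.branch (T := (p.H + 2) * (d * 3 + 4) + d * 6 + 19) ?_ ?_)
  · intro h32
    have h32' : s₂.nat 32 0 = 0 := by simpa [BExpr.eval, NExpr.eval] using h32
    refine (Ends.seq (T₂ := d * 4 + 9) (findCenter_ends hH₂) fun s₃ _ h₃ => ?_).mono (by omega)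
      fun _ _ h => h
    obtain ⟨hf₃, hc⟩ := h₃
    have hH₃ := hH₂.frame hf₃ (by simp) (by simp)
    have hL₃ := hL₂.frame hf₃ (by simp)
    have hc' : ∀ j < d, s₃.nat 33 j = boxCenter d p ln b j := fun j hj => by
      rw [hc j hj, hf₂.nat 28 (by simp), hf₂.nat 29 (by simp), hx j hj, hy j hj, boxCenter]
    have h1₃ : s₃.nat 1 = s.nat 1 := by rw [hf₃.nat 1 (by simp), h1₂]
    have h35₃ : s₃.nat 35 = s.nat 35 := by rw [hf₃.nat 35 (by simp), h35₂]
    have h4₃ : s₃.real 4 = s.real 4 := by rw [hf₃.real 4 (by simp), h4₂]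
    have h30₃ : s₃.nat 30 0 = b := by
      rw [hf₃.nat 30 (by simp), hf₂.nat 30 (by simp), hf₁.nat 30 (by simp), hb]
    have hck : centerKey d p.H (s₃.nat 33) = centerKey d p.H (boxCenter d p ln b) :=
      keyFold_congr hc'
    have hf₁₃ : Frame [1, 12, 13, 14, 28, 29, 31, 32, 33, 34, 35] [4] s s₃ :=
      hf₁₂.trans (hf₃.mono (by simp) (by simp))
    have hh : ∀ i, Hits d p s₃ b i ↔ Hits d p s b i := fun i => by
      unfold Hits outPoint
      rw [h1₃, h4₃]
    have hue : (usedMark d).eval s₃ = s.nat 35 (centerKey d p.H (boxCenter d p ln b)) := by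
      rw [← hck]
      simp only [usedMark, NExpr.eval, eval_keyExpr, hH₃.M, h35₃]
      rfl
    refine Ends.branch (T := d * 4 + 8) ?_ ?_
    · intro ht
      rw [eval_hitTest hH₃, h30₃] at ht
      exact (Ends.skip ⟨hf₁₃, fun x _ => by rw [h4₃], ⟨_, ht⟩,
        Or.inl ⟨by rw [h1₃], h35₃⟩⟩).mono (by omega) fun _ _ h => h
    · intro ht
      rw [eval_hitTest hH₃, h30₃, hh, hue] at ht
      refine (append_ends hH₃ hL₃ h30₃ hne (by rw [h1₃]; exact hW)).mono le_rfl ?_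
      rintro s₄ - ⟨hf₄, h5, h6, h7, h8, h9⟩
      rw [h1₃] at h5 h6 h7 h8
      refine ⟨hf₁₃.trans (hf₄.mono (by simp) (by simp)), fun x hx => by rw [h6 x hx, h4₃],
        ⟨s.nat 1 0, by omega, h7⟩, Or.inr ⟨h5, ?_, ht, fun hin j hj => ?_, fun x => ?_⟩⟩
      · intro t ht c hc
        have := hq' h32' t ht c hc
        rwa [Hits.frame hf₁ (by simp) (by simp), hqk, h27] at this
      · rw [h8 (hin.congr fun j hj => by rw [hc' j hj]) j hj, hc' j hj]
      · rw [h9 x, hck, h1₃, h35₃]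
  · intro h32
    have h32' : s₂.nat 32 0 ≠ 0 := by
      simp only [BExpr.eval, NExpr.eval] at h32; omega
    obtain ⟨i, hi⟩ := hq h32'
    rw [Hits.frame hf₁ (by simp) (by simp)] at hi
    refine (Ends.skip ⟨hf₁₂, fun x _ => by rw [h4₂], ⟨i, ?_⟩, Or.inl ⟨by rw [h1₂], h35₂⟩⟩).mono
      (by omega) fun _ _ h => h
    unfold Hits outPoint at hi ⊢
    rwa [h1₂, h4₂]

end RealRAM

namespace RealRAM

variable {σ : Goal}

/-! ### The query is complete -/

/-- Take the last level at which the block of `z` is strictly between those of `x` and `y`. One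
level higher it merges with one of them, so it is the immediate neighbour of that block. Conversely,
a block strictly between the two contains only numbers strictly between `x` and `y`. -/
theorem exists_sideNode {H x y z : ℕ} (hx : x < z) (hy : z < y) (hH : y < 2 ^ H) :
    ∃ h < H, ∃ c < 2, z / 2 ^ h = sideNode c h x y ∧
      ∀ z', z' / 2 ^ h = sideNode c h x y → x < z' ∧ z' < y := by
  classical
  have hex : ∃ h, ¬ (x / 2 ^ h < z / 2 ^ h ∧ z / 2 ^ h < y / 2 ^ h) :=
    ⟨H, by simp [Nat.div_eq_of_lt hH]⟩
  have hmin : Nat.find hex ≤ H := Nat.find_min' hex (by simp [Nat.div_eq_of_lt hH])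
  obtain ⟨h, hh⟩ : ∃ h, Nat.find hex = h + 1 := by
    rcases Nat.eq_zero_or_eq_succ_pred (Nat.find hex) with h0 | h0
    · exact absurd ⟨by simpa using hx, by simpa using hy⟩ (h0 ▸ Nat.find_spec hex)
    · exact ⟨_, h0⟩
  have h1 : x / 2 ^ h < z / 2 ^ h ∧ z / 2 ^ h < y / 2 ^ h :=
    not_not.1 (Nat.find_min hex (by omega : h < Nat.find hex))
  have h2 := Nat.find_spec hex
  rw [hh] at h2
  simp only [pow_succ, ← Nat.div_div_eq_div_mul] at h2
  have hlt : ∀ {u v : ℕ}, u / 2 ^ h < v / 2 ^ h → u < v := fun huv => by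
    by_contra hc
    exact absurd (Nat.div_le_div_right (c := 2 ^ h) (not_lt.1 hc)) (not_le.2 huv)
  refine ⟨h, by omega, ?_⟩
  by_cases h3 : z / 2 ^ h = x / 2 ^ h + 1
  · refine ⟨0, by omega, by simpa [sideNode] using h3, fun z' hz' => ?_⟩
    simp only [sideNode, if_true] at hz'
    exact ⟨hlt (by omega), hlt (by omega)⟩
  · have h4 : z / 2 ^ h = y / 2 ^ h - 1 := by
      clear hlt hmin hh
      generalize z / 2 ^ h = Z at *
      generalize y / 2 ^ h = Y at *
      generalize x / 2 ^ h = X at *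
      omega
    refine ⟨1, by omega, by simpa [sideNode] using h4, fun z' hz' => ?_⟩
    simp only [sideNode, one_ne_zero, if_false] at hz'
    exact ⟨hlt (by omega), hlt (by omega)⟩

theorem samplePos_lt (d : ℕ) (p : Params) (ln : ℕ → ℕ → ℝ) (x j : ℕ) :
    samplePos d p ln x j < 2 ^ (p.H + 2) := by
  have h1 := BoxNet.ltCount_le (ln j) (2 ^ p.H) (p.points (x * d + j))
  have h2 := BoxNet.leCount_le (ln j) (2 ^ p.H) (p.points (x * d + j))
  have h3 : 0 < 2 ^ p.H := by positivity
  rw [samplePos, BoxNet.pos, pow_add]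
  omega

/-- The levels and sides of the blocks of the interior sample point are coded by `t` and `u`. The
mark found there may come from another sample point, but that point lies in the same blocks and is
therefore inside the box too. -/
theorem exists_hit {d : ℕ} {p : Params} {ln : ℕ → ℕ → ℝ} {s : State} {x : ℕ → ℕ} {b i : ℕ}
    (hm : Marked (fun i => nodeKey d p.H (samplePos d p ln (x i))) (s.nat 27)
        fun i t => i < p.S ∧ t < (p.H + 2) ^ d)
    (hout : ∀ i < p.S, ∀ j < d, s.real 4 (i * d + j) = p.points (x i * d + j))
    (hS : p.S ≤ s.nat 1 0) (hi : i < p.S)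
    (hin : ∀ j < d, 2 * boxLow d p ln b j < samplePos d p ln (x i) j ∧
      samplePos d p ln (x i) j < 2 * boxHigh d p ln b j) :
    ∃ t < (p.H + 2) ^ d, ∃ c < 2 ^ d, Hits d p s b
      (s.nat 27 (queryKey d p.H (boxLow d p ln b) (boxHigh d p ln b) t c)) := by
  have hnode : ∀ j, ∃ h, ∃ c, j < d → h < p.H + 2 ∧ c < 2 ∧
      samplePos d p ln (x i) j / 2 ^ h =
        sideNode c h (2 * boxLow d p ln b j) (2 * boxHigh d p ln b j) ∧
      ∀ z', z' / 2 ^ h = sideNode c h (2 * boxLow d p ln b j) (2 * boxHigh d p ln b j) →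
        2 * boxLow d p ln b j < z' ∧ z' < 2 * boxHigh d p ln b j := by
    intro j
    by_cases hj : j < d
    · obtain ⟨h, hh, c, hc, h1⟩ := exists_sideNode (H := p.H + 2) (hin j hj).1 (hin j hj).2 (by
        have := BoxNet.leCount_le (ln j) (2 ^ p.H) (p.hi (b * d + j))
        have h3 : 0 < 2 ^ p.H := by positivity
        rw [boxHigh, pow_add]
        omega)
      exact ⟨h, c, fun _ => ⟨hh, hc, h1⟩⟩
    · exact ⟨0, 0, fun h => absurd h hj⟩
  choose h c hhc using hnode
  obtain ⟨t, ht, htd⟩ := exists_digits h fun j hj => (hhc j hj).1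
  obtain ⟨u, hu, hud⟩ := exists_digits c fun j hj => (hhc j hj).2.1
  have hkey : queryKey d p.H (boxLow d p ln b) (boxHigh d p ln b) t u =
      nodeKey d p.H (samplePos d p ln (x i)) t := by
    refine keyFold_congr fun j hj => ?_
    rw [htd j hj, hud j hj, (hhc j hj).2.2.1]
  obtain ⟨i', t', ⟨hi', -⟩, h1, h2⟩ := hm i t ⟨hi, ht⟩
  have hb : ∀ (k : ℕ) (t : ℕ), ∀ j < d, samplePos d p ln (x k) j /
      2 ^ (t / (p.H + 2) ^ j % (p.H + 2)) < 2 ^ (p.H + 2) := fun k t j _ =>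
    (Nat.div_le_self _ _).trans_lt (samplePos_lt _ _ _ _ _)
  obtain ⟨rfl, h4⟩ := keyFold_inj (hb _ _) (hb _ _) h2
  refine ⟨t', ht, u, hu, ?_⟩
  rw [hkey, h1]
  refine ⟨by omega, fun j hj => ?_⟩
  have h5 := h4 j hj
  rw [htd j hj] at h5
  have h6 := (hhc j hj).2.2.2 _ (h5.trans (hhc j hj).2.2.1)
  simp only [outPoint, hout i' hi' j hj]
  exact ⟨BoxNet.le_of_two_mul_ltCount_lt h6.1, BoxNet.le_of_lt_two_mul_leCount h6.2⟩

/-! ### Processing all boxes -/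

/-- Process all boxes. -/
def processAll (d : ℕ) : Cmd := forLoop 30 (.get 0 (.lit 1)) (processBox d)

/-- Extend a center by `0`. -/
def extend {d : ℕ} (c : Fin d → ℕ) (j : ℕ) : ℕ := if h : j < d then c ⟨j, h⟩ else 0

theorem Hits.of_processed {d : ℕ} {p : Params} {ln : ℕ → ℕ → ℝ} {b b' i : ℕ} {s s' : State}
    (h : Processed d p ln b s s') (hi : Hits d p s b' i) : Hits d p s' b' i := by
  refine ⟨?_, hi.2.congr fun j hj => h.output _ ?_⟩
  · have := hi.1
    rcases h.cases with h | h <;> omega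
  · have := hi.1
    nlinarith

/-- The appended points correspond one to one to a set `U` of centers inside `Bad`: a second box
with a center in `U` is hit by the point stored for it and appends nothing. -/
theorem processAll_ends {d : ℕ} {p : Params} {ln : ℕ → ℕ → ℝ} {s : State} {x : ℕ → ℕ}
    (hH : Holds d p s) (hL : Lines d p.H ln s) (h1 : s.nat 1 0 = p.S)
    (hm : Marked (fun i => nodeKey d p.H (samplePos d p ln (x i))) (s.nat 27)
        fun i t => i < p.S ∧ t < (p.H + 2) ^ d)
    (hout : ∀ i < p.S, ∀ j < d, s.real 4 (i * d + j) = p.points (x i * d + j))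
    (hne : ∀ b < p.m, ∀ j < d, p.lo (b * d + j) ≤ p.hi (b * d + j)) (hW : p.S + p.m ≤ σ.word)
    (Bad : Finset (Fin d → ℕ)) :
    Ends σ (processAll d) s (p.m * (d * (20 * (p.H + 2) + 6) + (p.H + 2) ^ d * (2 ^ d * 3 + 4) +
      (p.H + 2) * (d * 3 + 4) + d * 6 + 33) + 3) (fun s' =>
      Frame [1, 12, 13, 14, 28, 29, 30, 31, 32, 33, 34, 35] [4] s s' ∧
      (∀ b < p.m, ∃ i, Hits d p s' b i) ∧
      ((∀ b < p.m, (∀ j < d, boxLow d p ln b j < boxHigh d p ln b j) ∧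
        ((∀ i < p.S, ¬ ∀ j < d, 2 * boxLow d p ln b j < samplePos d p ln (x i) j ∧
          samplePos d p ln (x i) j < 2 * boxHigh d p ln b j) →
          (fun j : Fin d => boxCenter d p ln b j) ∈ Bad)) → s'.nat 1 0 ≤ p.S + Bad.card)) := by
  classical
  -- Piercing does not depend on the quality of the random choices, so this assumption guards only
  -- the size bound.
  set hyp : Prop := ∀ b < p.m, (∀ j < d, boxLow d p ln b j < boxHigh d p ln b j) ∧
        ((∀ i < p.S, ¬ ∀ j < d, 2 * boxLow d p ln b j < samplePos d p ln (x i) j ∧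
          samplePos d p ln (x i) j < 2 * boxHigh d p ln b j) →
          (fun j : Fin d => boxCenter d p ln b j) ∈ Bad) with hhyp
  let I : ℕ → State → Prop := fun q s' =>
    Frame [1, 12, 13, 14, 28, 29, 30, 31, 32, 33, 34, 35] [4] s s' ∧
    p.S ≤ s'.nat 1 0 ∧ s'.nat 1 0 ≤ p.S + q ∧
    (∀ i < p.S, ∀ j < d, s'.real 4 (i * d + j) = p.points (x i * d + j)) ∧
    (∀ b < q, ∃ i, Hits d p s' b i) ∧
    (hyp → ∃ U ⊆ Bad, s'.nat 1 0 = p.S + U.card ∧ ∀ c ∈ U, (∀ j, c j < 2 ^ (p.H + 2)) ∧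
      s'.nat 35 (centerKey d p.H (extend c)) < s'.nat 1 0 ∧
      ∀ j : Fin d, outPoint d s' (s'.nat 35 (centerKey d p.H (extend c))) j = ln j (c j - 1))
  have hI : ∀ q v s', I q s' → I q (s'.writeNat 30 0 v) := by
    rintro q v s' ⟨hf, h1, h2, h3, h4, h5⟩
    refine ⟨hf.writeNat (by simp), by simpa using h1, by simpa using h2, by simpa using h3, ?_, ?_⟩
    · intro b hb
      obtain ⟨i, hi⟩ := h4 b hb
      exact ⟨i, by simpa using hi.1, hi.2⟩
    · simpa [outPoint] using h5
  refine (Ends.forLoop I p.m (by omega) ?_ (hI _ _ _ ?_) ?_ (T := d * (20 * (p.H + 2) + 6) +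
    (p.H + 2) ^ d * (2 ^ d * 3 + 4) + (p.H + 2) * (d * 3 + 4) + d * 6 + 30)).mono le_rfl ?_
  · rintro q - s' ⟨hf, -⟩
    simp [NExpr.eval, hf.nat 0 (by simp), hH.m]
  · exact ⟨Frame.refl _ _ _, h1.ge, h1.le, hout, by simp, fun _ => ⟨∅, by simp, by simp [h1],
      by simp⟩⟩
  · rintro q hq s₁ - ⟨hf, h2, h3, h4, h5, h6⟩ h30
    have hH₁ := hH.frame hf (by simp) (by simp)
    have hL₁ := hL.frame hf (by simp)
    refine (processBox_ends hH₁ hL₁ h30 (hne q hq) (by omega)).mono le_rfl fun s₂ _ hp => ?_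
    have hout₂ : ∀ i < s₁.nat 1 0, ∀ j < d, outPoint d s₂ i j = outPoint d s₁ i j :=
      fun i hi j hj => hp.output _ (by nlinarith)
    refine ⟨by rw [hp.frame.nat 30 (by simp), h30], hI _ _ _ ⟨hf.trans (hp.frame.mono (by simp)
      (by simp)), ?_, ?_, fun i hi j hj => ?_, fun b hb => ?_, fun hy => ?_⟩⟩
    · rcases hp.cases with h | h <;> omega
    · rcases hp.cases with h | h <;> omega
    · rw [← h4 i hi j hj]
      exact hout₂ i (by omega) j hj
    · rcases (show b < q ∨ b = q by omega) with h | rfl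
      · obtain ⟨i, hi⟩ := h5 b h
        exact ⟨i, hi.of_processed hp⟩
      · exact hp.hit
    · obtain ⟨U, hU, hUc, hUu⟩ := h6 hy
      rcases hp.cases with ⟨h7, h8⟩ | ⟨h7, h8, h9, h10, h11⟩
      · refine ⟨U, hU, by rw [h7, hUc], fun c hc => ?_⟩
        obtain ⟨hc1, hc2, hc3⟩ := hUu c hc
        refine ⟨hc1, by rw [h7, h8]; exact hc2, fun j => ?_⟩
        rw [h8, hout₂ _ hc2 j j.2, hc3]
      · obtain ⟨hy1, hy2⟩ := hy q hq
        set c₀ : Fin d → ℕ := fun j => boxCenter d p ln q j with hc₀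
        have hle : ∀ j, boxHigh d p ln q j ≤ 2 ^ p.H := fun j => BoxNet.leCount_le _ _ _
        have hlt2 : 2 ^ p.H < 2 ^ (p.H + 2) := Nat.pow_lt_pow_right (by norm_num) (by omega)
        have hmid : ∀ j < d, boxLow d p ln q j < boxCenter d p ln q j ∧
            boxCenter d p ln q j ≤ boxHigh d p ln q j := by
          intro j hj
          have hlt := hy1 j hj
          have := BoxNet.mid_spec (G := p.H + 2) hlt (by
            have := hle j
            rw [Nat.div_eq_of_lt (by omega), Nat.div_eq_of_lt (by omega)])
          exact ⟨this.1, this.2.1⟩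
        -- The query failed, so by `exists_hit` no sample point is in the interior.
        have hbad : c₀ ∈ Bad := by
          refine hy2 fun i hi hin => ?_
          obtain ⟨t, ht, c, hc, hh⟩ := exists_hit (s := s₁)
            (by rw [hf.nat 27 (by simp)]; exact hm) h4 h2 hi hin
          exact h8 t ht c hc hh
        -- Since `boxLow < boxCenter ≤ boxHigh`, the sorted line with index `boxCenter - 1` is past
        -- all lines below the box and not past its upper side.
        have hcin : InBox d p.lo p.hi q (fun j => ln j (boxCenter d p ln q j - 1)) := by
          intro j hj
          obtain ⟨hm1, hm2⟩ := hmid j hj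
          have hj' := hle j
          constructor
          · by_contra hcon
            push Not at hcon
            have hsub : Finset.range (boxCenter d p ln q j) ⊆
                (Finset.range (2 ^ p.H)).filter fun g => ln j g < p.lo (q * d + j) := by
              intro g hg
              rw [Finset.mem_range] at hg
              exact Finset.mem_filter.2 ⟨Finset.mem_range.2 (by omega),
                (hL.sorted j hj g _ (by omega) (by omega)).trans_lt hcon⟩
            have := Finset.card_le_card hsub
            rw [Finset.card_range] at this
            exact absurd this (not_le.2 hm1)
          · by_contra hcon
            push Not at hcon
            have hsub : (Finset.range (2 ^ p.H)).filter (fun g => ln j g ≤ p.hi (q * d + j)) ⊆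
                Finset.range (boxCenter d p ln q j - 1) := by
              intro g hg
              obtain ⟨hg1, hg2⟩ := Finset.mem_filter.1 hg
              rw [Finset.mem_range] at hg1 ⊢
              by_contra hge
              exact absurd (hL.sorted j hj _ g (not_lt.1 hge) hg1) (not_le.2 (hg2.trans_lt hcon))
            have := Finset.card_le_card hsub
            rw [Finset.card_range] at this
            have h12 : boxHigh d p ln q j ≤ boxCenter d p ln q j - 1 := this
            omega
        have hck : centerKey d p.H (extend c₀) = centerKey d p.H (boxCenter d p ln q) :=
          keyFold_congr fun j hj => by simp [extend, hj, hc₀]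
        -- A stored point of this center would be the grid point, which lies in the box, and the
        -- test of the used center would have succeeded.
        have hnot : c₀ ∉ U := by
          intro hc
          obtain ⟨-, hc2, hc3⟩ := hUu c₀ hc
          rw [hck] at hc2 hc3
          exact h9 ⟨hc2, hcin.congr fun j hj => hc3 ⟨j, hj⟩⟩
        have hc₀b : ∀ j, c₀ j < 2 ^ (p.H + 2) := fun j => by
          have h12 := (hmid j j.2).2
          have h13 := hle j
          exact (h12.trans h13).trans_lt hlt2
        have hext : ∀ c : Fin d → ℕ, (∀ j, c j < 2 ^ (p.H + 2)) →
            ∀ j < d, extend c j < 2 ^ (p.H + 2) := fun c hc j hj => by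
          simpa [extend, hj] using hc ⟨j, hj⟩
        refine ⟨insert c₀ U, Finset.insert_subset hbad hU, ?_, fun c hc => ?_⟩
        · rw [Finset.card_insert_of_notMem hnot, h7, hUc, add_assoc]
        · rcases Finset.mem_insert.1 hc with rfl | hc
          · rw [h11, if_pos hck]
            exact ⟨hc₀b, by omega, fun j => h10 hcin j j.2⟩
          · obtain ⟨hc1, hc2, hc3⟩ := hUu c hc
            have hkne : centerKey d p.H (extend c) ≠ centerKey d p.H (boxCenter d p ln q) := by
              rw [← hck]
              intro hk
              have h12 := (keyFold_inj (hext c hc1) (hext c₀ hc₀b) hk).2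
              refine hnot ?_
              convert hc using 1
              funext j
              have := h12 j j.2
              simpa [extend] using this.symm
            rw [h11, if_neg hkne]
            exact ⟨hc1, by omega, fun j => by rw [hout₂ _ hc2 j j.2, hc3]⟩
  · rintro s' - ⟨⟨hf, -, -, -, h5, h6⟩, -⟩
    refine ⟨hf, h5, fun hy => ?_⟩
    obtain ⟨U, hU, hUc, -⟩ := h6 hy
    rw [hUc]
    exact Nat.add_le_add_left (Finset.card_le_card hU) _

end RealRAM

namespace RealRAM

variable {σ : Goal}

/-! ### One trial -/

/-- The arrays of the lines, and the auxiliary array for sorting. -/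
def lineArrays (d : ℕ) : List ℕ := 5 :: (List.range d).map (10 + ·)

/-- Make sorted lines from the coordinates of the sampled points. -/
def makeLines (d : ℕ) : Cmd :=
  seqN d fun j => .seq
    (forLoop 37 (.var 7) (.setReal (10 + j) (.var 37) (.get 1 (addr d (.get 15 (.var 37)) j))))
    (sortArray (10 + j))

theorem makeLines_ends {d : ℕ} {p : Params} {s : State} (hH : Holds d p s) :
    Ends σ (makeLines d) s (d * (36 * (2 ^ p.H * (p.H + 1)) + 5) + 1) (fun s' =>
      Frame [17, 18, 19, 20, 21, 22, 37] (lineArrays d) s s' ∧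
      ∃ ln, Lines d p.H ln s' ∧
        ∀ j < d, ∀ l < 2 ^ p.H, ∃ g < 2 ^ p.H, ln j g = p.points (s.nat 15 l * d + j)) := by
  refine Ends.pre fun hbd => ?_
  have hKW : 2 ^ p.H ≤ σ.word := hH.K ▸ hbd 7 0
  have hmem : ∀ j < d, 10 + j ∈ lineArrays d := fun j hj => by simp [lineArrays, hj]
  have hge : ∀ a ∈ lineArrays d, 4 ≤ a := by
    intro a ha
    simp only [lineArrays, List.mem_cons, List.mem_map] at ha
    omega
  refine (Ends.seqN (T := 36 * (2 ^ p.H * (p.H + 1)) + 4) (fun j s' =>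
    Frame [17, 18, 19, 20, 21, 22, 37] (lineArrays d) s s' ∧
      ∀ j' < j, (∀ g g', g ≤ g' → g' < 2 ^ p.H → s'.real (10 + j') g ≤ s'.real (10 + j') g') ∧
        ∀ l < 2 ^ p.H, ∃ g < 2 ^ p.H, s'.real (10 + j') g = p.points (s.nat 15 l * d + j')) d
    ⟨Frame.refl _ _ _, by simp⟩ ?_).mono le_rfl ?_
  · rintro j hj s₀ - ⟨hf, h1⟩
    have hH₀ := hH.frame hf (by simp) hge
    have hcopy : Ends σ (forLoop 37 (.var 7) (.setReal (10 + j) (.var 37)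
        (.get 1 (addr d (.get 15 (.var 37)) j)))) s₀ (2 ^ p.H * (1 + 3) + 3) (fun s' =>
        (Frame [37] [10 + j] s₀ s' ∧
          ∀ l < 2 ^ p.H, s'.real (10 + j) l = p.points (s.nat 15 l * d + j)) ∧
        s'.nat 37 0 = 2 ^ p.H) := by
      refine Ends.forLoop (fun q s' => Frame [37] [10 + j] s₀ s' ∧
        ∀ l < q, s'.real (10 + j) l = p.points (s.nat 15 l * d + j)) _ hKW ?_ ?_ ?_
      · rintro q - s' ⟨hf', -⟩
        simp [NExpr.eval, hf'.nat 7 (by simp), hH₀.K]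
      · exact ⟨(Frame.refl _ _ _).writeNat (by simp), by simp⟩
      · rintro q hq s' - ⟨hf', h2⟩ h37
        refine Ends.setReal ?_
        have hval : (RExpr.get 1 (addr d (.get 15 (.var 37)) j)).eval s' =
            p.points (s.nat 15 q * d + j) := by
          simp only [RExpr.eval, eval_addr, NExpr.eval, h37, hf'.nat 15 (by simp),
            hf.nat 15 (by simp), hf'.real 1 (by simp; omega), hH₀.points]
        rw [hval]
        simp only [NExpr.eval, h37]
        refine ⟨by simp [h37], (hf'.writeReal (by simp)).writeNat (by simp), fun l hl => ?_⟩
        rcases (show l < q ∨ l = q by omega) with h | rfl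
        · simpa [h.ne] using h2 l h
        · simp
    refine (Ends.seq (T₂ := 32 * (2 ^ p.H * (p.H + 1))) hcopy fun s₁ _ h₁ => ?_).mono ?_
      fun _ _ h => h
    · obtain ⟨⟨hf₁, h2⟩, -⟩ := h₁
      have hH₁ := hH₀.frame hf₁ (by simp) (by simp; omega)
      refine (sortArray_ends (10 + j) (by omega) hH₁.G hH₁.K).mono le_rfl ?_
      rintro s₂ - ⟨hf₂, h3, h4⟩
      refine ⟨(hf.trans (hf₁.mono (by simp) (by simp [hmem j hj]))).trans
        (hf₂.mono (by simp) (by simp [hmem j hj]; simp [lineArrays])), fun j' hj' => ?_⟩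
      rcases (show j' < j ∨ j' = j by omega) with h | rfl
      · rw [hf₂.real (10 + j') (by simp; omega), hf₁.real (10 + j') (by simp; omega)]
        exact h1 j' h
      · refine ⟨h3, fun l hl => ?_⟩
        obtain ⟨g, hg, he⟩ := h4 l hl
        exact ⟨g, hg, by rw [he, h2 l hl]⟩
    · have : 1 ≤ 2 ^ p.H := Nat.one_le_two_pow
      nlinarith
  · rintro s' - ⟨hf, h⟩
    exact ⟨hf, fun j => s'.real (10 + j), ⟨fun _ _ => rfl, fun j hj => (h j hj).1⟩,
      fun j hj => (h j hj).2⟩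

/-- Build the output from the sample, and accept it if it is small. -/
def finish (d : ℕ) : Cmd :=
  .seq (markAll d) (.seq (.assign 1 (.var 9)) (.seq (processAll d)
    (.branch (.ltNat (.add (.var 9) (.mul (.lit 5) (.var 2))) (.var 1)) .skip
      (.assign 36 (.lit 1)))))

/-- A bound on the number of steps of `finish`. -/
def finishTime (d : ℕ) (p : Params) : ℕ :=
  p.S * (d * (20 * (p.H + 2) + 8) + (p.H + 2) ^ d * 4 + 8) +
    p.m * (d * (20 * (p.H + 2) + 6) + (p.H + 2) ^ d * (2 ^ d * 3 + 4) +
      (p.H + 2) * (d * 3 + 4) + d * 6 + 33) + 12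

/-- Variable `36` is the flag of acceptance. The assumptions on `Bad` enter only the last clause:
without them a trial may be rejected, but an accepted output is always small and piercing. -/
theorem finish_ends {d : ℕ} {p : Params} {ln : ℕ → ℕ → ℝ} {s : State}
    (hH : Holds d p s) (hL : Lines d p.H ln s) (hdone : s.nat 36 0 = 0)
    (hne : ∀ b < p.m, ∀ j < d, p.lo (b * d + j) ≤ p.hi (b * d + j))
    (hW : 2 ^ (p.H + 2) ≤ σ.word) (hW' : p.S + p.m ≤ σ.word) (Bad : Finset (Fin d → ℕ)) :
    Ends σ (finish d) s (finishTime d p) (fun s' => Holds d p s' ∧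
      (s'.nat 36 0 = 0 ∨ s'.nat 36 0 = 1 ∧ s'.nat 1 0 ≤ p.S + 5 * p.R ∧
        ∀ b < p.m, ∃ i, Hits d p s' b i) ∧
      (Bad.card ≤ 5 * p.R → (∀ b < p.m, (∀ j < d, boxLow d p ln b j < boxHigh d p ln b j) ∧
        ((∀ i < p.S, ¬ ∀ j < d, 2 * boxLow d p ln b j < samplePos d p ln (s.nat 16 i) j ∧
          samplePos d p ln (s.nat 16 i) j < 2 * boxHigh d p ln b j) →
          (fun j : Fin d => boxCenter d p ln b j) ∈ Bad)) → s'.nat 36 0 = 1)) := by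
  obtain ⟨X, hX⟩ : ∃ X, p.m * (d * (20 * (p.H + 2) + 6) + (p.H + 2) ^ d * (2 ^ d * 3 + 4) +
    (p.H + 2) * (d * 3 + 4) + d * 6 + 33) + 3 = X := ⟨_, rfl⟩
  refine (Ends.seq (T₂ := 1 + (X + (1 + 1) + 1) + 1) (markAll_ends hH hL hW) fun s₁ _ h₁ => ?_).mono ?_ fun _ _ h => h
  · obtain ⟨hf₁, h1, h2⟩ := h₁
    have hH₁ := hH.frame hf₁ (by simp) (by simp)
    have hL₁ := hL.frame hf₁ (by simp)
    refine Ends.seq (T₁ := 1) (T₂ := X + (1 + 1) + 1)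
      (Ends.setNat (Q := fun s' => s' = s₁.writeNat 1 0 p.S) ?_ ?_) fun s₂ _ e₂ => ?_
    · intro hb; exact hb 9 0
    · simp [NExpr.eval, hH₁.S]
    have hf₂ : Frame [1] [] s₁ s₂ := by
      subst e₂
      exact (Frame.refl _ _ _).writeNat (by simp)
    have hH₂ := hH₁.frame hf₂ (by simp) (by simp)
    have hL₂ := hL₁.frame hf₂ (by simp)
    have hall := processAll_ends (σ := σ) hH₂ hL₂ (x := s.nat 16) (by rw [e₂]; simp)
      (by rw [hf₂.nat 27 (by simp)]; exact h2) (by rw [hf₂.real 4 (by simp)]; exact h1) hne hW' Bad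
    rw [hX] at hall
    refine Ends.seq (T₁ := X) (T₂ := 1 + 1) hall fun s₃ hb₃ h₃ => ?_
    obtain ⟨hf₃, h3, h4⟩ := h₃
    have hH₃ := hH₂.frame hf₃ (by simp) (by simp)
    have h36 : s₃.nat 36 0 = 0 := by
      rw [hf₃.nat 36 (by simp), hf₂.nat 36 (by simp), hf₁.nat 36 (by simp), hdone]
    refine Ends.branch ?_ ?_
    · intro ht
      simp only [BExpr.eval, NExpr.eval, hH₃.S, hH₃.R] at ht
      refine Ends.skip ⟨hH₃, Or.inl h36, fun hB hy => ?_⟩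
      have := h4 hy
      omega
    · intro ht
      simp only [BExpr.eval, NExpr.eval, hH₃.S, hH₃.R, not_lt] at ht
      refine Ends.setNat ?_ ?_
      · intro _
        have : 0 < 2 ^ (p.H + 2) := by positivity
        simp only [NExpr.eval]
        omega
      · have hf₄ : Frame [36] [] s₃ (s₃.writeNat 36 0 1) := (Frame.refl _ _ _).writeNat (by simp)
        refine ⟨hH₃.frame hf₄ (by simp) (by simp), Or.inr ⟨by simp [NExpr.eval],
          by simpa [NExpr.eval] using ht, fun b hb => ?_⟩, fun _ _ => by simp [NExpr.eval]⟩
        obtain ⟨i, hi⟩ := h3 b hb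
        exact ⟨i, (Hits.frame hf₄ (by simp) (by simp)).2 hi⟩
  · unfold finishTime
    omega

/-- One trial: sample the lines and the first part of the output, and finish. -/
def trial (d : ℕ) : Cmd :=
  .seq (sampleLoop 23 15 (.var 7)) (.seq (makeLines d)
    (.seq (sampleLoop 23 16 (.var 9)) (finish d)))

/-- The surcharge `b` is due on at most a quarter of the samples. -/
theorem sum_inv_mul_le {n N : ℕ} (hn : 0 < n) (f : (Fin N → Fin n) → ℝ≥0∞)
    (bad : Finset (Fin N → Fin n)) {a b : ℝ≥0∞} (hbad : (bad.card : ℝ) ≤ 1 / 4 * (n : ℝ) ^ N)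
    (h : ∀ ω ∉ bad, f ω ≤ a) (h' : ∀ ω, f ω ≤ a + b) :
    ∑ ω, ((n : ℝ≥0∞) ^ N)⁻¹ * f ω ≤ a + b / 4 := by
  classical
  have h1 : ∀ ω, f ω ≤ a + if ω ∈ bad then b else 0 := by
    intro ω
    split_ifs with hω
    · exact h' ω
    · simpa using h ω hω
  have h0 : (n : ℝ≥0∞) ^ N ≠ 0 := by simp [hn.ne']
  have htop : (n : ℝ≥0∞) ^ N ≠ ⊤ := by simp
  have hbad' : ((n : ℝ≥0∞) ^ N)⁻¹ * bad.card ≤ 1 / 4 := by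
    have h2 : bad.card * 4 ≤ n ^ N := by
      have : (bad.card : ℝ) * 4 ≤ (n : ℝ) ^ N := by linarith
      exact_mod_cast this
    rw [mul_comm, ← div_eq_mul_inv, ENNReal.div_le_iff h0 htop, mul_comm, mul_one_div,
      ENNReal.le_div_iff_mul_le (Or.inl (by simp)) (Or.inl (by simp))]
    exact_mod_cast h2
  calc ∑ ω, ((n : ℝ≥0∞) ^ N)⁻¹ * f ω
      ≤ ∑ ω, ((n : ℝ≥0∞) ^ N)⁻¹ * (a + if ω ∈ bad then b else 0) :=
        Finset.sum_le_sum fun ω _ => mul_le_mul_right (h1 ω) _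
    _ = a + ((n : ℝ≥0∞) ^ N)⁻¹ * bad.card * b := by
        rw [← Finset.mul_sum, Finset.sum_add_distrib, mul_add, Finset.sum_const,
          Finset.sum_ite_mem, Finset.sum_const]
        simp only [Finset.univ_inter, Finset.card_univ, Fintype.card_pi_const, Fintype.card_fin,
          nsmul_eq_mul, Nat.cast_pow]
        rw [← mul_assoc, ENNReal.inv_mul_cancel h0 htop, one_mul, mul_assoc]
    _ ≤ a + 1 / 4 * b := by gcongr
    _ = a + b / 4 := by rw [one_div, mul_comm, div_eq_mul_inv]

/-! ### From the memory back to points and boxes -/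

/-- The parameters describe the input. -/
structure Describes {d n m : ℕ} (p : Params) (P : Fin n → BoxNet.Point d)
    (B : Fin m → BoxNet.Box d) : Prop where
  card_points : p.n = n
  card_boxes : p.m = m
  points : ∀ (i : Fin n) (j : Fin d), p.points (i * d + j) = P i j
  lo : ∀ (b : Fin m) (j : Fin d), p.lo (b * d + j) = (B b).lo j
  hi : ∀ (b : Fin m) (j : Fin d), p.hi (b * d + j) = (B b).hi j

/-- Translates the geometry into what `finish_ends` asks for. Heavy boxes have nonempty interiors,
which separates the two ranks in every coordinate, and a box without interior sample points has its
center in `badCenters`. -/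
theorem Describes.good {d n m : ℕ} {p : Params} {P : Fin n → BoxNet.Point d}
    {B : Fin m → BoxNet.Box d} (hp : Describes p P B) {ε : ℝ} (hε : 0 < ε) (hn : 0 < n)
    (hd : 0 < d) {ln : ℕ → ℕ → ℝ} (hD : BoxNet.Dense P (ε / (4 * d)) ln (2 ^ p.H))
    (hB : ∀ b, BoxNet.Heavy P ε (B b)) {S : ℕ} (hS : p.S = S) (ω : Fin S → Fin n) (x : ℕ → ℕ)
    (hx : ∀ l : Fin S, x l = ω l) :
    ∀ b < p.m, (∀ j < d, boxLow d p ln b j < boxHigh d p ln b j) ∧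
        ((∀ i < p.S, ¬ ∀ j < d, 2 * boxLow d p ln b j < samplePos d p ln (x i) j ∧
          samplePos d p ln (x i) j < 2 * boxHigh d p ln b j) →
          (fun j : Fin d => boxCenter d p ln b j) ∈
            BoxNet.badCenters P B ln (2 ^ p.H) (p.H + 2) ω) := by
  intro b hb
  rw [hp.card_boxes] at hb
  have hlow : ∀ j : Fin d, boxLow d p ln b j =
      BoxNet.ltCount (ln j) (2 ^ p.H) ((B ⟨b, hb⟩).lo j) := fun j => by
    rw [boxLow, ← hp.lo ⟨b, hb⟩ j]
  have hhigh : ∀ j : Fin d, boxHigh d p ln b j =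
      BoxNet.leCount (ln j) (2 ^ p.H) ((B ⟨b, hb⟩).hi j) := fun j => by
    rw [boxHigh, ← hp.hi ⟨b, hb⟩ j]
  have hpos : ∀ (i : Fin n) (j : Fin d), samplePos d p ln i j =
      BoxNet.pos (ln j) (2 ^ p.H) (P i j) := fun i j => by
    rw [samplePos, hp.points i j]
  constructor
  · have h1 := BoxNet.le_card_interior P ln (2 ^ p.H) (B ⟨b, hb⟩) hε hn hd hD (hB _)
    have h2 : 0 < (BoxNet.interior P ln (2 ^ p.H) (B ⟨b, hb⟩)).card := by
      have : (0 : ℝ) < ε / 2 * n := by positivity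
      exact_mod_cast this.trans_le h1
    obtain ⟨i, hi⟩ := Finset.card_pos.1 h2
    intro j hj
    have := (Finset.mem_filter.1 hi).2 ⟨j, hj⟩
    rw [hlow ⟨j, hj⟩, hhigh ⟨j, hj⟩]
    omega
  · intro h
    refine Finset.mem_image.2 ⟨⟨b, hb⟩, Finset.mem_filter.2 ⟨Finset.mem_univ _, fun l hl => ?_⟩, ?_⟩
    · refine h l (hS ▸ l.2) fun j hj => ?_
      have := (Finset.mem_filter.1 hl).2 ⟨j, hj⟩
      rw [hx l, hpos (ω l) ⟨j, hj⟩, hlow ⟨j, hj⟩, hhigh ⟨j, hj⟩]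
      exact this
    · funext j
      rw [BoxNet.center, boxCenter, hlow j, hhigh j]

/-! ### Repeated trials -/

/-- A bound on the number of steps of a trial. -/
def trialTime (d : ℕ) (p : Params) : ℕ :=
  2 ^ p.H * 4 + p.S * 4 + (d * (36 * (2 ^ p.H * (p.H + 1)) + 5) + 1) + finishTime d p + 10

/-- Repeat trials until one succeeds. -/
def trials (d : ℕ) : Cmd := .loop (.ltNat (.var 36) (.lit 1)) (trial d)

open Classical in
-- The lines fail in at most a quarter of the cases and, given dense lines, so does the sample. If a
-- restart costs at most `Bd`, a run costs at most `T + 1 + Bd / 4 + Bd / 4`, with `T = trialTime d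
-- p`, and `Bd = 2 * (T + 1)` reproduces itself. Induction on the horizon avoids assuming
-- termination beforehand.
theorem cost_trials_le {d n m : ℕ} {p : Params} {P : Fin n → BoxNet.Point d}
    {B : Fin m → BoxNet.Box d} (hp : Describes p P B) {ε : ℝ} (hε : 0 < ε) (hn : 0 < n)
    (hd : 0 < d) (hB : ∀ b, BoxNet.Heavy P ε (B b)) {e q : ℕ} (hR : p.R = 2 ^ e)
    (he : 1 ≤ ε * 2 ^ e) (hK : 8 * d * 2 ^ e * ((13 + 3 * d) * (e + 1)) ≤ 2 ^ p.H)
    (hq : 2 * (p.H + 2) ^ d * (8 * d * (p.H + 2) ^ d + 1) ^ (2 * d) ≤ 2 ^ q)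
    (hS : 4 * 2 ^ e * q ≤ p.S)
    (hne : ∀ b < p.m, ∀ j < d, p.lo (b * d + j) ≤ p.hi (b * d + j))
    (hW : 2 ^ (p.H + 2) ≤ σ.word) (hW' : p.S + p.m ≤ σ.word)
    (hpost : ∀ s, Holds d p s → s.nat 1 0 ≤ p.S + 5 * p.R →
      (∀ b < p.m, ∃ i, Hits d p s b i) → σ.post s) (t : ℕ) :
    ∀ s, Bounded σ.word s → Holds d p s → s.nat 36 0 = 0 →
      cost σ t ⟨[trials d], s⟩ ≤ 2 * ((trialTime d p : ℝ≥0∞) + 1) := by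
  induction t with
  | zero => intro s _ _ _; simp [cost]
  | succ t ih =>
    intro s hs hH h36
    set Bd : ℝ≥0∞ := 2 * ((trialTime d p : ℝ≥0∞) + 1) with hBd
    -- Here the horizon really has to drop, so that the induction hypothesis covers the restarted
    -- loop.
    have hstep : cost σ (t + 1) ⟨[trials d], s⟩ = 1 + cost σ t ⟨[trial d, trials d], s⟩ := by
      have hstep' : step ⟨[trials d], s⟩ = PMF.pure ⟨[trial d, trials d], s⟩ := by
        simp [trials, step, BExpr.eval, NExpr.eval, h36]
      rw [cost, hstep', weight_running hs,
        tsum_eq_single ⟨[trial d, trials d], s⟩ (fun b hb => by simp [hb])]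
      simp
    -- A rejected trial owes the full bound again, while an accepted one only owes the step that
    -- leaves the loop.
    have hafter : ∀ s', Bounded σ.word s' → Holds d p s' → (s'.nat 36 0 = 0 ∨ s'.nat 36 0 = 1 ∧
        s'.nat 1 0 ≤ p.S + 5 * p.R ∧ ∀ b < p.m, ∃ i, Hits d p s' b i) →
        cost σ t ⟨[trials d], s'⟩ ≤ 1 + Bd ∧
          (s'.nat 36 0 = 1 → cost σ t ⟨[trials d], s'⟩ ≤ 1) := by
      rintro s' hb' hH' (h0 | ⟨h1, h2, h3⟩)
      · exact ⟨(ih s' hb' hH' h0).trans le_add_self, fun h => by omega⟩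
      · have : cost σ t ⟨[trials d], s'⟩ ≤ 1 := by
          refine (cost_loop_exit_le hb' [] t (by simp [BExpr.eval, NExpr.eval, h1])).trans ?_
          rw [cost_halted hb' (hpost s' hH' h2 h3), add_zero]
        exact ⟨this.trans le_self_add, fun _ => this⟩
    have hs1 := Ends.step_le (σ := σ) (p := trial d) (s' := s) (p' := [sampleLoop 23 15 (.var 7),
      .seq (makeLines d) (.seq (sampleLoop 23 16 (.var 9)) (finish d))]) hs (k := [trials d])
      (by simp [trial, step]) t
    obtain ⟨F, hF, hFc⟩ := cost_sampleLoop_le (σ := σ) (i := 23) (a := 15) (n := n) (N := 2 ^ p.H)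
      (Ne := .var 7) (by simp) (by simp) (by simp) hn (by rw [← hp.card_points, ← hH.n]; exact hs 0 0)
      (by rw [← hH.K]; exact hs 7 0) hs (by rw [hH.n, hp.card_points])
      (fun s' hf => by simp [NExpr.eval, hf.nat 7 (by simp), hH.K])
      ([.seq (makeLines d) (.seq (sampleLoop 23 16 (.var 9)) (finish d)), trials d]) t
    set A₂ : ℕ := 1 + (d * (36 * (2 ^ p.H * (p.H + 1)) + 5) + 1) + 1 + (p.S * 4 + 3) +
      (finishTime d p) + 1 with hA₂
    set bad₁ := Finset.univ.filter fun ω : Fin (2 ^ p.H) → Fin n => ¬ ∀ (j : Fin d) (a y : ℝ),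
      ε / (4 * d) * n ≤ ((Finset.univ.filter fun i => a ≤ P i j ∧ P i j ≤ y).card : ℝ) →
      ∃ l, a ≤ P (ω l) j ∧ P (ω l) j ≤ y with hbad₁
    -- The first bound charges a certain restart; its superfluous `Bd / 4` gives it the form `a + b`
    -- needed for averaging over the lines.
    have hinner : ∀ ω, cost σ t ⟨[.seq (makeLines d) (.seq (sampleLoop 23 16 (.var 9)) (finish d)),
        trials d], F ω⟩ ≤ (A₂ + Bd / 4) + Bd ∧ (ω ∉ bad₁ →
        cost σ t ⟨[.seq (makeLines d) (.seq (sampleLoop 23 16 (.var 9)) (finish d)),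
        trials d], F ω⟩ ≤ A₂ + Bd / 4) := by
      intro ω
      obtain ⟨hb₁, hf₁, h15⟩ := hF ω
      have hH₁ := hH.frame hf₁ (by simp) (by simp)
      have hc1 := Ends.step_le (σ := σ)
        (p := .seq (makeLines d) (.seq (sampleLoop 23 16 (.var 9)) (finish d)))
        (s' := F ω) (p' := [makeLines d, .seq (sampleLoop 23 16 (.var 9)) (finish d)]) hb₁
        (k := [trials d]) (by simp [step]) t
      obtain ⟨s₂, hb₂, ⟨hf₂, ln, hL, hsurj⟩, hc2⟩ := makeLines_ends (σ := σ) hH₁ hb₁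
        [.seq (sampleLoop 23 16 (.var 9)) (finish d), trials d] t
      have hge : ∀ a ∈ lineArrays d, 4 ≤ a := by
        intro a ha
        simp only [lineArrays, List.mem_cons, List.mem_map] at ha
        omega
      have hH₂ := hH₁.frame hf₂ (by simp) hge
      have hc3 := Ends.step_le (σ := σ) (p := .seq (sampleLoop 23 16 (.var 9)) (finish d))
        (s' := s₂) (p' := [sampleLoop 23 16 (.var 9), finish d]) hb₂
        (k := [trials d]) (by simp [step]) t
      obtain ⟨F₂, hF₂, hFc₂⟩ := cost_sampleLoop_le (σ := σ) (i := 23) (a := 16) (n := n) (N := p.S)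
        (Ne := .var 9) (by simp) (by simp) (by simp) hn (by rw [← hp.card_points, ← hH.n]; exact hs 0 0)
        (by omega) hb₂ (by rw [hH₂.n, hp.card_points])
        (fun s' hf => by simp [NExpr.eval, hf.nat 9 (by simp), hH₂.S])
        [finish d, trials d] t
      set bad₂ := Finset.univ.filter fun ω : Fin p.S → Fin n =>
        5 * 2 ^ e < (BoxNet.badCenters P B ln (2 ^ p.H) (p.H + 2) ω).card with hbad₂
      have hlast : ∀ ω₂, cost σ t ⟨[finish d, trials d], F₂ ω₂⟩ ≤ (finishTime d p + 1 : ℕ) + Bd ∧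
          (BoxNet.Dense P (ε / (4 * d)) ln (2 ^ p.H) → ω₂ ∉ bad₂ →
            cost σ t ⟨[finish d, trials d], F₂ ω₂⟩ ≤ (finishTime d p + 1 : ℕ)) := by
        intro ω₂
        obtain ⟨hb₃, hf₃, h16⟩ := hF₂ ω₂
        have hH₃ := hH₂.frame hf₃ (by simp) (by simp)
        have h36₃ : (F₂ ω₂).nat 36 0 = 0 := by
          rw [hf₃.nat 36 (by simp), hf₂.nat 36 (by simp), hf₁.nat 36 (by simp), h36]
        obtain ⟨s₄, hb₄, ⟨hH₄, hdone, hgood⟩, hc4⟩ := finish_ends (σ := σ) hH₃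
          (hL.frame hf₃ (by simp)) h36₃ hne hW hW'
          (BoxNet.badCenters P B ln (2 ^ p.H) (p.H + 2) ω₂) hb₃ [trials d] t
        obtain ⟨ha1, ha2⟩ := hafter s₄ hb₄ hH₄ hdone
        refine ⟨hc4.trans ?_, fun hD hω₂ => hc4.trans ?_⟩
        · push_cast
          rw [add_assoc]
          gcongr
        · push_cast
          gcongr
          refine ha2 (hgood ?_ (hp.good hε hn hd hD hB rfl ω₂ _ h16))
          rw [hR]
          simpa [bad₂] using hω₂
      have hcomb : ∀ c, (∑ ω₂, ((n : ℝ≥0∞) ^ p.S)⁻¹ * cost σ t ⟨[finish d, trials d], F₂ ω₂⟩ ≤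
          (finishTime d p + 1 : ℕ) + c) →
          cost σ t ⟨[.seq (makeLines d) (.seq (sampleLoop 23 16 (.var 9)) (finish d)),
            trials d], F ω⟩ ≤ A₂ + c := by
        intro c hc
        refine (hc1.trans (add_le_add_right (hc2.trans (add_le_add_right (hc3.trans
          (add_le_add_right (hFc₂.trans (add_le_add_right hc _)) _)) _)) _)).trans (le_of_eq ?_)
        rw [hA₂]
        push_cast
        ring
      have hn0 : (n : ℝ≥0∞) ^ p.S ≠ 0 := by simp [hn.ne']
      constructor
      · rw [add_assoc]
        refine hcomb _ ?_
        have h0 := sum_inv_mul_le hn (fun ω₂ => cost σ t ⟨[finish d, trials d], F₂ ω₂⟩) ∅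
          (a := (finishTime d p + 1 : ℕ) + Bd) (b := 0) (by simp)
          (fun ω₂ _ => (hlast ω₂).1) (fun ω₂ => by simpa using (hlast ω₂).1)
        refine h0.trans ?_
        simp only [ENNReal.zero_div, add_zero]
        gcongr
        exact le_add_self
      · intro hω
        have hD : BoxNet.Dense P (ε / (4 * d)) ln (2 ^ p.H) := by
          intro j a y hc
          simp only [bad₁, Finset.mem_filter, Finset.mem_univ, true_and, not_not] at hω
          obtain ⟨l, hl1, hl2⟩ := hω j a y hc
          obtain ⟨g, hg, he⟩ := hsurj j j.2 l l.2
          rw [h15 l, hp.points (ω l) j] at he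
          exact ⟨g, hg, by rw [he]; exact hl1, by rw [he]; exact hl2⟩
        refine hcomb _ (sum_inv_mul_le hn _ bad₂ ?_ (fun ω₂ h => (hlast ω₂).2 hD h)
          fun ω₂ => (hlast ω₂).1)
        have := BoxNet.card_many_badCenters_le P B ln hε hn hd (G := p.H + 2) (S := p.S)
          (by omega) he (Nat.pow_lt_pow_right (by norm_num) (by omega)) hD hB hq hS
        convert this
    have hout := sum_inv_mul_le hn _ bad₁ (by
      have := BoxNet.card_not_dense_le P hε hn hd he hK
      convert this) (fun ω h => (hinner ω).2 h) fun ω => (hinner ω).1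
    rw [hstep]
    refine (add_le_add_right (hs1.trans (add_le_add_right (hFc.trans
      (add_le_add_right hout _)) _)) _).trans ?_
    have hfour : Bd / 4 + Bd / 4 = trialTime d p + 1 := by
      rw [hBd, ← ENNReal.add_div, ← two_mul, ← mul_assoc, show (2 : ℝ≥0∞) * 2 = 4 by norm_num,
        mul_comm, ENNReal.mul_div_cancel_right (by simp) (by simp)]
    have hA : 1 + (1 + (2 ^ p.H * 4 + 3 + A₂)) ≤ trialTime d p + 1 := by
      rw [hA₂, trialTime]
      omega
    calc 1 + (1 + (((2 ^ p.H * 4 + 3 : ℕ) : ℝ≥0∞) + (A₂ + Bd / 4 + Bd / 4)))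
        = ((1 + (1 + (2 ^ p.H * 4 + 3 + A₂)) : ℕ) : ℝ≥0∞) + (Bd / 4 + Bd / 4) := by
          push_cast
          ring
      _ ≤ ((trialTime d p + 1 : ℕ) : ℝ≥0∞) + (trialTime d p + 1) := by
          rw [hfour]
          gcongr
      _ = Bd := by
          rw [hBd]
          push_cast
          ring

end RealRAM

namespace RealRAM

/-! ### The choice of the parameters -/

/-- `2 ^ e` is about `ε⁻¹` (unless this exceeds `m`) and `2 ^ u` is about `e`. -/
structure Scales (m : ℕ) (ε : ℝ) (e u : ℕ) : Prop where
  pred_le : e = 0 ∨ 2 ^ (e - 1) * ε < 1 ∧ 2 ^ (e - 1) ≤ m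
  lt_of_lt : 2 ^ e * ε < 1 → m < 2 ^ e
  pred_lt : u = 0 ∨ 2 ^ (u - 1) < e + 1
  le_pow : e + 1 ≤ 2 ^ u

/-- The logarithm of the number of lines over `2 ^ (e + u)`. -/
def extra (d : ℕ) : ℕ := 2 * d + 7

/-- The factor in the size of the sample. -/
def sampleFactor (d : ℕ) : ℕ := 1 + (d + 4) * d + 2 * d * (d + 4) + 2 * (d + 4) * d ^ 2

/-- The size of the sample. -/
def sampleSize (d e u : ℕ) : ℕ := 4 * 2 ^ e * (sampleFactor d * (u + 1))

namespace Scales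

variable {m e u d : ℕ} {ε : ℝ}

/-- The doubling stops as soon as `m` is exceeded, so `2 ^ e` is controlled by `m` however small `ε`
is. The word bounds rest on this. -/
theorem pow_le (h : Scales m ε e u) (hm : 1 ≤ m) : 2 ^ e ≤ 2 * m := by
  rcases h.pred_le with rfl | ⟨-, h⟩
  · omega
  · rcases e with _ | e
    · omega
    · rw [Nat.add_sub_cancel] at h
      rw [pow_succ]
      omega

theorem le_card (h : Scales m ε e u) : e ≤ m := by
  rcases h.pred_le with rfl | ⟨-, h⟩
  · omega
  · have := Nat.lt_two_pow_self (n := e - 1)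
    omega

theorem pow_log_le (h : Scales m ε e u) : 2 ^ u ≤ 2 * (e + 1) := by
  rcases h.pred_lt with rfl | h
  · omega
  · rcases u with _ | u
    · omega
    · rw [Nat.add_sub_cancel] at h
      rw [pow_succ]
      omega

theorem log_le (h : Scales m ε e u) : u ≤ e := by
  rcases h.pred_lt with rfl | h
  · omega
  · have := Nat.lt_two_pow_self (n := u - 1)
    omega

theorem height_le (h : Scales m ε e u) : e + u + extra d + 2 ≤ (2 * d + 11) * (e + 1) := by
  have := h.log_le
  unfold extra
  nlinarith

/-- `2 ^ u` pays for the factor `e + 1` and `2 ^ extra d = 128 * 4 ^ d` for the constants, so `2 ^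
H` lines are enough for density. -/
theorem mul_le_pow (h : Scales m ε e u) :
    8 * d * 2 ^ e * ((13 + 3 * d) * (e + 1)) ≤ 2 ^ (e + u + extra d) := by
  have hd : 8 * d * (13 + 3 * d) ≤ 2 ^ extra d := by
    have h1 : d + 1 ≤ 2 ^ d := Nat.lt_two_pow_self
    have h2 : 2 ^ extra d = 128 * (2 ^ d * 2 ^ d) := by
      rw [extra, pow_add, two_mul, pow_add]
      ring
    rw [h2]
    nlinarith [Nat.mul_le_mul h1 h1]
  calc 8 * d * 2 ^ e * ((13 + 3 * d) * (e + 1)) = 2 ^ e * (e + 1) * (8 * d * (13 + 3 * d)) := by ring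
    _ ≤ 2 ^ e * 2 ^ u * 2 ^ extra d := by
        gcongr
        exact h.le_pow
    _ = 2 ^ (e + u + extra d) := by rw [pow_add, pow_add]

/-- The number of levels is at most `2 ^ ((d + 4) * (u + 1))`, so a polynomial in it has a logarithm
linear in `u + 1`, and `sampleFactor` collects the exponents. This is where log log ε⁻¹ comes from,
as `2 ^ u` is about `e`. -/
theorem sample_le_pow (h : Scales m ε e u) :
    2 * (e + u + extra d + 2) ^ d * (8 * d * (e + u + extra d + 2) ^ d + 1) ^ (2 * d) ≤
      2 ^ (sampleFactor d * (u + 1)) := by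
  have hd : d + 1 ≤ 2 ^ d := Nat.lt_two_pow_self
  set a := (d + 4) * (u + 1) with ha
  have hG : e + u + extra d + 2 ≤ 2 ^ a := by
    calc e + u + extra d + 2 ≤ 2 ^ u * 2 ^ (d + 4) := by
          have h1 := h.le_pow
          have h2 : u < 2 ^ u := Nat.lt_two_pow_self
          unfold extra
          rw [pow_add]
          nlinarith
      _ = 2 ^ (u + (d + 4)) := (pow_add _ _ _).symm
      _ ≤ 2 ^ a := Nat.pow_le_pow_right (by norm_num) (by rw [ha]; nlinarith)
  have hGd : (e + u + extra d + 2) ^ d ≤ 2 ^ (a * d) := by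
    rw [pow_mul]
    exact Nat.pow_le_pow_left hG d
  have h9 : 8 * d * (e + u + extra d + 2) ^ d + 1 ≤ 2 ^ (d + 4 + a * d) := by
    have : 8 * d + 1 ≤ 2 ^ (d + 4) := by
      rw [pow_add]
      omega
    calc 8 * d * (e + u + extra d + 2) ^ d + 1 ≤ 8 * d * 2 ^ (a * d) + 2 ^ (a * d) := by
          gcongr
          exact Nat.one_le_two_pow
      _ = (8 * d + 1) * 2 ^ (a * d) := by ring
      _ ≤ 2 ^ (d + 4) * 2 ^ (a * d) := by gcongr
      _ = 2 ^ (d + 4 + a * d) := by rw [← pow_add]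
  calc _ ≤ 2 * 2 ^ (a * d) * (2 ^ (d + 4 + a * d)) ^ (2 * d) := by gcongr
    _ = 2 ^ (1 + a * d + (d + 4 + a * d) * (2 * d)) := by
        rw [← pow_mul, pow_add _ _ ((d + 4 + a * d) * (2 * d)), pow_add, pow_one]
    _ ≤ 2 ^ (sampleFactor d * (u + 1)) := by
        refine Nat.pow_le_pow_right (by norm_num) ?_
        rw [ha, sampleFactor]
        have : 0 ≤ 2 * d * (d + 4) * u + u := Nat.zero_le _
        nlinarith

theorem sampleSize_add_le (h : Scales m ε e u) (hm : 1 ≤ m) {y : ℕ} (hy : m + 2 ≤ y) :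
    sampleSize d e u + m ≤ y ^ (8 + sampleFactor d) := by
  have hy2 : 2 ≤ y := by omega
  have h1 : 2 ^ e ≤ y ^ 2 := (h.pow_le hm).trans (by nlinarith)
  have h2 : u + 1 ≤ y ^ 2 := by
    have := h.log_le
    have := h.le_card
    nlinarith
  have h3 : sampleFactor d ≤ y ^ sampleFactor d := (Nat.lt_pow_self hy2).le
  have h4 : m ≤ y ^ (7 + sampleFactor d) := by
    calc m ≤ y ^ 1 := by rw [pow_one]; omega
      _ ≤ _ := Nat.pow_le_pow_right (by omega) (by omega)
  have h5 : sampleSize d e u ≤ y ^ (7 + sampleFactor d) := by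
    calc sampleSize d e u ≤ y ^ 2 * y ^ 2 * (y ^ sampleFactor d * y ^ 2) := by
          unfold sampleSize
          gcongr
          nlinarith
      _ = y ^ (6 + sampleFactor d) := by ring
      _ ≤ _ := Nat.pow_le_pow_right (by omega) (by omega)
  calc sampleSize d e u + m ≤ 2 * y ^ (7 + sampleFactor d) := by omega
    _ ≤ y * y ^ (7 + sampleFactor d) := by gcongr
    _ = _ := by ring

theorem pow_height_le (h : Scales m ε e u) (hm : 1 ≤ m) {y : ℕ} (hy : m + 2 ≤ y) :
    2 ^ (e + u + extra d + 2) ≤ y ^ (7 + extra d) := by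
  have hy2 : 2 ≤ y := by omega
  have h1 : 2 ^ e ≤ y ^ 2 := (h.pow_le hm).trans (by nlinarith)
  have h2 : 2 ^ u ≤ y ^ 3 := by
    have h3 := h.pow_log_le
    have h4 := h.le_card
    calc 2 ^ u ≤ 2 * y := by omega
      _ ≤ y * y := by gcongr
      _ ≤ y ^ 3 := by rw [← pow_two]; exact Nat.pow_le_pow_right (by omega) (by omega)
  calc 2 ^ (e + u + extra d + 2) = 2 ^ e * 2 ^ u * 2 ^ extra d * 2 ^ 2 := by
        rw [pow_add, pow_add, pow_add]
    _ ≤ y ^ 2 * y ^ 3 * y ^ extra d * y ^ 2 := by gcongr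
    _ = y ^ (7 + extra d) := by ring

/-- The exponent in the bound for words. -/
def _root_.RealRAM.wordExponent (d : ℕ) : ℕ := (7 + extra d) * (d + 1) + (8 + sampleFactor d)

theorem word_bounds (h : Scales m ε e u) (hm : 1 ≤ m) {y : ℕ} (hy : m + 2 ≤ y) :
    2 ^ (e + u + extra d + 2) ≤ y ^ wordExponent d ∧
    (e + u + extra d + 2) ^ d ≤ y ^ wordExponent d ∧
    sampleSize d e u + m ≤ y ^ wordExponent d := by
  have hM := h.pow_height_le (d := d) hm hy
  refine ⟨hM.trans (Nat.pow_le_pow_right (by omega) ?_), ?_,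
    (h.sampleSize_add_le hm hy).trans (Nat.pow_le_pow_right (by omega) ?_)⟩
  · unfold wordExponent
    nlinarith
  · calc (e + u + extra d + 2) ^ d ≤ (y ^ (7 + extra d)) ^ d :=
          Nat.pow_le_pow_left (Nat.lt_two_pow_self.le.trans hM) d
      _ = y ^ ((7 + extra d) * d) := by rw [pow_mul]
      _ ≤ _ := Nat.pow_le_pow_right (by omega) (by unfold wordExponent; nlinarith)
  · unfold wordExponent
    omega

theorem pow_le_inv (h : Scales m ε e u) (hε : 0 < ε) (hε1 : ε < 1) : (2 : ℝ) ^ e ≤ 2 * ε⁻¹ := by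
  have h1 : 1 ≤ ε⁻¹ := (one_le_inv₀ hε).2 hε1.le
  rcases h.pred_le with rfl | ⟨h, -⟩
  · simp only [pow_zero]
    linarith
  · rcases e with _ | e
    · simp only [pow_zero]
      linarith
    · rw [Nat.add_sub_cancel] at h
      have h2 : (2 : ℝ) ^ e ≤ ε⁻¹ := by
        rw [← one_div, le_div_iff₀ hε]
        exact h.le
      rw [pow_succ]
      linarith

theorem add_one_le_lg (h : Scales m ε e u) (hε : 0 < ε) : ((e : ℝ) + 1) ≤ 4 * BoxNet.lg ε := by
  have h1 : 1 ≤ BoxNet.lg ε := le_max_left _ _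
  rcases h.pred_le with rfl | ⟨h, -⟩
  · norm_num
    linarith
  · rcases e with _ | e
    · norm_num
      linarith
    · rw [Nat.add_sub_cancel] at h
      have h2 : (2 : ℝ) ^ e ≤ ε⁻¹ := by
        rw [← one_div, le_div_iff₀ hε]
        exact h.le
      have h3 : (e : ℝ) * Real.log 2 ≤ BoxNet.lg ε := by
        rw [← Real.log_pow]
        exact (Real.log_le_log (by positivity) h2).trans (le_max_right _ _)
      have h4 := Real.log_two_gt_d9
      push_cast
      nlinarith [(Nat.cast_nonneg e : (0 : ℝ) ≤ e)]

/-- Taking logarithms in `2 ^ u ≤ 8 * lg ε` gives `u` up to constants; truncating at `1` is harmless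
because `log (lg ε) ≤ lglg ε` in both cases. -/
theorem add_one_le_lglg (h : Scales m ε e u) (hε : 0 < ε) : ((u : ℝ) + 1) ≤ 6 * BoxNet.lglg ε := by
  have h1 : 1 ≤ BoxNet.lglg ε := le_max_left _ _
  have h0 : 1 ≤ BoxNet.lg ε := le_max_left _ _
  have h2 : ((2 : ℝ) ^ u) ≤ 8 * BoxNet.lg ε := by
    have h3 : ((2 ^ u : ℕ) : ℝ) ≤ ((2 * (e + 1) : ℕ) : ℝ) := by exact_mod_cast h.pow_log_le
    push_cast at h3
    have := h.add_one_le_lg hε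
    linarith
  have h3 : Real.log (BoxNet.lg ε) ≤ BoxNet.lglg ε := by
    rcases le_total (Real.log ε⁻¹) 1 with h4 | h4
    · rw [BoxNet.lg, max_eq_left h4, Real.log_one]
      linarith
    · rw [BoxNet.lg, max_eq_right h4]
      exact le_max_right _ _
  have h4 : (u : ℝ) * Real.log 2 ≤ 3 * Real.log 2 + Real.log (BoxNet.lg ε) := by
    have h5 : (3 : ℝ) * Real.log 2 = Real.log 8 := by
      rw [show (8 : ℝ) = 2 ^ 3 by norm_num, Real.log_pow]
      norm_num
    rw [h5, ← Real.log_mul (by norm_num) (by linarith), ← Real.log_pow]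
    exact Real.log_le_log (by positivity) h2
  have h5 := Real.log_two_gt_d9
  nlinarith

theorem size_le (h : Scales m ε e u) (hε : 0 < ε) (hε1 : ε < 1) :
    ((sampleSize d e u + 5 * 2 ^ e : ℕ) : ℝ) ≤
      (48 * sampleFactor d + 10) * (ε⁻¹ * BoxNet.lglg ε) := by
  have h1 := h.pow_le_inv hε hε1
  have h2 := h.add_one_le_lglg hε
  have h3 : 1 ≤ BoxNet.lglg ε := le_max_left _ _
  have h4 : 0 < ε⁻¹ := inv_pos.2 hε
  unfold sampleSize
  push_cast
  calc 4 * (2 : ℝ) ^ e * (sampleFactor d * (u + 1)) + 5 * 2 ^ e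
      ≤ 4 * (2 * ε⁻¹) * (sampleFactor d * (6 * BoxNet.lglg ε)) +
        5 * (2 * ε⁻¹ * BoxNet.lglg ε) := by
        gcongr
        nlinarith
    _ = _ := by ring

/-- The factor in the time of a trial. -/
def _root_.RealRAM.timeFactor (d : ℕ) : ℕ :=
  36 * d * (4 * 2 ^ extra d * (2 * d + 11)) + 16 * 2 ^ extra d * (2 * d + 11) +
    (2 * d + 11) ^ d * (3 * 2 ^ d + 43 * d + 12) + 25 * d + 68

/-- `d ≥ 2` matters for sorting: `2 ^ H * (H + 1)` is of order `2 ^ e * (e + 1) ^ 2`, which `m * (e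
+ 1) ^ d` covers. All other work is of order `(H + 2) ^ d` per box or sample point, and there are
fewer than `m` sample points. -/
theorem trialTime_le (h : Scales m ε e u) (hd : 2 ≤ d) {p : Params}
    (hH : p.H = e + u + extra d) (hp : p.m = m) (hS : p.S < m) (he : 2 ^ e ≤ m) :
    trialTime d p ≤ timeFactor d * (m * (e + 1) ^ d) := by
  set E := (e + 1) ^ d with hE
  set c := (2 * d + 11) ^ d with hc
  set k := 4 * 2 ^ extra d * (2 * d + 11) with hk
  have hE1 : 1 ≤ E := Nat.one_le_pow _ _ (by omega)
  have hG := h.height_le (d := d)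
  rw [← hH] at hG
  have hT : (p.H + 2) ^ d ≤ c * E := by
    rw [hc, hE, ← mul_pow]
    exact Nat.pow_le_pow_left hG d
  have hGc : p.H + 2 ≤ c * E := by
    refine le_trans ?_ hT
    calc p.H + 2 = (p.H + 2) ^ 1 := (pow_one _).symm
      _ ≤ _ := Nat.pow_le_pow_right (by omega) (by omega)
  have hE2 : (e + 1) ^ 2 ≤ E := Nat.pow_le_pow_right (by omega) hd
  have hKG : 2 ^ p.H * (p.H + 1) ≤ k * (m * E) := by
    calc 2 ^ p.H * (p.H + 1) ≤ (2 ^ e * 2 ^ u * 2 ^ extra d) * (p.H + 2) := by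
          rw [hH, pow_add, pow_add]
          gcongr
          omega
      _ ≤ (m * (2 * (e + 1)) * 2 ^ extra d) * ((2 * d + 11) * (e + 1)) := by
          gcongr
          exact h.pow_log_le
      _ = 2 * 2 ^ extra d * (2 * d + 11) * (m * (e + 1) ^ 2) := by ring
      _ ≤ k * (m * E) := by
          rw [hk]
          gcongr
          omega
  have hK : 2 ^ p.H ≤ k * (m * E) := le_trans (Nat.le_mul_of_pos_right _ (by omega)) hKG
  have hA : d * (20 * (p.H + 2) + 8) + (p.H + 2) ^ d * 4 + 8 ≤
      (c * (20 * d + 4) + 8 * d + 8) * E := by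
    calc _ ≤ d * (20 * (c * E) + 8 * E) + c * E * 4 + 8 * E := by gcongr <;> omega
      _ = _ := by ring
  have hB : d * (20 * (p.H + 2) + 6) + (p.H + 2) ^ d * (2 ^ d * 3 + 4) +
      (p.H + 2) * (d * 3 + 4) + d * 6 + 33 ≤
      (c * (3 * 2 ^ d + 23 * d + 8) + 12 * d + 33) * E := by
    calc _ ≤ d * (20 * (c * E) + 6 * E) + c * E * (2 ^ d * 3 + 4) +
          c * E * (d * 3 + 4) + d * (6 * E) + 33 * E := by gcongr <;> omega
      _ = _ := by ring
  have hX : m ≤ m * E := Nat.le_mul_of_pos_right _ hE1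
  have hX1 : 1 ≤ m * E := by omega
  unfold trialTime finishTime
  rw [hp]
  calc _ ≤ k * (m * E) * 4 + m * E * 4 + (d * (36 * (k * (m * E)) + 5 * (m * E)) + 1 * (m * E)) +
        (m * ((c * (20 * d + 4) + 8 * d + 8) * E) +
          m * ((c * (3 * 2 ^ d + 23 * d + 8) + 12 * d + 33) * E) + 12 * (m * E)) +
        10 * (m * E) := by
        gcongr <;> omega
    _ = timeFactor d * (m * E) := by
        rw [timeFactor, hk, hc]
        ring

end Scales

end RealRAM

namespace RealRAM

variable {σ : Goal}

theorem Ends.seq_le {p q : Cmd} {s : State} {T T₁ T₂ : ℕ} {Q Q₁ : State → Prop}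
    (hT : T₁ + T₂ + 1 ≤ T) (hp : Ends σ p s T₁ Q₁)
    (hq : ∀ s', Bounded σ.word s' → Q₁ s' → Ends σ q s' T₂ Q) : Ends σ (.seq p q) s T Q :=
  (Ends.seq hp hq).mono hT fun _ _ h => h

/-! ### Computing the parameters -/

/-- Find the least power of two that fails a test. -/
def doubling (a b : ℕ) (test : BExpr) : Cmd :=
  .seq (.assign a (.lit 1)) (.seq (.assign b (.lit 0))
    (.loop test (.seq (.assign a (.mul (.lit 2) (.var a))) (.assign b (.add (.var b) (.lit 1))))))

/-- The last value that passed the test and the first that failed are both kept: the former bounds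
the scale from above, the latter from below. -/
theorem doubling_ends {a b : ℕ} {test : BExpr} {s : State} (hab : a ≠ b) (pr : ℕ → Prop) (N : ℕ)
    (htest : ∀ s', Frame [a, b] [] s s' → (test.eval s' ↔ pr (s'.nat a 0))) (hN : ¬ pr (2 ^ N))
    (h1 : 1 ≤ σ.word) (hW : ∀ v, pr v → 2 * v ≤ σ.word) :
    Ends σ (doubling a b test) s (N * 4 + 5) (fun s' => Frame [a, b] [] s s' ∧
      ∃ q ≤ N, s'.nat a 0 = 2 ^ q ∧ s'.nat b 0 = q ∧ (q = 0 ∨ pr (2 ^ (q - 1))) ∧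
        ¬ pr (2 ^ q)) := by
  refine (Ends.seq (T₁ := 1) (T₂ := 1 + (N * (1 + 1 + 1 + 1) + 1) + 1) (Ends.setNat
    (Q := fun s' => Frame [a, b] [] s s' ∧ s'.nat a 0 = 1) (fun _ => by simpa [NExpr.eval])
    ⟨(Frame.refl _ _ _).writeNat (by simp), by simp [NExpr.eval]⟩) fun s₁ _ h₁ =>
    Ends.seq (T₁ := 1) (T₂ := N * (1 + 1 + 1 + 1) + 1) (Ends.setNat
    (Q := fun s' => Frame [a, b] [] s s' ∧ s'.nat a 0 = 1 ∧ s'.nat b 0 = 0)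
    (fun _ => by simp [NExpr.eval])
    ⟨h₁.1.writeNat (by simp), by simp [NExpr.eval, hab, h₁.2], by simp [NExpr.eval]⟩)
    fun s₂ _ h₂ => (Ends.loop (T := 1 + 1 + 1) (fun q s' => Frame [a, b] [] s s' ∧
      s'.nat a 0 = 2 ^ q ∧ s'.nat b 0 = q ∧ (q = 0 ∨ pr (2 ^ (q - 1)))) N ?_ ?_
      ⟨h₂.1, by simpa using h₂.2.1, h₂.2.2, Or.inl rfl⟩).mono le_rfl ?_).mono (by omega)
    fun _ _ h => h
  · rintro q hq s' - ⟨hf, ha, hb, -⟩ ht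
    rw [htest s' hf, ha] at ht
    have hw := hW _ ht
    refine Ends.seq (Ends.setNat (Q := fun s'' => Frame [a, b] [] s s'' ∧
      s''.nat a 0 = 2 ^ (q + 1) ∧ s''.nat b 0 = q) (fun _ => by simpa [NExpr.eval, ha])
      ⟨hf.writeNat (by simp), ?_, ?_⟩) fun s'' _ h => Ends.setNat ?_ ⟨h.1.writeNat (by simp), ?_,
        ?_, Or.inr (by simpa using ht)⟩
    · simp [NExpr.eval, ha, pow_succ, mul_comm]
    · simp [NExpr.eval, hb, hab.symm]
    · intro _
      have : q < 2 ^ q := Nat.lt_two_pow_self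
      simp only [NExpr.eval, h.2.2]
      omega
    · simp [NExpr.eval, hab, h.2.1]
    · simp [NExpr.eval, h.2.2]
  · rintro s' - ⟨hf, ha, -, -⟩
    rw [htest s' hf, ha]
    exact hN
  · rintro s' - ⟨q, hq, ⟨hf, ha, hb, h⟩, ht⟩
    rw [htest s' hf, ha] at ht
    exact ⟨hf, q, hq, ha, hb, h, ht⟩

/-- The table of the powers of two. -/
def makePowers : Cmd :=
  .seq (.setNat 11 (.lit 0) (.lit 1)) (forLoop 37 (.var 6)
    (.setNat 11 (.add (.var 37) (.lit 1)) (.mul (.lit 2) (.get 11 (.var 37)))))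

/-- Expressions have no variable exponents, so dyadic levels are handled by dividing by tabulated
powers. -/
theorem makePowers_ends {s : State} {G : ℕ} (hG : s.nat 6 0 = G) (hW : 2 ^ G ≤ σ.word) :
    Ends σ makePowers s (G * 4 + 5) (fun s' => Frame [11, 37] [] s s' ∧
      ∀ h < G, s'.nat 11 h = 2 ^ h) := by
  have h1 : 1 ≤ σ.word := Nat.one_le_two_pow.trans hW
  refine (Ends.seq (T₁ := 1) (T₂ := G * (1 + 3) + 3) (Ends.setNat
    (Q := fun s' => Frame [11, 37] [] s s' ∧ s'.nat 11 0 = 1) (fun _ => by simpa [NExpr.eval])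
    ⟨(Frame.refl _ _ _).writeNat (by simp), by simp [NExpr.eval]⟩) fun s₁ _ h₁ =>
    (Ends.forLoop (fun q s' => Frame [11, 37] [] s s' ∧ ∀ h ≤ q, s'.nat 11 h = 2 ^ h) G
      (Nat.lt_two_pow_self.le.trans hW) ?_ ?_ ?_).mono le_rfl ?_).mono (by omega) fun _ _ h => h
  · rintro q - s' ⟨hf, -⟩
    simp [NExpr.eval, hf.nat 6 (by simp), hG]
  · refine ⟨h₁.1.writeNat (by simp), fun h hh => ?_⟩
    obtain rfl : h = 0 := by omega
    simp [h₁.2]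
  · rintro q hq s' - ⟨hf, h⟩ h37
    refine Ends.setNat ?_ ⟨by simp [h37], (hf.writeNat (by simp)).writeNat (by simp), ?_⟩
    · intro _
      simp only [NExpr.eval, h37, h q le_rfl]
      rw [← pow_succ']
      exact (Nat.pow_le_pow_right (by norm_num) hq).trans hW
    · intro l hl
      rcases (show l ≤ q ∨ l = q + 1 by omega) with h' | rfl
      · simp [NExpr.eval, h37, h l h', show l ≠ q + 1 by omega]
      · simp [NExpr.eval, h37, h q le_rfl, pow_succ']
  · rintro s' - ⟨⟨hf, h⟩, -⟩
    exact ⟨hf, fun l hl => h l hl.le⟩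

/-- Compute the parameters that depend on the two scales. -/
def tables (d : ℕ) : Cmd :=
  .seq (.assign 6 (.add (.add (.var 3) (.var 5)) (.lit (extra d + 2))))
  (.seq (.assign 7 (.mul (.mul (.var 2) (.var 4)) (.lit (2 ^ extra d))))
  (.seq (.assign 8 (.mul (.lit 4) (.var 7)))
  (.seq (.assign 9 (.mul (.mul (.lit 4) (.var 2))
    (.mul (.lit (sampleFactor d)) (.add (.var 5) (.lit 1)))))
  (.seq (.assign 10 (powExpr (.var 6) d)) makePowers))))

theorem tables_ends {d e u : ℕ} {s : State} (h2 : s.nat 2 0 = 2 ^ e) (h3 : s.nat 3 0 = e)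
    (h4 : s.nat 4 0 = 2 ^ u) (h5 : s.nat 5 0 = u) (hM : 2 ^ (e + u + extra d + 2) ≤ σ.word)
    (hT : (e + u + extra d + 2) ^ d ≤ σ.word) (hS : sampleSize d e u ≤ σ.word) :
    Ends σ (tables d) s ((e + u + extra d + 2) * 4 + 15) (fun s' =>
      Frame [6, 7, 8, 9, 10, 11, 37] [] s s' ∧ s'.nat 6 0 = e + u + extra d + 2 ∧
      s'.nat 7 0 = 2 ^ (e + u + extra d) ∧ s'.nat 8 0 = 2 ^ (e + u + extra d + 2) ∧
      s'.nat 9 0 = sampleSize d e u ∧ s'.nat 10 0 = (e + u + extra d + 2) ^ d ∧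
      ∀ h < e + u + extra d + 2, s'.nat 11 h = 2 ^ h) := by
  obtain ⟨G, hG⟩ : ∃ G, e + u + extra d + 2 = G := ⟨_, rfl⟩
  have hM' : 2 ^ (e + u + extra d + 2) = 4 * 2 ^ (e + u + extra d) := by
    rw [pow_add _ _ 2, mul_comm]
    norm_num
  obtain ⟨L, hL⟩ : ∃ L, 2 ^ (e + u + extra d) = L := ⟨_, rfl⟩
  have hL' : 2 ^ e * 2 ^ u * 2 ^ extra d = L := by rw [← hL, pow_add, pow_add]
  have hMG : 2 ^ G ≤ σ.word := hG ▸ hM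
  have hML : 4 * L ≤ σ.word := by rwa [← hL, ← hM']
  rw [hG] at hT
  rw [hM', hL, hG]
  refine Ends.seq_le (T₁ := 1) (T₂ := G * 4 + 13) (by omega) (Ends.setNat (Q := fun s' =>
    s' = s.writeNat 6 0 G) (fun _ => ?_) ?_) fun s₁ _ e₁ => ?_
  · simp only [NExpr.eval, h3, h5]
    have := Nat.lt_two_pow_self (n := G)
    omega
  · simp [NExpr.eval, h3, h5, ← hG, add_assoc]
  refine Ends.seq_le (T₁ := 1) (T₂ := G * 4 + 11) (by omega) (Ends.setNat (Q := fun s' =>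
    s' = s₁.writeNat 7 0 L) (fun _ => ?_) ?_) fun s₂ _ e₂ => ?_
  · simp [NExpr.eval, e₁, h2, h4, hL']
    omega
  · simp [NExpr.eval, e₁, h2, h4, hL']
  refine Ends.seq_le (T₁ := 1) (T₂ := G * 4 + 9) (by omega) (Ends.setNat (Q := fun s' =>
    s' = s₂.writeNat 8 0 (4 * L)) (fun _ => ?_) ?_) fun s₃ _ e₃ => ?_
  · simpa [NExpr.eval, e₂]
  · simp [NExpr.eval, e₂]
  refine Ends.seq_le (T₁ := 1) (T₂ := G * 4 + 7) (by omega) (Ends.setNat (Q := fun s' =>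
    s' = s₃.writeNat 9 0 (sampleSize d e u)) (fun _ => ?_) ?_) fun s₄ _ e₄ => ?_
  · simpa [NExpr.eval, e₃, e₂, e₁, h2, h5, sampleSize] using hS
  · simp [NExpr.eval, e₃, e₂, e₁, h2, h5, sampleSize]
  refine Ends.seq_le (T₁ := 1) (T₂ := G * 4 + 5) (by omega) (Ends.setNat (Q := fun s' =>
    s' = s₄.writeNat 10 0 (G ^ d)) (fun _ => ?_) ?_) fun s₅ _ e₅ => ?_
  · simpa [eval_powExpr, NExpr.eval, e₄, e₃, e₂, e₁]
  · simp [eval_powExpr, NExpr.eval, e₄, e₃, e₂, e₁]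
  have hf : Frame [6, 7, 8, 9, 10] [] s s₅ := by
    rw [e₅, e₄, e₃, e₂, e₁]
    exact (((((Frame.refl _ _ _).writeNat (by simp)).writeNat (by simp)).writeNat
      (by simp)).writeNat (by simp)).writeNat (by simp)
  refine (makePowers_ends (G := G) ?_ ?_).mono (by omega) ?_
  · simp [e₅, e₄, e₃, e₂, e₁]
  · exact hMG
  rintro s' - ⟨hf', h8⟩
  have hcell : ∀ a, a ≠ 11 → a ≠ 37 → s'.nat a = s₅.nat a := fun a h h' =>
    hf'.nat a (by simp [h, h'])
  refine ⟨(hf.mono (by simp) (by simp)).trans (hf'.mono (by simp) (by simp)), ?_, ?_, ?_, ?_, ?_,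
    h8⟩
  · simp [hcell 6, e₅, e₄, e₃, e₂, e₁]
  · simp [hcell 7, e₅, e₄, e₃, e₂]
  · simp [hcell 8, e₅, e₄, e₃]
  · simp [hcell 9, e₅, e₄]
  · simp [hcell 10, e₅]

/-- Compute the parameters. -/
def setup (d : ℕ) : Cmd :=
  .seq (doubling 2 3 (.conj (.ltReal (.mul (.cast (.var 2)) (.get 0 (.lit 0))) (.cast (.lit 1)))
    (.neg (.ltNat (.get 0 (.lit 1)) (.var 2)))))
  (.seq (doubling 4 5 (.ltNat (.var 4) (.add (.var 3) (.lit 1)))) (tables d))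

/-- The parameters for the input in `s`. -/
def params (d : ℕ) (s : State) (e u : ℕ) : Params where
  n := s.nat 0 0
  m := s.nat 0 1
  R := 2 ^ e
  H := e + u + extra d
  S := sampleSize d e u
  points := s.real 1
  lo := s.real 2
  hi := s.real 3

/-- `m < 2 ^ m` ends the first doubling after at most `m` rounds even for tiny `ε`, so the
parameters cost O(m) steps for fixed `d`. -/
theorem setup_ends {d m : ℕ} {s : State} (hm : s.nat 0 1 = m) (hW : 2 * (m + 1) ≤ σ.word)
    (hW' : ∀ e u, Scales m (s.real 0 0) e u → 2 ^ (e + u + extra d + 2) ≤ σ.word ∧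
      (e + u + extra d + 2) ^ d ≤ σ.word ∧ sampleSize d e u + m ≤ σ.word) :
    Ends σ (setup d) s ((m + 1) * (8 + (2 * d + 11) * 4) + 27) (fun s' =>
      Frame [2, 3, 4, 5, 6, 7, 8, 9, 10, 11, 37] [] s s' ∧
      ∃ e u, Scales m (s.real 0 0) e u ∧ Holds d (params d s e u) s') := by
  obtain ⟨X, hX⟩ : ∃ X, (m + 1) * ((2 * d + 11) * 4) = X := ⟨_, rfl⟩
  refine (Ends.seq (T₁ := m * 4 + 5) (T₂ := (m + 1) * 4 + X + 21) (doubling_ends (by simp)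
    (fun v => (v : ℝ) * s.real 0 0 < 1 ∧ v ≤ m) m ?_ ?_ (by omega) ?_) fun s₁ _ h₁ => ?_).mono
    (by rw [mul_add, hX]; omega) fun _ _ h => h
  · intro s' hf
    simp [BExpr.eval, RExpr.eval, NExpr.eval, hf.nat 0 (by simp), hf.real 0 (by simp), hm]
  · rintro ⟨-, h⟩
    exact absurd h (by simpa using Nat.lt_two_pow_self)
  · rintro v ⟨-, h⟩
    omega
  obtain ⟨hf₁, e, hem, h2, h3, hpred, hnot⟩ := h₁
  refine Ends.seq_le (T₁ := (m + 1) * 4 + 5) (T₂ := X + 15) (by omega) ((doubling_ends (by simp)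
    (fun v => v < e + 1) (e + 1) ?_ ?_ (by omega) ?_).mono (by omega) fun _ _ h => h)
    fun s₂ _ h₂ => ?_
  · intro s' hf
    simp [BExpr.eval, NExpr.eval, hf.nat 3 (by simp), h3]
  · exact not_lt.2 Nat.lt_two_pow_self.le
  · intro v h
    omega
  obtain ⟨hf₂, u, -, h4, h5, hpred', hnot'⟩ := h₂
  have hsc : Scales m (s.real 0 0) e u := by
    refine ⟨by simpa using hpred, fun h => ?_, hpred', by simpa using hnot'⟩
    by_contra hc
    exact hnot ⟨by simpa using h, by simpa using hc⟩
  obtain ⟨hM, hT, hS⟩ := hW' e u hsc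
  have hGX : (e + u + extra d + 2) * 4 ≤ X := by
    rw [← hX]
    calc _ ≤ (2 * d + 11) * (e + 1) * 4 := by gcongr; exact hsc.height_le
      _ ≤ (2 * d + 11) * (m + 1) * 4 := by gcongr
      _ = _ := by ring
  have h2' : s₂.nat 2 0 = 2 ^ e := by rw [hf₂.nat 2 (by simp), h2]
  refine (tables_ends (d := d) h2' (by rw [hf₂.nat 3 (by simp), h3]) h4 h5 hM hT (by omega)).mono
    (by omega) ?_
  rintro s' - ⟨hf₃, h6, h7, h8, h9, h10, h11⟩
  have hf : Frame [2, 3, 4, 5, 6, 7, 8, 9, 10, 11, 37] [] s s' :=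
    ((hf₁.mono (by simp) (by simp)).trans (hf₂.mono (by simp) (by simp))).trans
      (hf₃.mono (by simp) (by simp))
  refine ⟨hf, e, u, hsc, ?_⟩
  exact ⟨by rw [hf.nat 0 (by simp)]; rfl, by rw [hf.nat 0 (by simp)]; rfl,
    by rw [hf₃.nat 2 (by simp), h2']; rfl, h6, h7, h8, h9, h10, h11, hf.real 1 (by simp),
    hf.real 2 (by simp), hf.real 3 (by simp)⟩

/-- Output the lower corners of all boxes. -/
def copyCorners (d : ℕ) : Cmd :=
  .seq (forLoop 38 (.get 0 (.lit 1)) (seqN d fun j =>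
    .setReal 4 (addr d (.var 38) j) (.get 2 (addr d (.var 38) j))))
  (.assign 1 (.get 0 (.lit 1)))

theorem copyCorners_ends {d m : ℕ} {s : State} (hm : s.nat 0 1 = m) :
    Ends σ (copyCorners d) s (m * (d * 2 + 4) + 5) (fun s' => s'.nat 1 0 = m ∧
      ∀ i < m, ∀ j < d, s'.real 4 (i * d + j) = s.real 2 (i * d + j)) := by
  refine Ends.pre fun hbd => ?_
  have hmW : m ≤ σ.word := hm ▸ hbd 0 1
  refine (Ends.seq (T₁ := m * (d * (1 + 1) + 1 + 3) + 3) (T₂ := 1)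
    (Q₁ := fun s' => Frame [38] [4] s s' ∧
      ∀ i < m, ∀ j < d, s'.real 4 (i * d + j) = s.real 2 (i * d + j))
    ((Ends.forLoop (fun q s' => Frame [38] [4] s s' ∧
      ∀ i < q, ∀ j < d, s'.real 4 (i * d + j) = s.real 2 (i * d + j)) m hmW ?_ ?_ ?_).mono le_rfl
      fun _ _ h => h.1) fun s' _ h => Ends.setNat (fun _ => ?_) ⟨?_, ?_⟩).mono (by nlinarith)
      fun _ _ h => h
  · rintro q - s' ⟨hf, -⟩
    simp [NExpr.eval, hf.nat 0 (by simp), hm]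
  · exact ⟨(Frame.refl _ _ _).writeNat (by simp), by simp⟩
  · rintro q hq s' - ⟨hf, h⟩ h38
    refine (Ends.seqN (T := 1) (fun j s'' => Frame [38] [4] s s'' ∧ s''.nat 38 0 = q ∧
      (∀ i < q, ∀ j < d, s''.real 4 (i * d + j) = s.real 2 (i * d + j)) ∧
      ∀ j' < j, s''.real 4 (q * d + j') = s.real 2 (q * d + j')) d ⟨hf, h38, h, by simp⟩
      ?_).mono le_rfl ?_
    · rintro j hj s'' - ⟨hf', h38', h1, h2⟩
      refine Ends.setReal ⟨hf'.writeReal (by simp), h38', fun i hi j' hj' => ?_, fun j' hj' => ?_⟩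
      · have : i * d + j' ≠ q * d + j := by
          have : (i + 1) * d ≤ q * d := Nat.mul_le_mul_right d hi
          rw [add_mul] at this
          omega
        simp [eval_addr, NExpr.eval, h38', this, h1 i hi j' hj']
      · rcases (show j' < j ∨ j' = j by omega) with h3 | rfl
        · simp [eval_addr, NExpr.eval, h38', h3.ne, h2 j' h3]
        · simp [eval_addr, NExpr.eval, RExpr.eval, h38', hf'.real 2 (by simp)]
    · rintro s'' - ⟨hf', h38', h1, h2⟩
      refine ⟨h38', hf'.writeNat (by simp), fun i hi => ?_⟩
      rcases (show i < q ∨ i = q by omega) with h3 | rfl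
      · exact h1 i h3
      · exact h2
  · simpa [NExpr.eval, h.1.nat 0 (by simp), hm] using hmW
  · simp [NExpr.eval, h.1.nat 0 (by simp), hm]
  · exact h.2

end RealRAM

namespace RealRAM

/-! ### The algorithm -/

/-- The input in `s` is described by the chosen parameters. -/
theorem describes_params {d n m : ℕ} (hd : 0 < d) (P : Fin n → BoxNet.Point d)
    (B : Fin m → BoxNet.Box d) (ε : ℝ) (e u : ℕ) :
    Describes (params d (BoxNet.input P B ε) e u) P B := by
  have h1 : ∀ (i : ℕ) (j : Fin d), (i * d + j) / d = i := fun i j => by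
    rw [mul_comm, Nat.mul_add_div hd, Nat.div_eq_of_lt j.2, add_zero]
  have h2 : ∀ (i : ℕ) (j : Fin d), (i * d + j) % d = j := fun i j => by
    rw [mul_comm, Nat.mul_add_mod, Nat.mod_eq_of_lt j.2]
  constructor <;> simp [params, BoxNet.input, hd, h1, h2]

theorem lo_le_hi {d n : ℕ} {P : Fin n → BoxNet.Point d} {ε : ℝ} (hε : 0 < ε) (hn : 0 < n)
    {b : BoxNet.Box d} (hb : BoxNet.Heavy P ε b) (j : Fin d) : b.lo j ≤ b.hi j := by
  classical
  have h1 : 0 < BoxNet.countIn P b := by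
    have : (0 : ℝ) < ε * n := by positivity
    exact_mod_cast this.trans_le hb
  obtain ⟨i, hi⟩ := Finset.card_pos.1 h1
  have h2 := (Finset.mem_filter.1 hi).2
  exact (h2.1 j).trans (h2.2 j)

theorem pierces_output {d n m : ℕ} {p : Params} {P : Fin n → BoxNet.Point d}
    {B : Fin m → BoxNet.Box d} (hp : Describes p P B) {s : State}
    (h : ∀ b < m, ∃ i, Hits d p s b i) : BoxNet.Pierces (BoxNet.output d s) B := by
  intro b
  obtain ⟨i, hi, hin⟩ := h b b.2
  refine ⟨fun j : Fin d => s.real 4 (i * d + j), ?_, fun j => ?_, fun j => ?_⟩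
  · exact Finset.mem_image.2 ⟨i, Finset.mem_range.2 hi, rfl⟩
  · rw [← hp.lo b j]
    exact (hin j j.2).1
  · rw [← hp.hi b j]
    exact (hin j j.2).2

theorem card_output_le (d : ℕ) (s : State) : (BoxNet.output d s).card ≤ s.nat 1 0 :=
  Finset.card_image_le.trans (Finset.card_range _).le

/-- The algorithm. -/
def netProgram (d : ℕ) : Cmd :=
  .seq (setup d) (.branch (.conj
    (.neg (.ltReal (.mul (.cast (.var 2)) (.get 0 (.lit 0))) (.cast (.lit 1))))
    (.ltNat (.var 9) (.get 0 (.lit 1)))) (trials d) (copyCorners d))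

/-- The factor in the running time. -/
def netFactor (d : ℕ) : ℕ := 2 * timeFactor d + 2 * (8 + (2 * d + 11) * 4) + 2 * d + 40

/-- What has to hold of the runs of the algorithm. -/
noncomputable def netGoal {d m : ℕ} (n : ℕ) (B : Fin m → BoxNet.Box d) (ε : ℝ) : Goal where
  word := (n + m + 1) ^ wordExponent d
  post s := BoxNet.Pierces (BoxNet.output d s) B ∧ ((BoxNet.output d s).card : ℝ) ≤
    (48 * sampleFactor d + 10) * (ε⁻¹ * BoxNet.lglg ε)

/-- Trials run only if `2 ^ e` has really reached `ε⁻¹` and the sample is smaller than `m`, so that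
their time fits into the bound. Otherwise `m` itself is within the size bound, and all lower corners
may be output. -/
theorem cost_netProgram_le {d n m : ℕ} (hd : 2 ≤ d) (hn : 1 ≤ n) (hm : 1 ≤ m)
    (P : Fin n → BoxNet.Point d) (B : Fin m → BoxNet.Box d) {ε : ℝ} (hε : 0 < ε) (hε1 : ε < 1)
    (hB : ∀ j, BoxNet.Heavy P ε (B j)) (t : ℕ) :
    cost (netGoal n B ε) t (start (netProgram d) (BoxNet.input P B ε)) ≤
      ENNReal.ofReal (netFactor d * 4 ^ d * (m * BoxNet.lg ε ^ d)) := by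
  set σ := netGoal n B ε with hσ
  set s := BoxNet.input P B ε with hs
  have hword : σ.word = (n + m + 1) ^ wordExponent d := rfl
  have hw2 : (n + m + 1) ^ 2 ≤ σ.word :=
    Nat.pow_le_pow_right (by omega) (by unfold wordExponent; omega)
  have hbd : Bounded σ.word s := by
    intro a i
    have : s.nat a i ≤ n + m := by
      rw [hs]
      simp only [BoxNet.input]
      split_ifs <;> omega
    nlinarith
  have hs0 : s.real 0 0 = ε := by simp [hs, BoxNet.input]
  have hsm : s.nat 0 1 = m := by simp [hs, BoxNet.input]
  have hscale : ∀ e u, Scales m ε e u → 2 ^ (e + u + extra d + 2) ≤ σ.word ∧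
      (e + u + extra d + 2) ^ d ≤ σ.word ∧ sampleSize d e u + m ≤ σ.word :=
    fun e u h => h.word_bounds hm (by omega)
  have hl : 1 ≤ BoxNet.lg ε := le_max_left _ _
  -- Steps are counted in powers of `e + 1 ≤ 4 * lg ε`, whence the factor `4 ^ d`.
  have hbound : ∀ (N e u : ℕ), Scales m ε e u → N ≤ netFactor d * (m * (e + 1) ^ d) →
      (N : ℝ≥0∞) ≤ ENNReal.ofReal (netFactor d * 4 ^ d * (m * BoxNet.lg ε ^ d)) := by
    intro N e u h hN
    rw [← ENNReal.ofReal_natCast]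
    refine ENNReal.ofReal_le_ofReal ?_
    have h1 : (N : ℝ) ≤ netFactor d * (m * ((e : ℝ) + 1) ^ d) := by exact_mod_cast hN
    refine h1.trans ?_
    calc (netFactor d : ℝ) * (m * ((e : ℝ) + 1) ^ d)
        ≤ netFactor d * (m * (4 * BoxNet.lg ε) ^ d) := by
          gcongr
          exact h.add_one_le_lg hε
      _ = _ := by rw [mul_pow]; ring
  have hc1 := Ends.step_le (σ := σ) (p := netProgram d) (s' := s) hbd (k := [])
    (p' := [setup d, .branch (.conj
      (.neg (.ltReal (.mul (.cast (.var 2)) (.get 0 (.lit 0))) (.cast (.lit 1))))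
      (.ltNat (.var 9) (.get 0 (.lit 1)))) (trials d) (copyCorners d)])
    (by simp [netProgram, step]) t
  obtain ⟨s₁, hb₁, ⟨hf, e, u, hsc, hH⟩, hc2⟩ := setup_ends (σ := σ) (d := d) hsm (by nlinarith)
    (by rw [hs0]; exact hscale) hbd [.branch (.conj
      (.neg (.ltReal (.mul (.cast (.var 2)) (.get 0 (.lit 0))) (.cast (.lit 1))))
      (.ltNat (.var 9) (.get 0 (.lit 1)))) (trials d) (copyCorners d)] t
  rw [hs0] at hsc
  obtain ⟨hW1, -, hW3⟩ := hscale e u hsc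
  have hp := describes_params (by omega) P B ε e u
  rw [← hs] at hp
  have hE : m ≤ m * (e + 1) ^ d := Nat.le_mul_of_pos_right _ (by positivity)
  have htest : (BExpr.conj
      (.neg (.ltReal (.mul (.cast (.var 2)) (.get 0 (.lit 0))) (.cast (.lit 1))))
      (.ltNat (.var 9) (.get 0 (.lit 1)))).eval s₁ ↔
      1 ≤ 2 ^ e * ε ∧ sampleSize d e u < m := by
    have h1 := hH.R
    have h2 := hH.S
    have h3 := hH.m
    simp only [params] at h1 h2 h3
    simp [BExpr.eval, RExpr.eval, NExpr.eval, h1, h2, h3, hf.real 0, hs0, hsm]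
  have hfactor : 1 ≤ sampleFactor d := by
    unfold sampleFactor
    omega
  have hsize : 2 ^ e ≤ sampleSize d e u := by
    unfold sampleSize
    calc 2 ^ e = 1 * 2 ^ e * (1 * 1) := by ring
      _ ≤ _ := by gcongr <;> omega
  have hcard := hsc.size_le (d := d) hε hε1
  by_cases hb : 1 ≤ 2 ^ e * ε ∧ sampleSize d e u < m
  · have hc3 := Ends.step_le (σ := σ) (p := .branch (.conj
      (.neg (.ltReal (.mul (.cast (.var 2)) (.get 0 (.lit 0))) (.cast (.lit 1))))
      (.ltNat (.var 9) (.get 0 (.lit 1)))) (trials d) (copyCorners d)) (s' := s₁) hb₁ (k := [])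
      (p' := [trials d]) (by simp [step, htest.2 hb]) t
    have h36 : s₁.nat 36 0 = 0 := by
      rw [hf.nat 36 (by simp)]
      simp [hs, BoxNet.input]
    have hc4 := cost_trials_le (σ := σ) hp hε (by omega) (by omega) hB rfl (by linarith [hb.1])
      hsc.mul_le_pow hsc.sample_le_pow le_rfl
      (fun b hb' j hj => by
        rw [hp.card_boxes] at hb'
        rw [hp.lo ⟨b, hb'⟩ ⟨j, hj⟩, hp.hi ⟨b, hb'⟩ ⟨j, hj⟩]
        exact lo_le_hi hε (by omega) (hB _) _) hW1 (by rw [hp.card_boxes]; exact hW3)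
      (fun s' _ h1 h2 => ⟨pierces_output hp (hp.card_boxes ▸ h2), by
        refine le_trans ?_ hcard
        exact_mod_cast (card_output_le d s').trans h1⟩) t s₁ hb₁ hH h36
    have htime := hsc.trialTime_le hd (p := params d s e u) rfl hp.card_boxes hb.2
      (hsize.trans hb.2.le)
    refine (hc1.trans (add_le_add_right (hc2.trans (add_le_add_right
      (hc3.trans (add_le_add_right hc4 _)) _)) _)).trans ?_
    refine le_trans (le_of_eq ?_) (hbound (1 + (((m + 1) * (8 + (2 * d + 11) * 4) + 27) +
      (1 + 2 * (trialTime d (params d s e u) + 1)))) e u hsc ?_)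
    · push_cast
      ring
    · unfold netFactor
      nlinarith
  · have hc3 := Ends.step_le (σ := σ) (p := .branch (.conj
      (.neg (.ltReal (.mul (.cast (.var 2)) (.get 0 (.lit 0))) (.cast (.lit 1))))
      (.ltNat (.var 9) (.get 0 (.lit 1)))) (trials d) (copyCorners d)) (s' := s₁) hb₁ (k := [])
      (p' := [copyCorners d]) (by simp only [step, htest, if_neg hb]; rfl) t
    have hm₁ : s₁.nat 0 1 = m := by rw [hf.nat 0 (by simp), hsm]
    obtain ⟨s₂, hb₂, ⟨h1, h2⟩, hc4⟩ := copyCorners_ends (σ := σ) (d := d) hm₁ hb₁ [] t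
    have hpierce : BoxNet.Pierces (BoxNet.output d s₂) B := by
      refine pierces_output hp fun b hb' => ⟨b, h1 ▸ hb', fun j hj => ?_⟩
      rw [outPoint, h2 b hb' j hj, hH.lo, hp.lo ⟨b, hb'⟩ ⟨j, hj⟩, hp.hi ⟨b, hb'⟩ ⟨j, hj⟩]
      exact ⟨le_rfl, lo_le_hi hε (by omega) (hB _) _⟩
    have hpost : σ.post s₂ := by
      refine ⟨hpierce, ?_⟩
      have hcm : ((BoxNet.output d s₂).card : ℝ) ≤ m := by
        exact_mod_cast h1 ▸ card_output_le d s₂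
      refine hcm.trans ?_
      -- Either the doubling was stopped by `m`, so `m < 2 ^ e`, or the sample is at least as large
      -- as `m`; both are below the size bound.
      rcases lt_or_ge (2 ^ e * ε) 1 with h3 | h3
      · have h4 : (m : ℝ) ≤ 2 ^ e := by exact_mod_cast (hsc.lt_of_lt h3).le
        refine h4.trans (le_trans ?_ hcard)
        exact_mod_cast (by omega : 2 ^ e ≤ sampleSize d e u + 5 * 2 ^ e)
      · have h4 : m ≤ sampleSize d e u := not_lt.1 fun h4 => hb ⟨h3, h4⟩
        refine le_trans ?_ hcard
        exact_mod_cast h4.trans (Nat.le_add_right _ _)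
    rw [cost_halted hb₂ hpost, add_zero] at hc4
    refine (hc1.trans (add_le_add_right (hc2.trans (add_le_add_right
      (hc3.trans (add_le_add_right hc4 _)) _)) _)).trans ?_
    refine le_trans (le_of_eq ?_) (hbound (1 + (((m + 1) * (8 + (2 * d + 11) * 4) + 27) +
      (1 + (m * (d * 2 + 4) + 5)))) e u hsc ?_)
    · push_cast
      ring
    · unfold netFactor
      nlinarith

end RealRAM

theorem mainTheorem10 (d : ℕ) (hd : 2 ≤ d) :
    ∃ (prog : RealRAM.Cmd) (C : ℝ) (K : ℕ), 0 < C ∧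
      ∀ (n m : ℕ), 1 ≤ n → 1 ≤ m →
      ∀ (P : Fin n → BoxNet.Point d) (B : Fin m → BoxNet.Box d) (ε : ℝ),
        0 < ε → ε < 1 → (∀ j, BoxNet.Heavy P ε (B j)) →
        RealRAM.expectedTime prog (BoxNet.input P B ε)
            ≤ ENNReal.ofReal (C * ((m : ℝ) * BoxNet.lg ε ^ d)) ∧
        RealRAM.WordBound prog (BoxNet.input P B ε) ((n + m + 1) ^ K) ∧
        ∀ s : RealRAM.State, RealRAM.Outcome prog (BoxNet.input P B ε) s →
          BoxNet.IsWeakNet P B ε (BoxNet.output d s) ∧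
          BoxNet.Pierces (BoxNet.output d s) B ∧
          ((BoxNet.output d s).card : ℝ) ≤ C * (ε⁻¹ * BoxNet.lglg ε) := by
  -- One constant has to serve time and size, so it is the sum of the two.
  refine ⟨RealRAM.netProgram d, RealRAM.netFactor d * 4 ^ d +
    (48 * RealRAM.sampleFactor d + 10),
    RealRAM.wordExponent d, ?_, fun n m hn hm P B ε hε hε1 hB => ?_⟩
  · have : 0 ≤ (RealRAM.netFactor d : ℝ) * 4 ^ d := by positivity
    positivity
  have hl : 1 ≤ BoxNet.lg ε := le_max_left _ _
  have hll : 1 ≤ BoxNet.lglg ε := le_max_left _ _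
  obtain ⟨h1, h2, h3⟩ := RealRAM.of_cost_le ENNReal.ofReal_ne_top
    (RealRAM.cost_netProgram_le hd hn hm P B hε hε1 hB)
  refine ⟨h1.trans (ENNReal.ofReal_le_ofReal ?_), h2, fun s hs => ?_⟩
  · gcongr
    have : (0 : ℝ) ≤ 48 * RealRAM.sampleFactor d + 10 := by positivity
    linarith
  · obtain ⟨h4, h5⟩ := h3 s hs
    refine ⟨fun j _ => h4 j, h4, h5.trans ?_⟩
    gcongr ?_ * _
    have : (0 : ℝ) ≤ RealRAM.netFactor d * 4 ^ d := by positivity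
    linarith
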